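/- **Setting.** Let $d\in\mathbb N$ and let $\Gamma\subset\mathbb R^d$ be the lattice generated over $\mathbb Z$ by a basis $\gamma_1,\dots,\gamma_d$ of $\mathbb R^d$. Let $\Gamma^*$ be the dual lattice, generated by the basis $\gamma_1^*,\dots,\gamma_d^*$ with $\gamma_i\cdot\gamma_j^*=2\pi\delta_{ij}$, and let $M$, $M^*$ be the centered fundamental cells of $\Gamma$, $\Gamma^*$ (coefficients in $[-\frac12,\frac12]$). Let $\mathcal H_{\rm f}=L^2(\mathbb T^d)$, $\mathbb T^d=\mathbb R^d/\Gamma$, i.e. $L^2(M)$ with Lebesgue measure. For $\gamma^*\in\Gamma^*$ let $\tau(\gamma^*)$ be the unitary operator $(\tau(\gamma^*)\varphi)(y)=e^{\mathrm i y\cdot\gamma^*}\varphi(y)$ on $\mathcal H_{\rm f}$, and let $$\mathcal H_\tau=\{\varphi\in L^2_{\rm loc}(\mathbb R^d,\mathcal H_{\rm f}):\ \varphi(k-\gamma^*)=\tau(\gamma^*)\varphi(k)\ \text{for all }\gamma^*\in\Gamma^*\},\qquad \langle\varphi,\psi\rangle=\int_{M^*}\langle\varphi(k),\psi(k)\rangle_{\mathcal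 H_{\rm f}}\,dk,$$ with $dk$ the normalized Lebesgue measure on $M^*$. The Zak transform $\mathcal U:L^2(\mathbb R^d)\to\mathcal H_\tau$ is the unique unitary operator such that $$(\mathcal U\psi)(k,y)=\sum_{\gamma\in\Gamma}e^{-\mathrm i(y+\gamma)\cdot k}\,\psi(y+\gamma)\qquad(\psi\in\mathcal S(\mathbb R^d)).$$ *Symbols.* $S^1$ is the set of smooth functions on $\mathbb R^{2d}$ (with values in a normed space) all of whose derivatives are bounded. For $\varepsilon_0>0$, $S^1(\varepsilon)$ is the set of maps $[0,\varepsilon_0)\ni\varepsilon\mapsto A_\varepsilon\in S^1$ for which there are $A_j\in S^1$ such that, for every $n$, all derivatives of $A_\varepsilon-\sum_{j<n}\varepsilon^jA_j$ are bounded by a constant times $\varepsilon^n$, uniformly in $\varepsilon\in[0,\varepsilon_0)$ and on $\mathbb R^{2d}$. $S^1_\tau(\varepsilon)$ is the set of $\mathcal B(\mathcal H_{\rm f})$-valued $A_\varepsilon\in S^1(\varepsilon)$ with $A_\varepsilon(k-\gamma^*,r)=\tau(\gamma^*)A_\varepsilon(k,r)\tau(\gamma^*)^{-1}$ for all $\gamma^*\in\Gamma^*$;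 a scalar symbol is regarded as a multiple of the identity of $\mathcal H_{\rm f}$. *Quantization.* For a smooth bounded operator-valued symbol $\sigma$ with bounded derivatives, the Weyl quantization $\sigma(x,-\mathrm i\nabla_x)$ is given on Schwartz functions by $$\big(\sigma(x,-\mathrm i\nabla_x)\chi\big)(x)=(2\pi)^{-d}\int d\xi\int dy\ e^{\mathrm i\xi\cdot(x-y)}\,\sigma\big(\tfrac12(x+y),\xi\big)\chi(y)$$ and is extended to tempered distributions by duality, $\langle\chi,\sigma(x,-\mathrm i\nabla_x)f\rangle=\langle\sigma^*(x,-\mathrm i\nabla_x)\chi,f\rangle$, where $\sigma^*$ is the pointwise adjoint. Then $a(\varepsilon x,-\mathrm i\nabla_x)$ is the quantization of $(x,\xi)\mapsto a(\varepsilon x,\xi)$, and $b(k,\mathrm i\varepsilon\nabla_k)$ is the quantization, in the variables $(k,-\mathrm i\nabla_k)$, of $(k,\eta)\mapsto b(k,-\varepsilon\eta)$. **Proposition.** The Zak transform $\mathcal U$ exists and is unique. Let $a\in S^1(\varepsilon)$ be complex-valued and $\Gamma^*$-periodic in momentum, $a_\varepsilon(r,k+\gamma^*)=a_\varepsilon(r,k)$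 for all $\gamma^*\in\Gamma^*$, $r,k\in\mathbb R^d$, $\varepsilon\in[0,\varepsilon_0)$, and let $b_\varepsilon(k,r)=a_\varepsilon(r,k)$. Then $b\in S^1(\varepsilon)$ and $b\in S^1_\tau(\varepsilon)$, and for every $\varepsilon\in[0,\varepsilon_0)$ the Weyl quantizations $\widehat a=a_\varepsilon(\varepsilon x,-\mathrm i\nabla_x)$ and $\widehat b=b_\varepsilon(k,\mathrm i\varepsilon\nabla_k)$ are (uniquely determined) bounded operators on $L^2(\mathbb R^d)$ and on $\mathcal H_\tau$ respectively, and $$\widehat a=\mathcal U^*\,\widehat b\,\mathcal U .$$ -/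

import Mathlib

open MeasureTheory Module
open scoped SchwartzMap InnerProductSpace

namespace BlochZak

noncomputable section

/-! ### Lattice, dual lattice, fundamental cells -/

/-- The configuration (and momentum) space `ℝ^d` with its Euclidean structure. -/
abbrev Euc (d : ℕ) : Type := EuclideanSpace ℝ (Fin d)

variable {d : ℕ}

/-- The lattice generated over `ℤ` by a basis `v` of `ℝ^d`. -/
abbrev lattice (v : Basis (Fin d) ℝ (Euc d)) : Submodule ℤ (Euc d) :=
  Submodule.span ℤ (Set.range v)

/-- The centered fundamental cell: all `∑ α_j v_j` with `α_j ∈ [-1/2, 1/2]`. -/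
def cell (v : Basis (Fin d) ℝ (Euc d)) : Set (Euc d) :=
  {x | ∀ j, v.repr x j ∈ Set.Icc (-(1 / 2) : ℝ) (1 / 2)}

/-- The dual basis `v*`, normalized by `⟪v_i, v*_j⟫ = 2π δ_ij` (see `inner_dualBasis`). -/
def dualBasis (v : Basis (Fin d) ℝ (Euc d)) : Basis (Fin d) ℝ (Euc d) :=
  (v.dualBasis.map ((LinearMap.toContinuousLinearMap (𝕜 := ℝ) (E := Euc d) (F' := ℝ)).trans
    (InnerProductSpace.toDual ℝ (Euc d)).symm.toLinearEquiv)).unitsSMul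
      (fun _ => Units.mk0 (2 * Real.pi) (by positivity))

theorem inner_dualBasis (v : Basis (Fin d) ℝ (Euc d)) (i j : Fin d) :
    ⟪v i, dualBasis v j⟫_ℝ = if i = j then 2 * Real.pi else 0 := by
  have h : ⟪v i, dualBasis v j⟫_ℝ
      = 2 * Real.pi * ⟪(InnerProductSpace.toDual ℝ (Euc d)).symm
          (LinearMap.toContinuousLinearMap (v.dualBasis j)), v i⟫_ℝ := by
    rw [real_inner_comm]
    simp [dualBasis, Basis.unitsSMul_apply, Units.smul_def, inner_smul_left]
  rw [h, InnerProductSpace.toDual_symm_apply]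
  by_cases hij : i = j <;> simp [hij]

theorem isCompact_cell (v : Basis (Fin d) ℝ (Euc d)) : IsCompact (cell v) := by
  have h : cell v = v.equivFunL ⁻¹' (Set.pi Set.univ fun _ => Set.Icc (-(1 / 2) : ℝ) (1 / 2)) := by
    ext x
    rw [Set.mem_preimage, Set.mem_univ_pi]
    rfl
  rw [h]
  exact v.equivFunL.toHomeomorph.isCompact_preimage.2 (isCompact_univ_pi fun _ => isCompact_Icc)

/-- Every point is the sum of a point of the cell and a lattice vector. -/
theorem exists_sub_mem_cell (v : Basis (Fin d) ℝ (Euc d)) (x : Euc d) :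
    ∃ g : lattice v, x - (g : Euc d) ∈ cell v := by
  refine ⟨⟨∑ j, (round (v.repr x j)) • v j, ?_⟩, ?_⟩
  · exact Submodule.sum_mem _ fun j _ =>
      Submodule.smul_mem _ _ (Submodule.subset_span (Set.mem_range_self j))
  · intro j
    have h : v.repr (x - ∑ i, (round (v.repr x i)) • v i) j
        = v.repr x j - round (v.repr x j) := by
      simp [map_sum, Finsupp.single_apply, ← Int.cast_smul_eq_zsmul ℝ]
    rw [h]
    have := abs_le.1 (abs_sub_round (v.repr x j))
    exact ⟨this.1, this.2⟩

/-- Lebesgue measure on the cell, normalized to total mass one. -/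
def normalizedCell (v : Basis (Fin d) ℝ (Euc d)) : Measure (Euc d) :=
  (volume (cell v))⁻¹ • volume.restrict (cell v)

/-! ### The fibre space and the representation `τ` -/

/-- `L²(ℝ^d)`. -/
abbrev L2 (d : ℕ) : Type := Lp ℂ 2 (volume : Measure (Euc d))

/-- The fibre Hilbert space `L²(𝕋^d)`, `𝕋^d = ℝ^d / Γ`, with the flat Lebesgue measure. A function
on the torus is represented by its restriction to the fundamental cell of `Γ`. -/
abbrev Fibre (v : Basis (Fin d) ℝ (Euc d)) : Type := Lp ℂ 2 (volume.restrict (cell v))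

/-- The plane wave `e^{i y·g}`. -/
def wave (g y : Euc d) : ℂ := Complex.exp (Complex.I * (⟪y, g⟫_ℝ : ℂ))

theorem norm_wave (g y : Euc d) : ‖wave g y‖ = 1 := by
  rw [wave, mul_comm, Complex.norm_exp_ofReal_mul_I]

theorem wave_neg_mul (g y : Euc d) : wave (-g) y * wave g y = 1 := by
  rw [wave, wave, ← Complex.exp_add]; simp

theorem continuous_wave (g : Euc d) : Continuous (wave g) := by
  unfold wave; fun_prop

theorem memLp_wave_mul (v : Basis (Fin d) ℝ (Euc d)) (g : Euc d) (φ : Fibre v) :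
    MemLp (fun y => wave g y * φ y) 2 (volume.restrict (cell v)) :=
  (Lp.memLp φ).of_le ((continuous_wave g).aestronglyMeasurable.mul (Lp.aestronglyMeasurable φ))
    (Filter.Eventually.of_forall fun y => by simp [norm_wave])

/-- Multiplication by the plane wave, as a map of the fibre space. -/
def waveMul (v : Basis (Fin d) ℝ (Euc d)) (g : Euc d) (φ : Fibre v) : Fibre v :=
  (memLp_wave_mul v g φ).toLp _

theorem coeFn_waveMul (v : Basis (Fin d) ℝ (Euc d)) (g : Euc d) (φ : Fibre v) :
    waveMul v g φ =ᵐ[volume.restrict (cell v)] fun y => wave g y * φ y :=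
  (memLp_wave_mul v g φ).coeFn_toLp

theorem waveMul_neg (v : Basis (Fin d) ℝ (Euc d)) (g : Euc d) (φ : Fibre v) :
    waveMul v (-g) (waveMul v g φ) = φ := by
  apply Lp.ext
  filter_upwards [coeFn_waveMul v (-g) (waveMul v g φ), coeFn_waveMul v g φ] with y h1 h2
  rw [h1, h2, ← mul_assoc, wave_neg_mul, one_mul]

/-- The representation `τ`: the unitary operator `(τ(g) φ)(y) = e^{i y·g} φ(y)`
(used for `g` in the dual lattice `Γ*`). -/
def tau (v : Basis (Fin d) ℝ (Euc d)) (g : Euc d) : Fibre v ≃ₗᵢ[ℂ] Fibre v where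
  toFun := waveMul v g
  invFun := waveMul v (-g)
  left_inv := waveMul_neg v g
  right_inv φ := by simpa using waveMul_neg v (-g) φ
  map_add' φ ψ := by
    apply Lp.ext
    filter_upwards [coeFn_waveMul v g (φ + ψ), coeFn_waveMul v g φ, coeFn_waveMul v g ψ,
      Lp.coeFn_add φ ψ, Lp.coeFn_add (waveMul v g φ) (waveMul v g ψ)] with y h1 h2 h3 h4 h5
    rw [h1, h5, h4, Pi.add_apply, Pi.add_apply, h2, h3, mul_add]
  map_smul' c φ := by
    apply Lp.ext
    filter_upwards [coeFn_waveMul v g (c • φ), coeFn_waveMul v g φ,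
      Lp.coeFn_smul c φ, Lp.coeFn_smul c (waveMul v g φ)] with y h1 h2 h3 h4
    rw [h1, RingHom.id_apply, h4, h3, Pi.smul_apply, Pi.smul_apply, h2, smul_eq_mul, smul_eq_mul]
    ring
  norm_map' φ := by
    change ‖waveMul v g φ‖ = ‖φ‖
    rw [Lp.norm_def, Lp.norm_def]
    congr 1
    apply eLpNorm_congr_norm_ae
    filter_upwards [coeFn_waveMul v g φ] with y h
    rw [h, norm_mul, norm_wave, one_mul]

/-! ### The space `H_τ` -/

theorem normalizedCell_ac (v : Basis (Fin d) ℝ (Euc d)) : normalizedCell v ≪ volume :=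
  (Measure.smul_absolutelyContinuous).trans Measure.absolutelyContinuous_restrict

/-- `H_τ`: (classes of) functions `φ ∈ L²_loc(ℝ^d, L²(𝕋^d))` such that
`φ(k - g) = τ(g) φ(k)` for every `g ∈ Γ*`. -/
def tauSubmodule (v : Basis (Fin d) ℝ (Euc d)) :
    Submodule ℂ (Euc d →ₘ[(volume : Measure (Euc d))] Fibre v) where
  carrier := {φ | (∀ K : Set (Euc d), IsCompact K → MemLp φ 2 (volume.restrict K)) ∧
    ∀ g ∈ lattice (dualBasis v), ∀ᵐ k, φ (k - g) = tau v g (φ k)}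
  zero_mem' := by
    have h0 : ((0 : Euc d →ₘ[(volume : Measure (Euc d))] Fibre v) : Euc d → Fibre v)
        =ᵐ[volume] 0 := AEEqFun.coeFn_zero
    refine ⟨fun K _ => (memLp_congr_ae (ae_restrict_of_ae h0)).2 MemLp.zero, fun g _ => ?_⟩
    filter_upwards [h0, (measurePreserving_sub_right volume g).quasiMeasurePreserving.ae h0]
      with k h1 h2
    rw [h1, h2]; simp
  add_mem' := by
    rintro φ ψ ⟨h1, h2⟩ ⟨h3, h4⟩
    have h0 := AEEqFun.coeFn_add φ ψ
    refine ⟨fun K hK => (memLp_congr_ae (ae_restrict_of_ae h0)).2 ((h1 K hK).add (h3 K hK)),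
      fun g hg => ?_⟩
    filter_upwards [h0, (measurePreserving_sub_right volume g).quasiMeasurePreserving.ae h0,
      h2 g hg, h4 g hg] with k e1 e2 e3 e4
    rw [e1, e2, Pi.add_apply, Pi.add_apply, e3, e4, map_add]
  smul_mem' := by
    rintro c φ ⟨h1, h2⟩
    have h0 := AEEqFun.coeFn_smul c φ
    refine ⟨fun K hK => (memLp_congr_ae (ae_restrict_of_ae h0)).2 ((h1 K hK).const_smul c),
      fun g hg => ?_⟩
    filter_upwards [h0, (measurePreserving_sub_right volume g).quasiMeasurePreserving.ae h0,
      h2 g hg] with k e1 e2 e3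
    rw [e1, e2, Pi.smul_apply, Pi.smul_apply, e3, map_smul]

/-- The Hilbert space `H_τ`, as a type. -/
abbrev HTau (v : Basis (Fin d) ℝ (Euc d)) : Type := ↥(tauSubmodule v)

theorem memLp_normalizedCell (v : Basis (Fin d) ℝ (Euc d)) (φ : HTau v) :
    MemLp (φ : Euc d →ₘ[(volume : Measure (Euc d))] Fibre v) 2 (normalizedCell (dualBasis v)) := by
  refine (φ.2.1 _ (isCompact_cell (dualBasis v))).smul_measure ?_
  rw [ENNReal.inv_ne_top]
  have hint : (interior (cell (dualBasis v))).Nonempty := by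
    set w := dualBasis v
    have h : (w.equivFunL ⁻¹' (Set.pi Set.univ fun _ => Set.Ioo (-(1 / 2) : ℝ) (1 / 2)))
        ⊆ interior (cell w) := by
      refine interior_maximal ?_ ((isOpen_set_pi Set.finite_univ fun _ _ => isOpen_Ioo).preimage
        w.equivFunL.continuous)
      intro x hx j
      have := hx j (Set.mem_univ j)
      exact ⟨this.1.le, this.2.le⟩
    refine ⟨0, h ?_⟩
    intro j _
    simp
  exact (Measure.measure_pos_of_nonempty_interior _ hint).ne'

/-- Restriction of an element of `H_τ` to the cell `M*` of `Γ*`, which carries the normalized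
Lebesgue measure. -/
def restrictCell (v : Basis (Fin d) ℝ (Euc d)) :
    HTau v →ₗ[ℂ] Lp (Fibre v) 2 (normalizedCell (dualBasis v)) where
  toFun φ := (memLp_normalizedCell v φ).toLp _
  map_add' φ ψ := by
    rw [← MemLp.toLp_add]
    exact MemLp.toLp_congr _ _ ((normalizedCell_ac _).ae_eq
      (AEEqFun.coeFn_add (φ : Euc d →ₘ[(volume : Measure (Euc d))] Fibre v) ψ))
  map_smul' c φ := by
    rw [RingHom.id_apply, ← MemLp.toLp_const_smul]
    exact MemLp.toLp_congr _ _ ((normalizedCell_ac _).ae_eq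
      (AEEqFun.coeFn_smul c (φ : Euc d →ₘ[(volume : Measure (Euc d))] Fibre v)))

theorem restrictCell_injective (v : Basis (Fin d) ℝ (Euc d)) :
    Function.Injective (restrictCell v) := by
  rw [injective_iff_map_eq_zero]
  intro φ h
  have h0 : (φ : Euc d →ₘ[(volume : Measure (Euc d))] Fibre v)
      =ᵐ[normalizedCell (dualBasis v)] 0 :=
    (memLp_normalizedCell v φ).coeFn_toLp.symm.trans (Lp.eq_zero_iff_ae_eq_zero.1 h)
  have h1 : ∀ᵐ k : Euc d, k ∈ cell (dualBasis v) →
      (φ : Euc d →ₘ[(volume : Measure (Euc d))] Fibre v) k = 0 := by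
    refine (ae_restrict_iff' (isCompact_cell _).measurableSet).1 ?_
    refine (Measure.absolutelyContinuous_smul ?_).ae_le h0
    exact ENNReal.inv_ne_zero.2 (isCompact_cell _).measure_lt_top.ne
  have : Countable (lattice (dualBasis v)) := by infer_instance
  have h2 : ∀ᵐ k : Euc d, ∀ g : lattice (dualBasis v),
      k - (g : Euc d) ∈ cell (dualBasis v) →
        (φ : Euc d →ₘ[(volume : Measure (Euc d))] Fibre v) (k - (g : Euc d)) = 0 :=
    ae_all_iff.2 fun g =>
      (measurePreserving_sub_right volume (g : Euc d)).quasiMeasurePreserving.ae h1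
  have h3 : ∀ᵐ k : Euc d, ∀ g : lattice (dualBasis v),
      (φ : Euc d →ₘ[(volume : Measure (Euc d))] Fibre v) (k - (g : Euc d))
        = tau v g ((φ : Euc d →ₘ[(volume : Measure (Euc d))] Fibre v) k) :=
    ae_all_iff.2 fun g => φ.2.2 g g.2
  apply Subtype.ext
  apply AEEqFun.ext
  filter_upwards [h2, h3, AEEqFun.coeFn_zero (μ := (volume : Measure (Euc d))) (β := Fibre v)]
    with k e2 e3 e4
  obtain ⟨g, hg⟩ := exists_sub_mem_cell (dualBasis v) k
  have := e3 g
  rw [e2 g hg] at this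
  rw [(tau v g).map_eq_zero_iff.1 this.symm]
  exact e4.symm

/-- The inner product of `H_τ` is `⟪φ, ψ⟫ = ∫_{M*} ⟪φ(k), ψ(k)⟫ dk`, with normalized `dk`. -/
instance instNormedAddCommGroupHTau (v : Basis (Fin d) ℝ (Euc d)) :
    NormedAddCommGroup (HTau v) :=
  NormedAddCommGroup.induced (HTau v) _ (restrictCell v) (restrictCell_injective v)

instance instInnerProductSpaceHTau (v : Basis (Fin d) ℝ (Euc d)) :
    InnerProductSpace ℂ (HTau v) :=
  InnerProductSpace.induced (restrictCell v)

theorem inner_HTau (v : Basis (Fin d) ℝ (Euc d)) (φ ψ : HTau v) :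
    ⟪φ, ψ⟫_ℂ = ∫ k, ⟪(φ : Euc d →ₘ[(volume : Measure (Euc d))] Fibre v) k,
      (ψ : Euc d →ₘ[(volume : Measure (Euc d))] Fibre v) k⟫_ℂ ∂(normalizedCell (dualBasis v)) := by
  change ⟪restrictCell v φ, restrictCell v ψ⟫_ℂ = _
  rw [L2.inner_def]
  refine integral_congr_ae ?_
  filter_upwards [(memLp_normalizedCell v φ).coeFn_toLp, (memLp_normalizedCell v ψ).coeFn_toLp]
    with k h1 h2
  simp only [restrictCell, LinearMap.coe_mk, AddHom.coe_mk]
  rw [h1, h2]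

/-! ### The Zak transform -/

/-- `U : L²(ℝ^d) → H_τ` is the Zak transform: the unitary operator which on Schwartz functions is
`(Uψ)(k, y) = ∑_{g ∈ Γ} e^{-i (y+g)·k} ψ(y+g)`. -/
def IsZakTransform (v : Basis (Fin d) ℝ (Euc d)) (U : L2 d ≃ₗᵢ[ℂ] HTau v) : Prop :=
  ∀ ψ : 𝓢(Euc d, ℂ), ∀ᵐ k : Euc d, ∀ᵐ y ∂(volume.restrict (cell v)),
    (U (ψ.toLp 2) : Euc d →ₘ[(volume : Measure (Euc d))] Fibre v) k y
      = ∑' g : lattice v, wave (-k) (y + (g : Euc d)) * ψ (y + (g : Euc d))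

/-! ### Symbols -/

section Symbols

variable {F : Type*} [NormedAddCommGroup F] [NormedSpace ℝ F]

/-- The symbol class `S¹` (order function `1`): smooth functions on phase space all of whose
derivatives (of order `0, 1, 2, …`) are bounded. -/
def IsSymbol (A : Euc d × Euc d → F) : Prop :=
  ContDiff ℝ (⊤ : ℕ∞) A ∧ ∀ m : ℕ, ∃ C : ℝ, ∀ z, ‖iteratedFDeriv ℝ m A z‖ ≤ C

/-- The class `S¹(ε)` of semiclassical symbols of order `1`: maps `[0, ε₀) → S¹` with an
asymptotic expansion `A_ε ≍ ∑ ε^j A_j` in `S¹`. -/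
def IsSemiclassicalSymbol (ε₀ : ℝ) (A : ℝ → Euc d × Euc d → F) : Prop :=
  (∀ ε ∈ Set.Ico 0 ε₀, IsSymbol (A ε)) ∧
  ∃ A' : ℕ → Euc d × Euc d → F, (∀ j, IsSymbol (A' j)) ∧
    ∀ n m : ℕ, ∃ C : ℝ, ∀ ε ∈ Set.Ico 0 ε₀, ∀ z,
      ‖iteratedFDeriv ℝ m (fun z => A ε z - ∑ j ∈ Finset.range n, ε ^ j • A' j z) z‖ ≤ ε ^ n * C

end Symbols

/-- The class `S¹_τ(ε, B(H_f))`, `H_f = L²(𝕋^d)`, of `τ`-equivariant semiclassical symbols: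
`A_ε(k - g, r) = τ(g) A_ε(k, r) τ(g)⁻¹` for all `g ∈ Γ*`. -/
def IsTauEquivariantSymbol (v : Basis (Fin d) ℝ (Euc d)) (ε₀ : ℝ)
    (A : ℝ → Euc d × Euc d → (Fibre v →L[ℂ] Fibre v)) : Prop :=
  IsSemiclassicalSymbol ε₀ A ∧
  ∀ ε ∈ Set.Ico 0 ε₀, ∀ g ∈ lattice (dualBasis v), ∀ k r (φ : Fibre v),
    A ε (k - g, r) φ = tau v g (A ε (k, r) ((tau v g).symm φ))

/-- A scalar symbol regarded as an operator-valued one: `c(z)` times the identity of `F`. -/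
def scalarSymbol (F : Type*) [NormedAddCommGroup F] [NormedSpace ℂ F]
    (c : Euc d × Euc d → ℂ) : Euc d × Euc d → (F →L[ℂ] F) :=
  fun z => c z • ContinuousLinearMap.id ℂ F

/-! ### Weyl quantization -/

section Weyl

variable {F : Type*} [NormedAddCommGroup F] [InnerProductSpace ℂ F] [CompleteSpace F]

/-- The Weyl quantization `σ(x, -i∇)` acting on a rapidly decreasing function `χ`:
`(2π)^{-d} ∫ dξ ∫ dy e^{i ξ·(x-y)} σ((x+y)/2, ξ) χ(y)`. -/
def weylSchwartz (σ : Euc d × Euc d → (F →L[ℂ] F)) (χ : Euc d → F) (x : Euc d) : F :=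
  ((2 * Real.pi : ℂ) ^ d)⁻¹ • ∫ ξ : Euc d, ∫ y : Euc d,
    wave ξ (x - y) • σ ((1 / 2 : ℝ) • (x + y), ξ) (χ y)

/-- `g = σ(x, -i∇) f`, where `σ(x, -i∇)` acts on tempered distributions by duality: pairing with
a test function `χ`, `⟪χ, σ(x,-i∇) f⟫ = ⟪σ*(x,-i∇) χ, f⟫`, where `σ*` is the pointwise adjoint. -/
def IsWeylImage (σ : Euc d × Euc d → (F →L[ℂ] F)) (f g : Euc d → F) : Prop :=
  ∀ χ : 𝓢(Euc d, F),
    ∫ x, ⟪χ x, g x⟫_ℂ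
      = ∫ x, ⟪weylSchwartz (fun z => ContinuousLinearMap.adjoint (σ z)) χ x, f x⟫_ℂ

end Weyl

/-- The bounded operator `T` on `L²(ℝ^d)` is the Weyl quantization `a(εx, -i∇_x)` of the scalar
symbol `a(r, k)`. -/
def IsWeylOpL2 (ε : ℝ) (a : Euc d × Euc d → ℂ) (T : L2 d →L[ℂ] L2 d) : Prop :=
  ∀ ψ : L2 d, IsWeylImage (scalarSymbol ℂ fun z => a (ε • z.1, z.2)) ψ (T ψ)

/-- The bounded operator `B` on `H_τ` is the Weyl quantization `b(k, iε∇_k)` of the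
operator-valued symbol `b(k, r)`; since `iε∇_k = -ε(-i∇_k)`, this is the quantization in
the variables `(k, -i∇_k)` of `(k, η) ↦ b(k, -εη)`. -/
def IsWeylOpHTau (v : Basis (Fin d) ℝ (Euc d)) (ε : ℝ)
    (b : Euc d × Euc d → (Fibre v →L[ℂ] Fibre v)) (B : HTau v →L[ℂ] HTau v) : Prop :=
  ∀ φ : HTau v, IsWeylImage (fun z => b (z.1, -(ε • z.2)))
    (φ : Euc d →ₘ[(volume : Measure (Euc d))] Fibre v)
    (B φ : Euc d →ₘ[(volume : Measure (Euc d))] Fibre v)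

end

end BlochZak

open BlochZak

open MeasureTheory Module
open scoped SchwartzMap InnerProductSpace Pointwise ComplexConjugate

namespace BlochZak

noncomputable section

variable {d : ℕ}

/-! ### Symbols -/

section SymbolLemmas

variable {F G : Type*} [NormedAddCommGroup F] [NormedSpace ℝ F]
  [NormedAddCommGroup G] [NormedSpace ℝ G]

/-! A symbol periodic in momentum is a superposition of lattice translations. With `α (x, k) = a (ε
x, k)`, expand in a Fourier series in `k`: `α (x, k) = ∑_γ c_γ(x) e^{i γ·k}` over `γ ∈ Γ`. Weyl
quantization turns the `γ`-th term into `ψ ↦ c_γ(x + γ/2) ψ(x + γ)`, so the quantization of `α` is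
the adjoint `T` of `S : f ↦ ∑_γ conj c_γ(x - γ/2) f(x - γ)`. The series for `S` converges in
operator norm because the `c_γ` and all their derivatives decay rapidly in `γ`
(`exists_bound_fourierCoef`). On test functions the quantization of the adjoint symbol is this
lattice sum (`weylSchwartz_periodic_momentum`); with the roles of position and momentum exchanged it
is the Fourier conjugate of the same sum (`weylSchwartz_periodic_position`).

The Zak transform is obtained by matching two orthogonal decompositions indexed by `Γ` with common
fibre `L²(M)`: functions on `ℝ^d` are cut along the cells `M + γ`, and `H_τ` splits into the Bloch
functions `e^{-iγ·k} e^{-iy·k} φ(y)`. Completeness of the latter is completeness of plane waves on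
`M*`. On Schwartz functions both series converge absolutely, which gives the explicit formula;
density gives uniqueness.

For the conjugation, pair `Uψ` with a test function `f(k) ζ`, where `f` is scalar and `ζ` lies in
the fibre. The pairing equals `⟪G, ψ⟫`, where `G` is the unnormalized inverse Fourier transform of
`f` times the `Γ`-periodic extension of `ζ` (`coeFn_zakAdjoint`). Since `S` only translates by `Γ`,
it commutes with multiplication by a `Γ`-periodic function, so `S G` is the function attached to the
transformed test function. This is the duality relation for `U T U*` on elementary test functions
(`integral_inner_zak_adjoint_smul`). General fibre-valued test functions are reached by expanding in
a Hilbert basis of the fibre, and a bounded operator is determined by its pairings with test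
functions. -/

theorem IsSymbol.contDiff {A : Euc d × Euc d → F} (hA : IsSymbol A) {n : ℕ∞} : ContDiff ℝ n A :=
  hA.1.of_le (by exact_mod_cast le_top)

theorem IsSymbol.continuous {A : Euc d × Euc d → F} (hA : IsSymbol A) : Continuous A :=
  hA.1.continuous

theorem IsSymbol.sub {A B : Euc d × Euc d → F} (hA : IsSymbol A) (hB : IsSymbol B) :
    IsSymbol (A - B) := by
  refine ⟨hA.1.sub hB.1, fun m => ?_⟩
  obtain ⟨C, hC⟩ := hA.2 m
  obtain ⟨D, hD⟩ := hB.2 m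
  refine ⟨C + D, fun z => ?_⟩
  rw [iteratedFDeriv_sub_apply hA.contDiff.contDiffAt hB.contDiff.contDiffAt]
  exact (norm_sub_le _ _).trans (add_le_add (hC z) (hD z))

theorem IsSymbol.comp_continuousLinearMap {A : Euc d × Euc d → F} (hA : IsSymbol A)
    (L : Euc d × Euc d →L[ℝ] Euc d × Euc d) : IsSymbol (A ∘ L) := by
  refine ⟨hA.1.comp L.contDiff, fun m => ?_⟩
  obtain ⟨C, hC⟩ := hA.2 m
  refine ⟨C * ∏ _ : Fin m, ‖L‖, fun z => ?_⟩
  rw [L.iteratedFDeriv_comp_right hA.1 z (by exact_mod_cast le_top)]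
  exact (ContinuousMultilinearMap.norm_compContinuousLinearMap_le _ _).trans
    (mul_le_mul_of_nonneg_right (hC _) (by positivity))

theorem norm_iteratedFDeriv_comp_swap (A : Euc d × Euc d → F) (m : ℕ) (z : Euc d × Euc d) :
    ‖iteratedFDeriv ℝ m (fun z => A z.swap) z‖ = ‖iteratedFDeriv ℝ m A z.swap‖ :=
  (LinearIsometryEquiv.prodComm ℝ (Euc d) (Euc d)).norm_iteratedFDeriv_comp_right A z m

theorem IsSymbol.comp_swap {A : Euc d × Euc d → F} (hA : IsSymbol A) :
    IsSymbol (fun z => A z.swap) := by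
  refine ⟨hA.1.comp (contDiff_snd.prodMk contDiff_fst), fun m => ?_⟩
  obtain ⟨C, hC⟩ := hA.2 m
  exact ⟨C, fun z => by rw [norm_iteratedFDeriv_comp_swap]; exact hC _⟩

theorem IsSemiclassicalSymbol.comp_swap {ε₀ : ℝ} {A : ℝ → Euc d × Euc d → F}
    (hA : IsSemiclassicalSymbol ε₀ A) : IsSemiclassicalSymbol ε₀ (fun ε z => A ε z.swap) := by
  obtain ⟨h1, A', h2, h3⟩ := hA
  refine ⟨fun ε hε => (h1 ε hε).comp_swap, fun j z => A' j z.swap, fun j => (h2 j).comp_swap,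
    fun n m => ?_⟩
  obtain ⟨C, hC⟩ := h3 n m
  refine ⟨C, fun ε hε z => ?_⟩
  rw [norm_iteratedFDeriv_comp_swap (fun z => A ε z - ∑ j ∈ Finset.range n, ε ^ j • A' j z)]
  exact hC ε hε _

theorem IsSymbol.continuousLinearMap_comp {A : Euc d × Euc d → F} (hA : IsSymbol A)
    (L : F →L[ℝ] G) : IsSymbol (fun z => L (A z)) := by
  refine ⟨L.contDiff.comp hA.1, fun m => ?_⟩
  obtain ⟨C, hC⟩ := hA.2 m
  refine ⟨‖L‖ * C, fun z => ?_⟩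
  exact (L.norm_iteratedFDeriv_comp_left (hA.contDiff (n := m)).contDiffAt le_rfl).trans
    (mul_le_mul_of_nonneg_left (hC z) (norm_nonneg _))

theorem IsSemiclassicalSymbol.continuousLinearMap_comp {ε₀ : ℝ} {A : ℝ → Euc d × Euc d → F}
    (hA : IsSemiclassicalSymbol ε₀ A) (L : F →L[ℝ] G) :
    IsSemiclassicalSymbol ε₀ (fun ε z => L (A ε z)) := by
  obtain ⟨h1, A', h2, h3⟩ := hA
  refine ⟨fun ε hε => (h1 ε hε).continuousLinearMap_comp L, fun j z => L (A' j z),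
    fun j => (h2 j).continuousLinearMap_comp L, fun n m => ?_⟩
  obtain ⟨C, hC⟩ := h3 n m
  refine ⟨‖L‖ * C, fun ε hε z => ?_⟩
  have hs : ContDiff ℝ m (fun z => A ε z - ∑ j ∈ Finset.range n, ε ^ j • A' j z) :=
    ((h1 ε hε).contDiff (n := m)).sub
      (ContDiff.sum fun j _ => ((h2 j).contDiff (n := m)).const_smul _)
  have := L.norm_iteratedFDeriv_comp_left (x := z) hs.contDiffAt (le_refl _)
  simp only [Function.comp_def, map_sub, map_sum, map_smul] at this
  refine this.trans ((mul_le_mul_of_nonneg_left (hC ε hε z) (norm_nonneg _)).trans_eq ?_)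
  ring

end SymbolLemmas

/-- The map `c ↦ c • id` is bounded and linear, hence preserves all symbol estimates. Scalars are
restricted to `ℝ` because the derivatives are real ones. -/
theorem IsSemiclassicalSymbol.scalarSymbol (F : Type*) [NormedAddCommGroup F] [NormedSpace ℂ F]
    {ε₀ : ℝ} {a : ℝ → Euc d × Euc d → ℂ} (ha : IsSemiclassicalSymbol ε₀ a) :
    IsSemiclassicalSymbol ε₀ (fun ε => scalarSymbol F (a ε)) :=
  ha.continuousLinearMap_comp
    ((ContinuousLinearMap.toSpanSingleton ℂ (ContinuousLinearMap.id ℂ F)).restrictScalars ℝ)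

/-- Multiples of the identity commute with `τ`, so equivariance is just periodicity in `k`. -/
theorem isTauEquivariantSymbol_scalarSymbol (v : Basis (Fin d) ℝ (Euc d)) {ε₀ : ℝ}
    {b : ℝ → Euc d × Euc d → ℂ} (hb : IsSemiclassicalSymbol ε₀ b)
    (hper : ∀ ε ∈ Set.Ico 0 ε₀, ∀ g ∈ lattice (dualBasis v), ∀ k r, b ε (k + g, r) = b ε (k, r)) :
    IsTauEquivariantSymbol v ε₀ (fun ε => scalarSymbol (Fibre v) (b ε)) := by
  refine ⟨hb.scalarSymbol _, fun ε hε g hg k r φ => ?_⟩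
  have h : b ε (k - g, r) = b ε (k, r) := by
    rw [← hper ε hε g hg (k - g) r, sub_add_cancel]
  simp [BlochZak.scalarSymbol, h]

/-! ### Plane waves and the lattice -/

theorem wave_comm (g y : Euc d) : wave g y = wave y g := by
  rw [wave, wave, real_inner_comm]

theorem wave_add_left (g h y : Euc d) : wave (g + h) y = wave g y * wave h y := by
  rw [wave, wave, wave, ← Complex.exp_add, inner_add_right]; push_cast; ring_nf

theorem wave_add_right (g x y : Euc d) : wave g (x + y) = wave g x * wave g y := by
  rw [wave_comm, wave_add_left, wave_comm x, wave_comm y]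

@[simp] theorem wave_zero_left (y : Euc d) : wave 0 y = 1 := by simp [wave]

theorem wave_neg_right (g y : Euc d) : wave g (-y) = wave (-g) y := by simp [wave]

theorem conj_wave (g y : Euc d) : starRingEnd ℂ (wave g y) = wave (-g) y := by
  rw [wave, wave, ← Complex.exp_conj]; simp

theorem continuous_wave_uncurry : Continuous fun p : Euc d × Euc d => wave p.1 p.2 := by
  unfold wave; fun_prop

@[fun_prop]
theorem _root_.Continuous.wave {X : Type*} [TopologicalSpace X] {f g : X → Euc d}
    (hf : Continuous f) (hg : Continuous g) : Continuous fun x => wave (f x) (g x) :=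
  continuous_wave_uncurry.comp (hf.prodMk hg)

/-- From `|e^{iθ} - 1| ≤ |θ|`. On the bounded cell this makes `k ↦ τ(k) φ` Lipschitz. -/
theorem norm_wave_sub_wave_le (g h y : Euc d) : ‖wave g y - wave h y‖ ≤ ‖y‖ * ‖g - h‖ := by
  have h1 : wave g y - wave h y = wave h y * (Complex.exp (Complex.I * (⟪y, g - h⟫_ℝ : ℝ)) - 1) := by
    have : Complex.exp (Complex.I * (⟪y, g - h⟫_ℝ : ℝ)) = wave (g - h) y := rfl
    rw [this, mul_sub, ← wave_add_left]; simp
  rw [h1, norm_mul, norm_wave, one_mul]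
  refine (Real.norm_exp_I_mul_ofReal_sub_one_le).trans ?_
  exact norm_inner_le_norm _ _

/-- The lattice and the dual lattice pair to integer multiples of `2π`. -/
theorem exists_inner_eq (v : Basis (Fin d) ℝ (Euc d)) {γ g : Euc d} (hγ : γ ∈ lattice v)
    (hg : g ∈ lattice (dualBasis v)) : ∃ n : ℤ, ⟪γ, g⟫_ℝ = n * (2 * Real.pi) := by
  induction hγ using Submodule.span_induction with
  | zero => exact ⟨0, by simp⟩
  | add x y _ _ hx hy =>
    obtain ⟨m, hm⟩ := hx
    obtain ⟨n, hn⟩ := hy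
    exact ⟨m + n, by rw [inner_add_left, hm, hn]; push_cast; ring⟩
  | smul a x _ hx =>
    obtain ⟨n, hn⟩ := hx
    refine ⟨a * n, ?_⟩
    rw [← Int.cast_smul_eq_zsmul ℝ, real_inner_smul_left, hn]; push_cast; ring
  | mem x hx =>
    obtain ⟨i, rfl⟩ := hx
    induction hg using Submodule.span_induction with
    | zero => exact ⟨0, by simp⟩
    | add x y _ _ hx hy =>
      obtain ⟨m, hm⟩ := hx
      obtain ⟨n, hn⟩ := hy
      exact ⟨m + n, by rw [inner_add_right, hm, hn]; push_cast; ring⟩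
    | smul a x _ hx =>
      obtain ⟨n, hn⟩ := hx
      refine ⟨a * n, ?_⟩
      rw [← Int.cast_smul_eq_zsmul ℝ, real_inner_smul_right, hn]; push_cast; ring
    | mem x hx =>
      obtain ⟨j, rfl⟩ := hx
      rw [inner_dualBasis]
      by_cases hij : i = j
      · exact ⟨1, by simp [hij]⟩
      · exact ⟨0, by simp [hij]⟩

theorem wave_eq_one (v : Basis (Fin d) ℝ (Euc d)) {γ g : Euc d} (hγ : γ ∈ lattice v)
    (hg : g ∈ lattice (dualBasis v)) : wave γ g = 1 := by
  obtain ⟨n, hn⟩ := exists_inner_eq v hγ hg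
  rw [wave, real_inner_comm, hn]
  have := Complex.exp_int_mul_two_pi_mul_I n
  rw [← this]; push_cast; ring_nf

/-- Biorthogonality kills the off-diagonal terms. In these coordinates the plane waves with
frequency in `Γ` become the characters of the standard torus. -/
theorem inner_dualBasis_repr (v : Basis (Fin d) ℝ (Euc d)) (x k : Euc d) :
    ⟪k, x⟫_ℝ = 2 * Real.pi * ∑ j, v.repr x j * (dualBasis v).repr k j := by
  conv_lhs => rw [← v.sum_repr x, ← (dualBasis v).sum_repr k]
  rw [inner_sum, Finset.mul_sum]
  refine Finset.sum_congr rfl fun i _ => ?_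
  rw [sum_inner, Finset.sum_eq_single i]
  · rw [real_inner_smul_left, real_inner_smul_right, real_inner_comm, inner_dualBasis]
    simp; ring
  · intro j _ hj
    rw [real_inner_smul_left, real_inner_smul_right, real_inner_comm, inner_dualBasis]
    simp [hj.symm]
  · simp

/-! ### The cell is a fundamental domain -/

theorem volume_cell_ne_zero (w : Basis (Fin d) ℝ (Euc d)) : volume (cell w) ≠ 0 := by
  have h : (w.equivFunL ⁻¹' (Set.pi Set.univ fun _ => Set.Ioo (-(1 / 2) : ℝ) (1 / 2)))
      ⊆ interior (cell w) := by
    refine interior_maximal ?_ ((isOpen_set_pi Set.finite_univ fun _ _ => isOpen_Ioo).preimage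
      w.equivFunL.continuous)
    intro x hx j
    have := hx j (Set.mem_univ j)
    exact ⟨this.1.le, this.2.le⟩
  refine (Measure.measure_pos_of_nonempty_interior _ ⟨0, h ?_⟩).ne'
  intro j _
  simp

theorem volume_cell_ne_top (w : Basis (Fin d) ℝ (Euc d)) : volume (cell w) ≠ ⊤ :=
  (isCompact_cell w).measure_lt_top.ne

instance (w : Basis (Fin d) ℝ (Euc d)) : IsProbabilityMeasure (normalizedCell w) :=
  ⟨by simp [normalizedCell, ENNReal.inv_mul_cancel (volume_cell_ne_zero w) (volume_cell_ne_top w)]⟩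

instance (w : Basis (Fin d) ℝ (Euc d)) : IsFiniteMeasure (volume.restrict (cell w)) :=
  ⟨by simpa using (isCompact_cell w).measure_lt_top⟩

/-- The set is a proper affine subspace. The faces of the closed cell are therefore negligible,
which excuses all boundary ambiguities below. -/
theorem volume_repr_eq_zero (w : Basis (Fin d) ℝ (Euc d)) (j : Fin d) (c : ℝ) :
    volume {x : Euc d | w.repr x j = c} = 0 := by
  have h : {x : Euc d | w.repr x j = c}
      = (AffineSubspace.mk' (c • w j) (LinearMap.ker (w.coord j)) : Set (Euc d)) := by
    ext x
    simp [AffineSubspace.mem_mk', sub_eq_zero]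
  rw [h]
  refine Measure.addHaar_affineSubspace _ _ fun htop => ?_
  have : (AffineSubspace.mk' (c • w j) (LinearMap.ker (w.coord j))).direction = ⊤ := by
    rw [htop, AffineSubspace.direction_top]
  rw [AffineSubspace.direction_mk', LinearMap.ker_eq_top] at this
  have h1 : w.coord j (w j) = 0 := by rw [this]; rfl
  simp at h1

theorem repr_lattice_eq_int (w : Basis (Fin d) ℝ (Euc d)) (g : lattice w) (j : Fin d) :
    w.repr (g : Euc d) j = ((w.restrictScalars ℤ).repr g j : ℤ) := by
  exact (w.restrictScalars_repr_apply ℤ g j).symm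

instance vaddInvariantMeasure_lattice (w : Basis (Fin d) ℝ (Euc d)) :
    VAddInvariantMeasure (lattice w) (Euc d) volume :=
  inferInstanceAs <| VAddInvariantMeasure (lattice w).toAddSubgroup (Euc d) volume

/-- If `y` and `y + g` both lie in the closed cell and the `j`-th integer coordinate of `g` is
nonzero, it must be `±1` and `y + g` lies on a face. Overlaps of distinct translates are thus null.
-/
theorem isAddFundamentalDomain_cell (w : Basis (Fin d) ℝ (Euc d)) :
    IsAddFundamentalDomain (lattice w) (cell w) (volume : Measure (Euc d)) := by
  refine IsAddFundamentalDomain.mk'' (isCompact_cell w).measurableSet.nullMeasurableSet ?_ ?_ ?_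
  · refine Filter.Eventually.of_forall fun x => ?_
    obtain ⟨g, hg⟩ := exists_sub_mem_cell w x
    exact ⟨-g, by simpa [Submodule.vadd_def, vadd_eq_add, sub_eq_neg_add] using hg⟩
  · intro g hg
    have hsub : (g +ᵥ cell w) ∩ cell w
        ⊆ ⋃ j : Fin d, ({x | w.repr x j = 1 / 2} ∪ {x | w.repr x j = -(1 / 2)}) := by
      rintro x ⟨⟨y, hy, rfl⟩, hx⟩
      have hne : ∃ j, (w.restrictScalars ℤ).repr g j ≠ 0 := by
        by_contra! h
        exact hg ((w.restrictScalars ℤ).repr.map_eq_zero_iff.1 (Finsupp.ext h))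
      obtain ⟨j, hj⟩ := hne
      have h1 := hy j
      have h2 := hx j
      simp only [vadd_eq_add, map_add, Finsupp.add_apply,
        repr_lattice_eq_int] at h2
      refine Set.mem_iUnion.2 ⟨j, ?_⟩
      simp only [Set.mem_union, Set.mem_ofPred_eq, vadd_eq_add, map_add,
        Finsupp.add_apply, repr_lattice_eq_int]
      set n := (w.restrictScalars ℤ).repr g j
      rcases lt_or_gt_of_ne hj with h | h
      · right
        have : (n : ℝ) ≤ -1 := by exact_mod_cast (show n ≤ -1 by omega)
        linarith [h1.1, h1.2, h2.1, h2.2]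
      · left
        have : (1 : ℝ) ≤ n := by exact_mod_cast (show 1 ≤ n by omega)
        linarith [h1.1, h1.2, h2.1, h2.2]
    refine measure_mono_null hsub ((measure_iUnion_null_iff).2 fun j => ?_)
    exact measure_union_null (volume_repr_eq_zero w j _) (volume_repr_eq_zero w j _)
  · intro g
    exact (measurePreserving_vadd g volume).quasiMeasurePreserving

/-! ### Polynomial decay -/

/-- The weight `(1 + |x|)^{-(d+1)}`, which is integrable and summable over lattices. -/
def decay (x : Euc d) : ℝ := ((1 + ‖x‖) ^ (d + 1))⁻¹

theorem decay_pos (x : Euc d) : 0 < decay x := by unfold decay; positivity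

theorem decay_nonneg (x : Euc d) : 0 ≤ decay x := (decay_pos x).le

@[fun_prop]
theorem continuous_decay : Continuous (decay : Euc d → ℝ) := by
  unfold decay
  exact Continuous.inv₀ (by fun_prop) fun x => by positivity

theorem decay_le_one (x : Euc d) : decay x ≤ 1 :=
  inv_le_one_of_one_le₀ (one_le_pow₀ (by linarith [norm_nonneg x]))

@[simp] theorem decay_neg (x : Euc d) : decay (-x) = decay x := by simp [decay]

theorem integrable_decay : Integrable (decay : Euc d → ℝ) := by
  have := integrable_one_add_norm (E := Euc d) (μ := volume) (r := (d + 1 : ℕ)) (by simp)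
  refine this.congr (Filter.Eventually.of_forall fun x => ?_)
  simp only [decay]
  rw [Real.rpow_neg (by positivity), Real.rpow_natCast]

/-- Equivalent to `1 + ‖x + y‖ ≤ (1 + ‖x‖)(1 + ‖y‖)`. It trades decay in `γ` for a shift of the
argument by `γ`. -/
theorem decay_mul_decay_le (x y : Euc d) : decay x * decay y ≤ decay (x + y) := by
  unfold decay
  rw [← mul_inv, ← mul_pow]
  gcongr
  nlinarith [norm_add_le x y, norm_nonneg x, norm_nonneg y, mul_nonneg (norm_nonneg x) (norm_nonneg y)]

theorem summable_decay (w : Basis (Fin d) ℝ (Euc d)) :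
    Summable fun g : lattice w => decay (g : Euc d) := by
  have hr : -((d + 1 : ℕ) : ℝ) < -Module.finrank ℤ (lattice w) := by
    rw [Module.finrank_eq_card_basis (w.restrictScalars ℤ)]
    simp
  refine Summable.of_norm_bounded_eventually (ZLattice.summable_norm_rpow (lattice w) _ hr) ?_
  -- The comparison with `‖g‖ ^ (-(d+1))` fails only at `g = 0`, where the real power is `0` by
  -- convention while the weight is `1`.
  refine (Set.finite_singleton (0 : lattice w)).subset fun g hg => ?_
  by_contra h0
  refine hg ?_
  have h0' : g ≠ 0 := h0
  have hpos : 0 < ‖g‖ := norm_pos_iff.2 h0'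
  change ‖decay (g : Euc d)‖ ≤ _
  rw [Real.norm_of_nonneg (decay_nonneg _), decay, Real.rpow_neg hpos.le, Real.rpow_natCast]
  gcongr
  have : ‖(g : Euc d)‖ = ‖g‖ := rfl
  linarith

/-- On the cell, translates of the weight are comparable with its values on the lattice. -/
theorem exists_decay_add_le (w : Basis (Fin d) ℝ (Euc d)) :
    ∃ C, 0 ≤ C ∧ ∀ x ∈ cell w, ∀ g : Euc d, decay (x + g) ≤ C * decay g := by
  obtain ⟨R, hR⟩ := (isCompact_cell w).isBounded.exists_norm_le
  refine ⟨(1 + |R|) ^ (d + 1), by positivity, fun x hx g => ?_⟩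
  -- Applied to `g = (x + g) + (-x)`; the loss `1 / decay x` is bounded on the compact cell.
  have h1 := decay_mul_decay_le (x + g) (-x)
  rw [decay_neg, add_neg_cancel_comm, ← le_div_iff₀ (decay_pos x)] at h1
  refine h1.trans ?_
  rw [div_eq_mul_inv, mul_comm]
  refine mul_le_mul_of_nonneg_right ?_ (decay_nonneg g)
  rw [decay, inv_inv]
  gcongr
  exact (hR x hx).trans (le_abs_self R)

/-! ### Fourier series on the cell of the dual lattice -/

section Torus

-- Total mass one, so that the characters are orthonormal and the torus measure corresponds to the
-- normalized `dk` on `M*`.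
local instance haarMeasureSpaceUnitAddCircle : MeasureSpace UnitAddCircle :=
  ⟨AddCircle.haarAddCircle⟩

/-- The half-open unit box centred at the origin. -/
def unitBox (d : ℕ) : Set (Fin d → ℝ) := {t | ∀ i, t i ∈ Set.Ioc (-(1 / 2) : ℝ) (-(1 / 2) + 1)}

theorem unitBox_eq_pi (d : ℕ) :
    unitBox d = Set.pi Set.univ fun _ => Set.Ioc (-(1 / 2) : ℝ) (-(1 / 2) + 1) := by
  ext t; simp [unitBox]

theorem volume_unitBox (d : ℕ) : volume (unitBox d) = 1 := by
  rw [unitBox_eq_pi, volume_pi_pi]; simp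

theorem preimage_unitBox_ae_eq (w : Basis (Fin d) ℝ (Euc d)) :
    (w.equivFunL ⁻¹' unitBox d : Set (Euc d)) =ᵐ[volume] cell w := by
  have h : ∀ᵐ x : Euc d, ∀ j, w.repr x j ≠ -(1 / 2) :=
    ae_all_iff.2 fun j => by
      rw [ae_iff]; simpa using volume_repr_eq_zero w j (-(1 / 2))
  filter_upwards [h] with x hx
  apply propext
  change (∀ i, w.repr x i ∈ Set.Ioc _ _) ↔ ∀ i, w.repr x i ∈ Set.Icc _ _
  refine forall_congr' fun i => ?_
  rw [Set.mem_Ioc, Set.mem_Icc]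
  constructor
  · rintro ⟨h1, h2⟩; constructor <;> linarith
  · rintro ⟨h1, h2⟩; exact ⟨lt_of_le_of_ne h1 (hx i).symm, by linarith⟩

/-- A linear isomorphism carries Lebesgue measure to a Haar measure, hence to a multiple of Lebesgue
measure. Comparing total masses over the box identifies the multiple as the normalizing factor. -/
theorem measurePreserving_equivFunL_symm (w : Basis (Fin d) ℝ (Euc d)) :
    MeasurePreserving w.equivFunL.symm (volume.restrict (unitBox d)) (normalizedCell w) := by
  refine ⟨w.equivFunL.symm.continuous.measurable, ?_⟩
  set e : (Fin d → ℝ) ≃ᵐ Euc d := w.equivFunL.symm.toHomeomorph.toMeasurableEquiv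
  have : Measure.IsAddHaarMeasure ((volume : Measure (Fin d → ℝ)).map e) :=
    w.equivFunL.symm.isAddHaarMeasure_map _
  obtain ⟨c, hc⟩ : ∃ c : ENNReal, (volume : Measure (Fin d → ℝ)).map e = c • volume :=
    ⟨_, Measure.isAddLeftInvariant_eq_smul ((volume : Measure (Fin d → ℝ)).map e) volume⟩
  have h1 : (volume.restrict (unitBox d)).map e = c • volume.restrict (cell w) := by
    have h2 : unitBox d = e ⁻¹' (w.equivFunL ⁻¹' unitBox d) := by
      ext t
      simp [e]
    conv_lhs => rw [h2]
    rw [← e.restrict_map, hc, Measure.restrict_smul, Measure.restrict_congr_set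
      (preimage_unitBox_ae_eq w)]
  have h3 : (1 : ENNReal) = c * volume (cell w) := by
    have := congrArg (fun μ => μ Set.univ) h1
    simpa [e.map_apply, volume_unitBox] using this
  change (volume.restrict (unitBox d)).map e = _
  rw [h1, normalizedCell]
  congr 1
  exact ENNReal.eq_inv_of_mul_eq_one_left h3.symm

/-- The measurable section of the covering map of the torus, with values in the cell. -/
def torusSection (w : Basis (Fin d) ℝ (Euc d)) (θ : UnitAddTorus (Fin d)) : Euc d :=
  w.equivFunL.symm (UnitAddTorus.measurableEquivPiIoc (fun _ => (-(1 / 2) : ℝ)) θ).1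

theorem measurableSet_unitBox (d : ℕ) : MeasurableSet (unitBox d) := by
  rw [unitBox_eq_pi]; exact MeasurableSet.univ_pi fun _ => measurableSet_Ioc

theorem measurePreserving_torusSection (w : Basis (Fin d) ℝ (Euc d)) :
    MeasurePreserving (torusSection w) volume (normalizedCell w) := by
  have h := UnitAddTorus.measurePreserving_equivPiIoc (fun _ : Fin d => (-(1 / 2) : ℝ))
  have h2 : MeasurePreserving (Subtype.val : unitBox d → (Fin d → ℝ))
      (Measure.comap Subtype.val volume) (volume.restrict (unitBox d)) :=
    ⟨measurable_subtype_coe, map_comap_subtype_coe (measurableSet_unitBox d) volume⟩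
  exact (measurePreserving_equivFunL_symm w).comp (h2.comp h)

theorem measurableEmbedding_torusSection (w : Basis (Fin d) ℝ (Euc d)) :
    MeasurableEmbedding (torusSection w) :=
  w.equivFunL.symm.toHomeomorph.toMeasurableEquiv.measurableEmbedding.comp
    ((MeasurableEmbedding.subtype_coe (measurableSet_unitBox d)).comp
      (UnitAddTorus.measurableEquivPiIoc (fun _ => (-(1 / 2) : ℝ))).measurableEmbedding)

theorem coe_repr_torusSection (w : Basis (Fin d) ℝ (Euc d)) (θ : UnitAddTorus (Fin d)) (j : Fin d) :
    ((w.repr (torusSection w θ) j : ℝ) : UnitAddCircle) = θ j := by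
  have h1 : w.repr (torusSection w θ) j
      = (UnitAddTorus.measurableEquivPiIoc (fun _ => (-(1 / 2) : ℝ)) θ).1 j :=
    congrFun (w.equivFunL.apply_symm_apply _) j
  rw [h1]
  have := (UnitAddTorus.measurableEquivPiIoc (fun _ : Fin d => (-(1 / 2) : ℝ))).symm_apply_apply θ
  exact congrFun this j

/-- The integer coordinates of a lattice vector. -/
def latticeCoord (v : Basis (Fin d) ℝ (Euc d)) : lattice v ≃ (Fin d → ℤ) :=
  (v.restrictScalars ℤ).equivFun.toEquiv

/-- Only the class of `k` modulo `Γ*` enters the left side, so the identity holds for every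
representative, not only the one chosen by `torusSection`. -/
theorem mFourier_eq_wave (v : Basis (Fin d) ℝ (Euc d)) (γ : lattice v) (k : Euc d)
    (θ : UnitAddTorus (Fin d)) (hk : ∀ j, (((dualBasis v).repr k j : ℝ) : UnitAddCircle) = θ j) :
    UnitAddTorus.mFourier (latticeCoord v γ) θ = wave γ k := by
  have h1 : UnitAddTorus.mFourier (latticeCoord v γ) θ
      = ∏ j, fourier (latticeCoord v γ j) (θ j) := rfl
  rw [h1, wave, inner_dualBasis_repr v, Complex.ofReal_mul, Complex.ofReal_sum, Finset.mul_sum,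
    Finset.mul_sum, Complex.exp_sum]
  refine Finset.prod_congr rfl fun j _ => ?_
  rw [← hk j, fourier_coe_apply, repr_lattice_eq_int]
  congr 1
  have : latticeCoord v γ j = (v.restrictScalars ℤ).repr γ j := rfl
  rw [this]
  push_cast
  ring

theorem latticeCoord_neg (v : Basis (Fin d) ℝ (Euc d)) (γ : lattice v) :
    latticeCoord v (-γ) = -latticeCoord v γ :=
  map_neg (v.restrictScalars ℤ).equivFun γ

theorem mFourier_torusSection (v : Basis (Fin d) ℝ (Euc d)) (γ : lattice v)
    (θ : UnitAddTorus (Fin d)) :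
    UnitAddTorus.mFourier (latticeCoord v γ) θ = wave γ (torusSection (dualBasis v) θ) :=
  mFourier_eq_wave v γ _ θ (coe_repr_torusSection _ θ)

theorem mFourierCoeff_comp_torusSection (v : Basis (Fin d) ℝ (Euc d)) (f : Euc d → ℂ)
    (γ : lattice v) :
    UnitAddTorus.mFourierCoeff (f ∘ torusSection (dualBasis v)) (latticeCoord v γ)
      = ∫ k, wave (-γ) k * f k ∂(normalizedCell (dualBasis v)) := by
  rw [← (measurePreserving_torusSection (dualBasis v)).integral_comp
    (measurableEmbedding_torusSection _)]
  refine integral_congr_ae (Filter.Eventually.of_forall fun θ => ?_)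
  simp only [← latticeCoord_neg, mFourier_torusSection, smul_eq_mul, Function.comp_apply]

/-- Completeness of the plane waves: a square integrable function on the cell of `Γ*` with vanishing
Fourier coefficients vanishes. -/
theorem ae_eq_zero_of_fourierCoeff_eq_zero (v : Basis (Fin d) ℝ (Euc d)) {f : Euc d → ℂ}
    (hf : MemLp f 2 (normalizedCell (dualBasis v)))
    (h : ∀ γ : lattice v, ∫ k, wave (-γ) k * f k ∂(normalizedCell (dualBasis v)) = 0) :
    f =ᵐ[normalizedCell (dualBasis v)] 0 := by
  have hmp := measurePreserving_torusSection (dualBasis v)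
  have hF : MemLp (f ∘ torusSection (dualBasis v)) 2 volume := hf.comp_measurePreserving hmp
  have h0 : hF.toLp = 0 := by
    apply UnitAddTorus.mFourierBasis.repr.map_eq_zero_iff.1
    apply lp.ext
    funext n
    rw [UnitAddTorus.mFourierBasis_repr]
    have h1 : UnitAddTorus.mFourierCoeff hF.toLp n
        = UnitAddTorus.mFourierCoeff (f ∘ torusSection (dualBasis v)) n :=
      integral_congr_ae (by
        filter_upwards [hF.coeFn_toLp] with θ hθ
        rw [hθ])
    obtain ⟨γ, rfl⟩ := (latticeCoord v).surjective n
    rw [h1, mFourierCoeff_comp_torusSection, h γ]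
    rfl
  have h2 : f ∘ torusSection (dualBasis v) =ᵐ[volume] 0 :=
    hF.coeFn_toLp.symm.trans (Lp.eq_zero_iff_ae_eq_zero.1 h0)
  rw [← hmp.map_eq]
  exact (measurableEmbedding_torusSection _).ae_map_iff.2 h2

theorem exists_lattice_add_eq (w : Basis (Fin d) ℝ (Euc d)) {x y : Euc d}
    (h : ∀ j, ((w.repr x j : ℝ) : UnitAddCircle) = (w.repr y j : ℝ)) :
    ∃ g ∈ lattice w, y = x + g := by
  have h1 : ∀ j, ∃ n : ℤ, w.repr y j - w.repr x j = n := by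
    intro j
    obtain ⟨n, hn⟩ := (QuotientAddGroup.eq_iff_sub_mem.1 (h j).symm)
    exact ⟨n, by simpa using hn.symm⟩
  choose n hn using h1
  refine ⟨∑ j, n j • w j, Submodule.sum_mem _ fun j _ => Submodule.smul_mem _ _
    (Submodule.subset_span (Set.mem_range_self j)), ?_⟩
  apply w.repr.injective
  ext j
  simp [map_sum, Finsupp.single_apply, ← Int.cast_smul_eq_zsmul ℝ, ← hn j]

/-- The section itself jumps at the faces, but a periodic `f` does not see the jump: pulled back
along the quotient map `ℝ^d → 𝕋^d`, the composite is `f` in coordinates. -/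
theorem continuous_comp_torusSection (w : Basis (Fin d) ℝ (Euc d)) {f : Euc d → ℂ}
    (hf : Continuous f) (hper : ∀ g ∈ lattice w, ∀ k, f (k + g) = f k) :
    Continuous (f ∘ torusSection w) := by
  have hq : IsOpenQuotientMap (Pi.map (fun (_ : Fin d) (x : ℝ) => (x : UnitAddCircle))) :=
    IsOpenQuotientMap.piMap fun _ => QuotientAddGroup.isOpenQuotientMap_mk
  rw [hq.isQuotientMap.continuous_iff]
  convert hf.comp w.equivFunL.symm.continuous using 1
  funext t
  obtain ⟨g, hg, h⟩ := exists_lattice_add_eq w (x := w.equivFunL.symm t)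
    (y := torusSection w (Pi.map (fun (_ : Fin d) (x : ℝ) => (x : UnitAddCircle)) t)) (fun j => by
      rw [coe_repr_torusSection]
      have : w.repr (w.equivFunL.symm t) j = t j :=
        congrFun (w.equivFunL.apply_symm_apply t) j
      rw [this]; rfl)
  simp only [Function.comp_apply, h]
  exact hper g hg _

/-- Pointwise convergence of the Fourier series of a periodic function with summable coefficients. -/
theorem hasSum_fourierSeries (v : Basis (Fin d) ℝ (Euc d)) {f : Euc d → ℂ}
    (hf : Continuous f) (hper : ∀ g ∈ lattice (dualBasis v), ∀ k, f (k + g) = f k)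
    (hs : Summable fun γ : lattice v =>
      ∫ k, wave (-γ) k * f k ∂(normalizedCell (dualBasis v))) (k : Euc d) :
    HasSum (fun γ : lattice v =>
      (∫ k, wave (-γ) k * f k ∂(normalizedCell (dualBasis v))) * wave γ k) (f k) := by
  set F : C(UnitAddTorus (Fin d), ℂ) := ⟨_, continuous_comp_torusSection _ hf hper⟩
  have hcoef : ∀ γ : lattice v, UnitAddTorus.mFourierCoeff F (latticeCoord v γ)
      = ∫ k, wave (-γ) k * f k ∂(normalizedCell (dualBasis v)) :=
    mFourierCoeff_comp_torusSection v f
  have hs' : Summable (UnitAddTorus.mFourierCoeff F) := by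
    rw [← (latticeCoord v).summable_iff]
    exact hs.congr fun γ => (hcoef γ).symm
  set θ : UnitAddTorus (Fin d) := fun j => ((dualBasis v).repr k j : ℝ)
  have h := UnitAddTorus.hasSum_mFourier_series_apply_of_summable hs' θ
  rw [← (latticeCoord v).hasSum_iff] at h
  have hF : F θ = f k := by
    obtain ⟨g, hg, h⟩ := exists_lattice_add_eq (dualBasis v) (x := k)
      (y := torusSection (dualBasis v) θ) (fun j => (coe_repr_torusSection _ θ j).symm)
    change f (torusSection (dualBasis v) θ) = _
    rw [h, hper g hg]
  rw [hF] at h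
  refine h.congr_fun fun γ => ?_
  simp only [Function.comp_apply, hcoef, smul_eq_mul]
  rw [mFourier_eq_wave v γ k θ fun _ => rfl]

end Torus

/-! ### Periodic integrals over the cell and half-period translations. -/

/-- A translate of a fundamental domain is again a fundamental domain, and periodic functions have
the same integral over both. -/
theorem integral_normalizedCell_comp_add {E : Type*} [NormedAddCommGroup E] [NormedSpace ℝ E]
    (w : Basis (Fin d) ℝ (Euc d)) {f : Euc d → E}
    (hper : ∀ g ∈ lattice w, ∀ k, f (k + g) = f k) (h : Euc d) :
    ∫ k, f (k + h) ∂(normalizedCell w) = ∫ k, f k ∂(normalizedCell w) := by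
  have h1 := (isAddFundamentalDomain_cell w)
  have h2 : ∫ k in cell w, f (k + h) = ∫ k in cell w, f k := by
    have h3 := h1.vadd_of_comm h
    rw [h1.setIntegral_eq h3 (f := f) (fun g x => by
      rw [Submodule.vadd_def, vadd_eq_add, add_comm]; exact hper _ g.2 _)]
    rw [← Set.image_vadd, (measurePreserving_vadd h volume).setIntegral_image_emb
      (measurableEmbedding_const_vadd h)]
    simp [add_comm]
  rw [normalizedCell, integral_smul_measure, integral_smul_measure, h2]

/-- A translation which changes the sign of the plane wave with frequency `γ`. -/
def halfPeriod (γ : Euc d) : Euc d := (Real.pi / ‖γ‖ ^ 2) • γ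

theorem norm_halfPeriod (γ : Euc d) : ‖halfPeriod γ‖ = Real.pi * ‖γ‖⁻¹ := by
  rw [halfPeriod, norm_smul, Real.norm_of_nonneg (by positivity)]
  rcases eq_or_ne ‖γ‖ 0 with h | h
  · simp [h]
  · field_simp

theorem wave_halfPeriod {γ : Euc d} (hγ : γ ≠ 0) : wave γ (halfPeriod γ) = -1 := by
  have h : ‖γ‖ ≠ 0 := norm_ne_zero_iff.2 hγ
  rw [wave, halfPeriod, real_inner_smul_left, real_inner_self_eq_norm_sq, div_mul_cancel₀ _
    (pow_ne_zero 2 h), mul_comm, Complex.exp_pi_mul_I]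

theorem wave_add_lattice (v : Basis (Fin d) ℝ (Euc d)) {γ g : Euc d} (hγ : γ ∈ lattice v)
    (hg : g ∈ lattice (dualBasis v)) (k : Euc d) : wave γ (k + g) = wave γ k := by
  rw [wave_add_right, wave_eq_one v hγ hg, mul_one]

/-- Orthogonality of the plane waves on the cell of `Γ*`. -/
theorem integral_wave_normalizedCell (v : Basis (Fin d) ℝ (Euc d)) (γ : lattice v) :
    ∫ k, wave γ k ∂(normalizedCell (dualBasis v)) = if γ = 0 then 1 else 0 := by
  split_ifs with h
  · simp [h]
  · have h1 := integral_normalizedCell_comp_add (dualBasis v) (f := wave (γ : Euc d))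
      (fun g hg k => wave_add_lattice v γ.2 hg k) (halfPeriod γ)
    have h0 : (γ : Euc d) ≠ 0 := by simpa using h
    simp only [wave_add_right, wave_halfPeriod h0, mul_neg, mul_one, integral_neg] at h1
    exact CharZero.neg_eq_self_iff.1 h1

/-! ### Fourier coefficients of periodic symbols -/

/-- Repeated differentiation under the integral sign. The codomain is generalized in the induction
because the derivative takes values in `Euc d →L[ℝ] F`. Smoothness and the bound are proved
together, and the bound passes with the same constant since the measure has mass one. -/
theorem contDiff_integral_param {F : Type*} [NormedAddCommGroup F] [NormedSpace ℝ F]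
    (μ : Measure (Euc d)) [IsProbabilityMeasure μ] (n : ℕ) {f : Euc d × Euc d → F}
    (hf : ContDiff ℝ (⊤ : ℕ∞) f)
    (hb : ∀ m ≤ n, ∃ C, ∀ x k, ‖iteratedFDeriv ℝ m (fun x => f (x, k)) x‖ ≤ C) :
    ContDiff ℝ n (fun x => ∫ k, f (x, k) ∂μ) ∧
    ∀ C, (∀ x k, ‖iteratedFDeriv ℝ n (fun x => f (x, k)) x‖ ≤ C) →
      ∀ x, ‖iteratedFDeriv ℝ n (fun x => ∫ k, f (x, k) ∂μ) x‖ ≤ C := by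
  induction n generalizing F with
  | zero =>
    obtain ⟨C, hC⟩ := hb 0 le_rfl
    simp only [norm_iteratedFDeriv_zero] at hC ⊢
    refine ⟨contDiff_zero.2 ?_, fun D hD x => ?_⟩
    · refine continuous_of_dominated (bound := fun _ => C)
        (fun x => (hf.continuous.comp (by fun_prop)).aestronglyMeasurable)
        (fun x => Filter.Eventually.of_forall fun k => hC x k) (integrable_const _)
        (Filter.Eventually.of_forall fun k => hf.continuous.comp (by fun_prop))
    · simpa using norm_integral_le_of_norm_le_const (μ := μ)
        (Filter.Eventually.of_forall fun k => hD x k)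
  | succ n ih =>
    set g : Euc d × Euc d → (Euc d →L[ℝ] F) := fun p => fderiv ℝ (fun x => f (x, p.2)) p.1
    have hg : ContDiff ℝ (⊤ : ℕ∞) g := by
      have hF : ContDiff ℝ (⊤ : ℕ∞)
          (Function.uncurry fun (p : Euc d × Euc d) (x : Euc d) => f (x, p.2)) :=
        hf.comp (contDiff_snd.prodMk (contDiff_snd.comp contDiff_fst))
      exact ContDiff.fderiv hF contDiff_fst (by simp)
    have hgn : ∀ m x k, ‖iteratedFDeriv ℝ m (fun x => g (x, k)) x‖
        = ‖iteratedFDeriv ℝ (m + 1) (fun x => f (x, k)) x‖ := by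
      intro m x k
      have h : (fun x => g (x, k)) = fderiv ℝ (fun x => f (x, k)) := rfl
      rw [h, norm_iteratedFDeriv_fderiv]
    have hgb : ∀ m ≤ n, ∃ C, ∀ x k, ‖iteratedFDeriv ℝ m (fun x => g (x, k)) x‖ ≤ C := by
      intro m hm
      obtain ⟨C, hC⟩ := hb (m + 1) (by omega)
      exact ⟨C, fun x k => by rw [hgn]; exact hC x k⟩
    obtain ⟨h1, h2⟩ := ih hg hgb
    have hder : ∀ x, HasFDerivAt (fun x => ∫ k, f (x, k) ∂μ) (∫ k, g (x, k) ∂μ) x := by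
      intro x
      obtain ⟨C0, hC0⟩ := hb 0 (by omega)
      obtain ⟨C1, hC1⟩ := hgb 0 (by omega)
      simp only [norm_iteratedFDeriv_zero] at hC0 hC1
      refine hasFDerivAt_integral_of_dominated_of_fderiv_le (bound := fun _ => C1)
        (F := fun x k => f (x, k)) (F' := fun x k => g (x, k)) Filter.univ_mem
        (Filter.Eventually.of_forall fun y =>
          (hf.continuous.comp (by fun_prop)).aestronglyMeasurable) ?_
        (hg.continuous.comp (by fun_prop)).aestronglyMeasurable
        (Filter.Eventually.of_forall fun k y _ => hC1 y k) (integrable_const _)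
        (Filter.Eventually.of_forall fun k y _ => ?_)
      · exact Integrable.of_bound (hf.continuous.comp (by fun_prop)).aestronglyMeasurable C0
          (Filter.Eventually.of_forall fun k => hC0 x k)
      · have : DifferentiableAt ℝ (fun x => f (x, k)) y :=
          ((hf.comp (contDiff_id.prodMk contDiff_const)).differentiable (by simp)) y
        exact this.hasFDerivAt
    have hfd : fderiv ℝ (fun x => ∫ k, f (x, k) ∂μ) = fun x => ∫ k, g (x, k) ∂μ :=
      funext fun x => (hder x).fderiv
    refine ⟨?_, fun C hC x => ?_⟩
    · rw [show ((n + 1 : ℕ) : WithTop ℕ∞) = (n : WithTop ℕ∞) + 1 by simp, contDiff_succ_iff_fderiv]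
      refine ⟨fun x => (hder x).differentiableAt, by simp, ?_⟩
      rw [hfd]; exact h1
    · rw [← norm_iteratedFDeriv_fderiv, hfd]
      exact h2 C (fun x k => by rw [hgn]; exact hC x k) x

theorem norm_iteratedFDeriv_partial_le {F : Type*} [NormedAddCommGroup F] [NormedSpace ℝ F]
    {a : Euc d × Euc d → F} (ha : ContDiff ℝ (⊤ : ℕ∞) a) (m : ℕ) (x k : Euc d) :
    ‖iteratedFDeriv ℝ m (fun x => a (x, k)) x‖ ≤ ‖iteratedFDeriv ℝ m a (x, k)‖ := by
  have h : (fun x => a (x, k))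
      = (fun z => a (z + (0, k))) ∘ (ContinuousLinearMap.inl ℝ (Euc d) (Euc d)) := by
    funext y; simp
  have ha' : ContDiff ℝ (⊤ : ℕ∞) fun z => a (z + (0, k)) :=
    ha.comp (contDiff_id.add contDiff_const)
  rw [h, ContinuousLinearMap.iteratedFDeriv_comp_right _ ha' x (by exact_mod_cast le_top)]
  refine (ContinuousMultilinearMap.norm_compContinuousLinearMap_le _ _).trans ?_
  have h1 : ∏ _i : Fin m, ‖ContinuousLinearMap.inl ℝ (Euc d) (Euc d)‖ ≤ 1 :=
    Finset.prod_le_one (fun _ _ => norm_nonneg _)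
      fun _ _ => ContinuousLinearMap.norm_inl_le_one ℝ _ _
  rw [iteratedFDeriv_comp_add_right]
  simpa using mul_le_mul_of_nonneg_left h1 (norm_nonneg (iteratedFDeriv ℝ m a (x, k)))

/-- The Fourier coefficient, in the second variable, of a function periodic under `Γ*`. -/
def fourierCoef (v : Basis (Fin d) ℝ (Euc d)) (a : Euc d × Euc d → ℂ) (γ x : Euc d) : ℂ :=
  ∫ k, wave (-γ) k * a (x, k) ∂(normalizedCell (dualBasis v))

theorem contDiff_wave (g : Euc d) : ContDiff ℝ (⊤ : ℕ∞) (wave g) := by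
  unfold wave
  exact (contDiff_const.mul (Complex.ofRealCLM.contDiff.comp
    (contDiff_id.inner ℝ contDiff_const))).cexp

/-- With `k` fixed the plane wave is a unimodular constant, so `x`-derivatives of the integrand are
no larger than those of `a`, uniformly in `γ`. -/
theorem contDiff_fourierCoef_aux {a : Euc d × Euc d → ℂ} (ha : IsSymbol a) (γ : Euc d) :
    ContDiff ℝ (⊤ : ℕ∞) (fun z : Euc d × Euc d => wave (-γ) z.2 * a z) ∧
    ∀ m x k, ‖iteratedFDeriv ℝ m (fun x => wave (-γ) k * a (x, k)) x‖
      ≤ ‖iteratedFDeriv ℝ m a (x, k)‖ := by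
  refine ⟨((contDiff_wave _).comp contDiff_snd).mul ha.1, fun m x k => ?_⟩
  have h := iteratedFDeriv_const_smul_apply (𝕜 := ℝ) (i := m) (a := wave (-γ) k) (x := x)
    (f := fun x => a (x, k))
    ((ha.contDiff (n := m)).comp (contDiff_id.prodMk contDiff_const)).contDiffAt
  have h' : (fun x => wave (-γ) k * a (x, k)) = wave (-γ) k • (fun x => a (x, k)) := rfl
  rw [h', h, norm_smul, norm_wave, one_mul]
  exact norm_iteratedFDeriv_partial_le ha.1 m x k

theorem contDiff_fourierCoef (v : Basis (Fin d) ℝ (Euc d)) {a : Euc d × Euc d → ℂ}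
    (ha : IsSymbol a) (γ : Euc d) : ContDiff ℝ (⊤ : ℕ∞) (fourierCoef v a γ) := by
  obtain ⟨h1, h2⟩ := contDiff_fourierCoef_aux ha γ
  refine contDiff_infty.2 fun n => ?_
  refine (contDiff_integral_param (normalizedCell (dualBasis v)) n h1 fun m _ => ?_).1
  obtain ⟨C, hC⟩ := ha.2 m
  exact ⟨C, fun x k => (h2 m x k).trans (hC _)⟩

theorem norm_iteratedFDeriv_fourierCoef_le (v : Basis (Fin d) ℝ (Euc d)) {a : Euc d × Euc d → ℂ}
    (ha : IsSymbol a) (γ : Euc d) {n : ℕ} {C : ℝ} (hC : ∀ z, ‖iteratedFDeriv ℝ n a z‖ ≤ C)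
    (x : Euc d) : ‖iteratedFDeriv ℝ n (fourierCoef v a γ) x‖ ≤ C := by
  obtain ⟨h1, h2⟩ := contDiff_fourierCoef_aux ha γ
  refine (contDiff_integral_param (normalizedCell (dualBasis v)) n h1 fun m _ => ?_).2 C
    (fun x k => (h2 n x k).trans (hC _)) x
  obtain ⟨C, hC⟩ := ha.2 m
  exact ⟨C, fun x k => (h2 m x k).trans (hC _)⟩

/-- The difference operator in the second variable. -/
def diffOp (h : Euc d) (a : Euc d × Euc d → ℂ) : Euc d × Euc d → ℂ :=
  (fun z => a (z + (0, h))) - a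

theorem IsSymbol.comp_add {a : Euc d × Euc d → ℂ} (ha : IsSymbol a) (c : Euc d × Euc d) :
    IsSymbol (fun z => a (z + c)) := by
  refine ⟨ha.1.comp (contDiff_id.add contDiff_const), fun m => ?_⟩
  obtain ⟨C, hC⟩ := ha.2 m
  exact ⟨C, fun z => by rw [iteratedFDeriv_comp_add_right]; exact hC _⟩

theorem IsSymbol.diffOp {a : Euc d × Euc d → ℂ} (ha : IsSymbol a) (h : Euc d) :
    IsSymbol (diffOp h a) :=
  (ha.comp_add _).sub ha

/-- Mean value inequality for the `m`-th derivative: each difference costs one derivative and gains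
a factor `‖h‖`. -/
theorem norm_iteratedFDeriv_diffOp_le {a : Euc d × Euc d → ℂ} (ha : IsSymbol a) (h : Euc d)
    {m : ℕ} {C : ℝ} (hC : ∀ z, ‖iteratedFDeriv ℝ (m + 1) a z‖ ≤ C) (z : Euc d × Euc d) :
    ‖iteratedFDeriv ℝ m (diffOp h a) z‖ ≤ ‖h‖ * C := by
  rw [BlochZak.diffOp, iteratedFDeriv_sub_apply (ha.comp_add _).contDiff.contDiffAt
    ha.contDiff.contDiffAt, iteratedFDeriv_comp_add_right]
  have := Convex.norm_image_sub_le_of_norm_fderiv_le (𝕜 := ℝ) (f := iteratedFDeriv ℝ m a)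
    (s := Set.univ) (C := C) (x := z) (y := z + (0, h))
    (fun y _ => (ha.1.differentiable_iteratedFDeriv (by exact_mod_cast ENat.natCast_lt_top m)) y)
    (fun y _ => by rw [norm_fderiv_iteratedFDeriv]; exact hC y) convex_univ trivial trivial
  refine this.trans_eq ?_
  simp [mul_comm]

theorem isSymbol_iterate_diffOp {a : Euc d × Euc d → ℂ} (ha : IsSymbol a) (h : Euc d) (N : ℕ) :
    IsSymbol ((diffOp h)^[N] a) := by
  induction N with
  | zero => exact ha
  | succ N ih => rw [Function.iterate_succ_apply']; exact ih.diffOp h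

theorem norm_iteratedFDeriv_iterate_diffOp_le {a : Euc d × Euc d → ℂ} (ha : IsSymbol a)
    (h : Euc d) (N : ℕ) {m : ℕ} {C : ℝ} (hC : ∀ z, ‖iteratedFDeriv ℝ (m + N) a z‖ ≤ C)
    (z : Euc d × Euc d) : ‖iteratedFDeriv ℝ m ((diffOp h)^[N] a) z‖ ≤ ‖h‖ ^ N * C := by
  induction N generalizing m z with
  | zero => simpa using hC z
  | succ N ih =>
    rw [Function.iterate_succ_apply', pow_succ', mul_assoc]
    refine norm_iteratedFDeriv_diffOp_le (isSymbol_iterate_diffOp ha h N) h (fun z => ?_) z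
    exact ih (m := m + 1) (by rwa [add_assoc, add_comm 1 N]) z

/-- Periodicity in the second variable. -/
def IsPeriodic (v : Basis (Fin d) ℝ (Euc d)) (a : Euc d × Euc d → ℂ) : Prop :=
  ∀ g ∈ lattice (dualBasis v), ∀ x k, a (x, k + g) = a (x, k)

theorem IsPeriodic.diffOp {v : Basis (Fin d) ℝ (Euc d)} {a : Euc d × Euc d → ℂ}
    (ha : IsPeriodic v a) (h : Euc d) : IsPeriodic v (diffOp h a) := by
  intro g hg x k
  simp only [BlochZak.diffOp, Pi.sub_apply, Prod.mk_add_mk, ha g hg]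
  rw [add_right_comm, ha g hg]

/-- By translation invariance, shifting `a` by the half period shifts the plane wave the other way,
which multiplies it by `-1`; subtracting the unshifted coefficient gives `-2`. -/
theorem fourierCoef_diffOp {v : Basis (Fin d) ℝ (Euc d)} {a : Euc d × Euc d → ℂ}
    (ha : IsSymbol a) (hp : IsPeriodic v a) {γ : lattice v} (hγ : γ ≠ 0) (x : Euc d) :
    fourierCoef v (diffOp (halfPeriod γ) a) γ x = (-2) * fourierCoef v a γ x := by
  have h0 : (γ : Euc d) ≠ 0 := by simpa using hγ
  have hint : ∀ b : Euc d × Euc d → ℂ, IsSymbol b →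
      Integrable (fun k => wave (-(γ : Euc d)) k * b (x, k)) (normalizedCell (dualBasis v)) := by
    intro b hb
    obtain ⟨C, hC⟩ := hb.2 0
    refine Integrable.of_bound (C := C) ?_ (Filter.Eventually.of_forall fun k => ?_)
    · exact ((continuous_wave _).mul (hb.continuous.comp (by fun_prop))).aestronglyMeasurable
    · rw [norm_mul, norm_wave, one_mul]
      simpa using hC (x, k)
  have h1 : fourierCoef v (diffOp (halfPeriod γ) a) γ x
      = ∫ k, wave (-(γ : Euc d)) k * a (x, k + halfPeriod γ) ∂(normalizedCell (dualBasis v))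
        - fourierCoef v a γ x := by
    have h4 := hint _ (ha.comp_add (0, halfPeriod γ))
    simp only [Prod.mk_add_mk, add_zero] at h4
    rw [fourierCoef, fourierCoef, ← integral_sub h4 (hint a ha)]
    simp [BlochZak.diffOp, mul_sub]
  have h2 := integral_normalizedCell_comp_add (dualBasis v)
    (f := fun k => wave (-(γ : Euc d)) k * a (x, k)) (fun g hg k => by
      rw [wave_add_lattice v (neg_mem γ.2) hg, hp g hg]) (halfPeriod γ)
  have h3 : wave (-(γ : Euc d)) (halfPeriod γ) = -1 := by
    rw [← conj_wave, wave_halfPeriod h0]; simp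
  simp only [wave_add_right, h3, mul_neg, mul_one, neg_mul, integral_neg] at h2
  rw [h1, fourierCoef, ← h2]
  ring

theorem fourierCoef_iterate_diffOp {v : Basis (Fin d) ℝ (Euc d)} {a : Euc d × Euc d → ℂ}
    (ha : IsSymbol a) (hp : IsPeriodic v a) {γ : lattice v} (hγ : γ ≠ 0) (N : ℕ) (x : Euc d) :
    fourierCoef v ((diffOp (halfPeriod γ))^[N] a) γ x = (-2) ^ N * fourierCoef v a γ x := by
  have hp' : ∀ N, IsPeriodic v ((diffOp (halfPeriod (γ : Euc d)))^[N] a) := by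
    intro N
    induction N with
    | zero => exact hp
    | succ N ih => rw [Function.iterate_succ_apply']; exact ih.diffOp _
  induction N with
  | zero => simp
  | succ N ih =>
    rw [Function.iterate_succ_apply', fourierCoef_diffOp (isSymbol_iterate_diffOp ha _ N) (hp' N) hγ,
      ih, pow_succ']
    ring

/-- A Fourier expansion with smooth, rapidly decreasing coefficients. -/
structure IsFourierExpansion (v : Basis (Fin d) ℝ (Euc d)) (a : Euc d × Euc d → ℂ)
    (c : lattice v → Euc d → ℂ) : Prop where
  contDiff : ∀ γ, ContDiff ℝ (⊤ : ℕ∞) (c γ)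
  bound : ∀ m N : ℕ, ∃ C, 0 ≤ C ∧ ∀ γ x, ‖iteratedFDeriv ℝ m (c γ) x‖ ≤ C * decay (γ : Euc d) ^ N
  hasSum : ∀ x k, HasSum (fun γ => c γ x * wave γ k) (a (x, k))

/-- Finite differences replace integration by parts. Taking `M` differences with step `halfPeriod
γ`, of length `π / ‖γ‖`, multiplies the coefficient by `(-2) ^ M`, while the differenced symbol is
bounded by `(π / ‖γ‖) ^ M` times derivatives of `a`. -/
theorem exists_bound_fourierCoef {v : Basis (Fin d) ℝ (Euc d)} {a : Euc d × Euc d → ℂ}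
    (ha : IsSymbol a) (hp : IsPeriodic v a) (m N : ℕ) :
    ∃ C, 0 ≤ C ∧ ∀ (γ : lattice v) x,
      ‖iteratedFDeriv ℝ m (fourierCoef v a γ) x‖ ≤ C * decay (γ : Euc d) ^ N := by
  -- Chosen so that `decay γ ^ N = (1 + ‖γ‖) ^ (-M)`.
  set M := (d + 1) * N
  obtain ⟨C0, hC0⟩ := ha.2 m
  obtain ⟨C1, hC1⟩ := ha.2 (m + M)
  have hC0' : 0 ≤ C0 := (norm_nonneg _).trans (hC0 0)
  have hC1' : 0 ≤ C1 := (norm_nonneg _).trans (hC1 0)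
  have hdec : ∀ γ : Euc d, decay γ ^ N = ((1 + ‖γ‖) ^ M)⁻¹ := by
    intro γ
    rw [decay, inv_pow, ← pow_mul]
  refine ⟨C0 * 2 ^ M + Real.pi ^ M * C1, by positivity, fun γ x => ?_⟩
  rw [hdec, ← div_eq_mul_inv, le_div_iff₀ (by positivity)]
  -- Short frequencies need only the trivial bound. For long ones `(1 + ‖γ‖) ^ M ≤ 2 ^ M ‖γ‖ ^ M`,
  -- and the `2 ^ M` is absorbed by the factor from the differences.
  rcases le_or_gt ‖(γ : Euc d)‖ 1 with h | h
  · have h1 := norm_iteratedFDeriv_fourierCoef_le v ha γ hC0 x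
    have h2 : (1 + ‖(γ : Euc d)‖) ^ M ≤ 2 ^ M := by gcongr; linarith
    calc _ ≤ C0 * 2 ^ M := by gcongr
      _ ≤ _ := le_add_of_nonneg_right (by positivity)
  · have h0 : (γ : Euc d) ≠ 0 := by rintro h0; simp [h0] at h; linarith
    have hγ : γ ≠ 0 := by simpa using h0
    have hsym := isSymbol_iterate_diffOp ha (halfPeriod (γ : Euc d)) M
    have h1 := norm_iteratedFDeriv_fourierCoef_le v hsym γ
      (norm_iteratedFDeriv_iterate_diffOp_le ha (halfPeriod (γ : Euc d)) M hC1) x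
    have h2 : fourierCoef v ((diffOp (halfPeriod (γ : Euc d)))^[M] a) γ
        = ((-2) ^ M : ℂ) • fourierCoef v a γ :=
      funext fun x => fourierCoef_iterate_diffOp ha hp hγ M x
    rw [h2, iteratedFDeriv_const_smul_apply
      ((contDiff_fourierCoef v ha γ).of_le (by exact_mod_cast le_top)).contDiffAt, norm_smul,
      norm_pow, norm_neg, Complex.norm_ofNat, norm_halfPeriod] at h1
    have h3 : (1 + ‖(γ : Euc d)‖) ^ M ≤ 2 ^ M * ‖(γ : Euc d)‖ ^ M := by
      rw [← mul_pow]; gcongr; linarith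
    have h4 : 0 < ‖(γ : Euc d)‖ ^ M := by positivity
    calc ‖iteratedFDeriv ℝ m (fourierCoef v a γ) x‖ * (1 + ‖(γ : Euc d)‖) ^ M
        ≤ ‖iteratedFDeriv ℝ m (fourierCoef v a γ) x‖ * (2 ^ M * ‖(γ : Euc d)‖ ^ M) := by gcongr
      _ = (2 ^ M * ‖iteratedFDeriv ℝ m (fourierCoef v a γ) x‖) * ‖(γ : Euc d)‖ ^ M := by ring
      _ ≤ ((Real.pi * ‖(γ : Euc d)‖⁻¹) ^ M * C1) * ‖(γ : Euc d)‖ ^ M := by gcongr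
      _ = Real.pi ^ M * C1 := by rw [mul_pow, inv_pow]; field_simp
      _ ≤ _ := le_add_of_nonneg_left (by positivity)

theorem isFourierExpansion_fourierCoef {v : Basis (Fin d) ℝ (Euc d)} {a : Euc d × Euc d → ℂ}
    (ha : IsSymbol a) (hp : IsPeriodic v a) :
    IsFourierExpansion v a (fun γ => fourierCoef v a γ) := by
  refine ⟨fun γ => contDiff_fourierCoef v ha γ, exists_bound_fourierCoef ha hp, fun x k => ?_⟩
  obtain ⟨C, hC0, hC⟩ := exists_bound_fourierCoef ha hp 0 1
  refine hasSum_fourierSeries v (f := fun k => a (x, k)) (ha.continuous.comp (by fun_prop))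
    (fun g hg k => hp g hg x k) ?_ k
  refine Summable.of_norm_bounded ((summable_decay v).mul_left C) fun γ => ?_
  simpa [fourierCoef] using hC γ x

/-! ### Fourier transform -/

section Fourier

open scoped FourierTransform

variable {F : Type*} [NormedAddCommGroup F] [InnerProductSpace ℂ F] [CompleteSpace F]

/-- The Fourier transform without normalization, `∫ e^{-i y·ξ} f(y) dy`. -/
def ft (f : Euc d → F) (ξ : Euc d) : F := ∫ y, wave (-ξ) y • f y

theorem ft_eq_fourier (f : Euc d → F) (ξ : Euc d) : ft f ξ = 𝓕 f ((2 * Real.pi)⁻¹ • ξ) := by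
  rw [ft, Real.fourier_eq']
  refine integral_congr_ae (Filter.Eventually.of_forall fun y => ?_)
  have h : -2 * Real.pi * ⟪y, (2 * Real.pi)⁻¹ • ξ⟫_ℝ = -⟪y, ξ⟫_ℝ := by
    rw [real_inner_smul_right]
    field_simp
  simp only [h, wave, inner_neg_right, mul_comm Complex.I]

theorem continuous_ft {f : Euc d → F} (hf : Integrable f) : Continuous (ft f) := by
  have h : ft f = fun ξ => 𝓕 f ((2 * Real.pi)⁻¹ • ξ) := funext (ft_eq_fourier f)
  rw [h]
  exact (VectorFourier.fourierIntegral_continuous Real.continuous_fourierChar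
    (innerSL ℝ).continuous₂ hf).comp (by fun_prop)

/-- Fourier inversion. -/
theorem integral_wave_smul_ft {f : Euc d → F} (hc : Continuous f) (hf : Integrable f)
    (hft : Integrable (ft f)) (x : Euc d) :
    ((2 * Real.pi : ℂ) ^ d)⁻¹ • ∫ ξ, wave ξ x • ft f ξ = f x := by
  have hpi : (2 * Real.pi) ≠ 0 := by positivity
  have h1 : Integrable (𝓕 f) := by
    have := hft.comp_smul hpi
    refine this.congr (Filter.Eventually.of_forall fun ξ => ?_)
    simp only [ft_eq_fourier, smul_smul, inv_mul_cancel₀ hpi, one_smul]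
  have h2 := congrFun (hc.fourierInv_fourier_eq hf h1) x
  rw [Real.fourierInv_eq'] at h2
  -- The substitution `ξ ↦ 2πξ` produces the prefactor `(2π)^{-d}`.
  have h3 := Measure.integral_comp_smul volume (fun ξ => wave ξ x • ft f ξ) (2 * Real.pi)
  have h4 : ∀ ξ : Euc d, wave ((2 * Real.pi) • ξ) x • ft f ((2 * Real.pi) • ξ)
      = Complex.exp ((2 * Real.pi * ⟪ξ, x⟫_ℝ : ℝ) * Complex.I) • 𝓕 f ξ := by
    intro ξ
    rw [ft_eq_fourier, smul_smul, inv_mul_cancel₀ hpi, one_smul, wave, real_inner_smul_right,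
      real_inner_comm, mul_comm Complex.I]
  simp only [h4] at h3
  rw [h3] at h2
  rw [← h2, finrank_euclideanSpace, Fintype.card_fin, abs_of_nonneg (by positivity),
    ← Complex.coe_smul]
  push_cast
  rfl

theorem decay_smul_le (ξ : Euc d) :
    decay ((2 * Real.pi)⁻¹ • ξ) ≤ (2 * Real.pi) ^ (d + 1) * decay ξ := by
  have hpi : 1 ≤ 2 * Real.pi := by linarith [Real.pi_gt_three]
  have hpi0 : 0 < 2 * Real.pi := by linarith
  rw [decay, decay, ← div_eq_mul_inv, inv_le_comm₀ (by positivity) (by positivity), inv_div,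
    ← div_pow]
  gcongr
  rw [norm_smul, Real.norm_of_nonneg (by positivity), add_div, div_eq_inv_mul, div_eq_inv_mul]
  gcongr
  rw [mul_one]; exact inv_le_one_of_one_le₀ hpi

/-- Functions whose derivatives decay have a decaying Fourier transform. -/
theorem exists_norm_ft_le (d : ℕ) : ∃ C, 0 ≤ C ∧
    ∀ {F : Type*} [NormedAddCommGroup F] [InnerProductSpace ℂ F] [CompleteSpace F]
      {f : Euc d → F} (_ : ContDiff ℝ (⊤ : ℕ∞) f) {A : ℝ}
      (_ : ∀ p ≤ d + 1, ∀ y, ‖iteratedFDeriv ℝ p f y‖ ≤ A * decay y) (ξ : Euc d),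
      ‖ft f ξ‖ ≤ C * A * decay ξ := by
  set I : ℝ := ∫ y : Euc d, decay y
  have hI : 0 ≤ I := integral_nonneg fun y => decay_nonneg y
  refine ⟨2 ^ d * (I + 2 ^ (d + 1) * ((d + 2) * I)) * (2 * Real.pi) ^ (d + 1), by positivity, ?_⟩
  intro F _ _ _ f hf A hA ξ
  have hA0 : 0 ≤ A := by
    have h1 := (norm_nonneg _).trans (hA 0 (by omega) 0)
    exact nonneg_of_mul_nonneg_left h1 (decay_pos _)
  have hint : ∀ p ≤ d + 1, Integrable (fun y => ‖iteratedFDeriv ℝ p f y‖) := by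
    intro p hp
    refine (integrable_decay.const_mul A).mono' ?_ (Filter.Eventually.of_forall fun y => ?_)
    · exact (hf.continuous_iteratedFDeriv (by exact_mod_cast le_top)).norm.aestronglyMeasurable
    · rw [norm_norm]; exact hA p hp y
  have hle : ∀ p ≤ d + 1, ∫ y, ‖iteratedFDeriv ℝ p f y‖ ≤ A * I := by
    intro p hp
    rw [← integral_const_mul]
    exact integral_mono (hint p hp) (integrable_decay.const_mul A) (hA p hp)
  set w := (2 * Real.pi)⁻¹ • ξ
  -- Powers of the frequency are controlled by `L¹` norms of derivatives. Since the constant depends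
  -- on `f` only through `A`, the final estimate is uniform over families of functions.
  have key : ∀ n ≤ d + 1, ‖w‖ ^ n * ‖𝓕 f w‖ ≤ 2 ^ n * ((n + 1) * (A * I)) := by
    intro n hn
    have h := Real.pow_mul_norm_iteratedFDeriv_fourier_le (K := 0) (N := (d + 1 : ℕ))
      (hf.of_le (by exact_mod_cast le_top)) (fun k p hk hp => by
        have hk0 : k = 0 := by simpa using hk
        subst hk0
        simpa using hint p (by exact_mod_cast hp)) (k := 0) (n := n) (by simp)
        (by exact_mod_cast hn) w
    simp only [norm_iteratedFDeriv_zero, pow_zero, one_mul, Nat.cast_zero, mul_zero,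
      zero_add] at h
    refine h.trans ?_
    gcongr
    rw [Finset.sum_product]
    simp only [Finset.range_one, Finset.sum_singleton, pow_zero, one_mul]
    refine (Finset.sum_le_sum fun p hp => hle p ?_).trans_eq ?_
    · have := Finset.mem_range.1 hp; omega
    · simp
  have h0 := key 0 (by omega)
  have h1 := key (d + 1) le_rfl
  simp only [pow_zero, one_mul, Nat.cast_zero, zero_add] at h0
  -- Convexity of the power combines the bounds for `n = 0` and `n = d + 1`.
  have h2 : (1 + ‖w‖) ^ (d + 1) ≤ 2 ^ d * (1 + ‖w‖ ^ (d + 1)) := by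
    simpa using add_pow_le (zero_le_one) (norm_nonneg w) (d + 1)
  have h3 : ‖𝓕 f w‖ ≤ 2 ^ d * (I + 2 ^ (d + 1) * ((d + 2) * I)) * A * decay w := by
    rw [decay, ← div_eq_mul_inv, le_div_iff₀ (by positivity)]
    calc ‖𝓕 f w‖ * (1 + ‖w‖) ^ (d + 1) ≤ ‖𝓕 f w‖ * (2 ^ d * (1 + ‖w‖ ^ (d + 1))) := by gcongr
      _ = 2 ^ d * (‖𝓕 f w‖ + ‖w‖ ^ (d + 1) * ‖𝓕 f w‖) := by ring
      _ ≤ 2 ^ d * (A * I + 2 ^ (d + 1) * (((d + 1 : ℕ) + 1) * (A * I))) := by gcongr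
      _ = _ := by push_cast; ring
  rw [ft_eq_fourier]
  refine h3.trans ?_
  have h4 := decay_smul_le ξ
  calc _ ≤ 2 ^ d * (I + 2 ^ (d + 1) * ((d + 2) * I)) * A * ((2 * Real.pi) ^ (d + 1) * decay ξ) := by
        gcongr
    _ = _ := by ring

/-- All derivatives decay like the weight. -/
def HasDecay (f : Euc d → F) : Prop :=
  ContDiff ℝ (⊤ : ℕ∞) f ∧ ∀ m : ℕ, ∃ C, 0 ≤ C ∧ ∀ x, ‖iteratedFDeriv ℝ m f x‖ ≤ C * decay x

theorem HasDecay.norm_le {f : Euc d → F} (hf : HasDecay f) :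
    ∃ C, 0 ≤ C ∧ ∀ x, ‖f x‖ ≤ C * decay x := by
  obtain ⟨C, h0, hC⟩ := hf.2 0
  exact ⟨C, h0, by simpa using hC⟩

theorem integrable_of_norm_le_decay {f : Euc d → F} (hc : AEStronglyMeasurable f) {C : ℝ}
    (hf : ∀ x, ‖f x‖ ≤ C * decay x) : Integrable f :=
  (integrable_decay.const_mul C).mono' hc (Filter.Eventually.of_forall hf)

theorem HasDecay.integrable {f : Euc d → F} (hf : HasDecay f) : Integrable f := by
  obtain ⟨C, _, hC⟩ := hf.norm_le
  exact integrable_of_norm_le_decay hf.1.continuous.aestronglyMeasurable hC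

theorem HasDecay.norm_ft_le {f : Euc d → F} (hf : HasDecay f) :
    ∃ C, 0 ≤ C ∧ ∀ x, ‖ft f x‖ ≤ C * decay x := by
  obtain ⟨C, hC0, hC⟩ := exists_norm_ft_le d
  choose D hD0 hD using hf.2
  refine ⟨C * ∑ m ∈ Finset.range (d + 2), D m,
    mul_nonneg hC0 (Finset.sum_nonneg fun m _ => hD0 m), fun x => ?_⟩
  refine hC hf.1 (fun p hp y => (hD p y).trans ?_) x
  refine mul_le_mul_of_nonneg_right ?_ (decay_nonneg y)
  exact Finset.single_le_sum (f := D) (fun m _ => hD0 m) (Finset.mem_range.2 (by omega))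

theorem HasDecay.continuous_ft {f : Euc d → F} (hf : HasDecay f) : Continuous (ft f) :=
  BlochZak.continuous_ft hf.integrable

theorem HasDecay.integrable_ft {f : Euc d → F} (hf : HasDecay f) : Integrable (ft f) := by
  obtain ⟨C, _, hC⟩ := hf.norm_ft_le
  exact integrable_of_norm_le_decay hf.continuous_ft.aestronglyMeasurable hC

theorem HasDecay.inversion {f : Euc d → F} (hf : HasDecay f) (x : Euc d) :
    ((2 * Real.pi : ℂ) ^ d)⁻¹ • ∫ ξ, wave ξ x • ft f ξ = f x :=
  integral_wave_smul_ft hf.1.continuous hf.integrable hf.integrable_ft x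

theorem hasDecay_schwartz (f : 𝓢(Euc d, F)) : HasDecay f := by
  refine ⟨f.smooth _, fun m => ?_⟩
  refine ⟨2 ^ (d + 1) * (Finset.Iic (d + 1, m)).sup
    (fun n => SchwartzMap.seminorm ℝ n.1 n.2) f, by positivity, fun x => ?_⟩
  rw [decay, ← div_eq_mul_inv, le_div_iff₀ (by positivity), mul_comm]
  exact SchwartzMap.one_add_le_sup_seminorm_apply (𝕜 := ℝ) (m := (d + 1, m)) le_rfl le_rfl f x

/-- The reflected transform is the Schwartz function `𝓕 f` composed with multiplication by
`-1/(2π)`. -/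
theorem hasDecay_ft_neg (f : 𝓢(Euc d, F)) : HasDecay (fun x => ft f (-x)) := by
  set L : Euc d ≃L[ℝ] Euc d :=
    (LinearEquiv.smulOfNeZero ℝ (Euc d) (-(2 * Real.pi)⁻¹)
      (by simp [Real.pi_ne_zero])).toContinuousLinearEquiv
  have h : (fun x => ft f (-x)) = SchwartzMap.compCLMOfContinuousLinearEquiv ℝ L (𝓕 f) := by
    funext x
    rw [ft_eq_fourier]
    simp [L, SchwartzMap.fourier_coe]
  rw [h]
  exact hasDecay_schwartz _

end Fourier

/-! ### Weyl quantization of periodic symbols on Schwartz functions -/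

section WeylSeries

variable {F : Type*} [NormedAddCommGroup F] [InnerProductSpace ℂ F] [CompleteSpace F]
  {v : Basis (Fin d) ℝ (Euc d)} {a : Euc d × Euc d → ℂ} {c : lattice v → Euc d → ℂ}

theorem adjoint_scalarSymbol (a : Euc d × Euc d → ℂ) (z : Euc d × Euc d) (u : F) :
    ContinuousLinearMap.adjoint (scalarSymbol F a z) u = conj (a z) • u := by
  have h : scalarSymbol F a z = a z • (1 : F →L[ℂ] F) := rfl
  rw [h, map_smulₛₗ, smul_apply]
  congr 1
  rw [show (1 : F →L[ℂ] F) = ContinuousLinearMap.id ℂ F from rfl, ContinuousLinearMap.adjoint_id]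
  rfl

theorem IsFourierExpansion.norm_le (hc : IsFourierExpansion v a c) (N : ℕ) :
    ∃ C, 0 ≤ C ∧ ∀ γ x, ‖c γ x‖ ≤ C * decay (γ : Euc d) ^ N := by
  obtain ⟨C, h0, hC⟩ := hc.bound 0 N
  exact ⟨C, h0, by simpa using hC⟩

theorem IsFourierExpansion.conj_hasSum (hc : IsFourierExpansion v a c) (x k : Euc d) :
    HasSum (fun γ : lattice v => wave (-(γ : Euc d)) k * conj (c γ x)) (conj (a (x, k))) := by
  have := (Complex.conjCLE : ℂ →L[ℝ] ℂ).hasSum (hc.hasSum x k)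
  refine this.congr_fun fun γ => ?_
  simp [conj_wave, mul_comm]

theorem contDiff_conj_comp_affine (hc : IsFourierExpansion v a c) (γ : lattice v) (s : ℝ)
    (b : Euc d) : ContDiff ℝ (⊤ : ℕ∞) (fun y => conj (c γ (s • y + b))) := by
  have h1 : ContDiff ℝ (⊤ : ℕ∞) (fun y : Euc d => c γ (s • y + b)) :=
    (hc.contDiff γ).comp ((contDiff_const_smul s).add contDiff_const)
  exact (Complex.conjLIE.toContinuousLinearEquiv.contDiff).comp h1

/-- Conjugation is an isometry and the linear part of the affine map has norm at most one. The
values `s = 1` and `s = 1/2` are the ones needed. -/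
theorem norm_iteratedFDeriv_conj_comp_affine_le (hc : IsFourierExpansion v a c) (γ : lattice v)
    {s : ℝ} (hs : |s| ≤ 1) (b : Euc d) (m : ℕ) (y : Euc d) :
    ‖iteratedFDeriv ℝ m (fun y => conj (c γ (s • y + b))) y‖
      ≤ ‖iteratedFDeriv ℝ m (c γ) (s • y + b)‖ := by
  have h0 : (fun y => conj (c γ (s • y + b))) = Complex.conjLIE ∘ (fun y => c γ (s • y + b)) := rfl
  rw [h0, LinearIsometryEquiv.norm_iteratedFDeriv_comp_left]
  set L : Euc d →L[ℝ] Euc d := s • ContinuousLinearMap.id ℝ (Euc d)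
  have h1 : (fun y => c γ (s • y + b)) = (fun z => c γ (z + b)) ∘ L := rfl
  have h2 : ContDiff ℝ (⊤ : ℕ∞) (fun z => c γ (z + b)) :=
    (hc.contDiff γ).comp (contDiff_id.add contDiff_const)
  rw [h1, L.iteratedFDeriv_comp_right h2 y (by exact_mod_cast le_top)]
  refine (ContinuousMultilinearMap.norm_compContinuousLinearMap_le _ _).trans ?_
  have hL : ‖L‖ ≤ 1 := by
    refine (norm_smul_le s (ContinuousLinearMap.id ℝ (Euc d))).trans ?_
    exact mul_le_one₀ hs (norm_nonneg _) ContinuousLinearMap.norm_id_le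
  have h3 : ∏ _i : Fin m, ‖L‖ ≤ 1 :=
    Finset.prod_le_one (fun _ _ => norm_nonneg _) fun _ _ => hL
  rw [iteratedFDeriv_comp_add_right]
  exact mul_le_of_le_one_right (norm_nonneg _) h3

/-- Leibniz bound for a Fourier coefficient times a decaying function. -/
theorem exists_bound_conj_smul (hc : IsFourierExpansion v a c) {f : Euc d → F} (hf : HasDecay f)
    (N m : ℕ) : ∃ C, 0 ≤ C ∧ ∀ (γ : lattice v) (s : ℝ) (b e y : Euc d), |s| ≤ 1 →
      ‖iteratedFDeriv ℝ m (fun y => conj (c γ (s • y + b)) • f (y + e)) y‖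
        ≤ C * decay (γ : Euc d) ^ N * decay (y + e) := by
  choose B hB0 hB using fun i => hc.bound i N
  choose D hD0 hD using hf.2
  refine ⟨∑ i ∈ Finset.range (m + 1), (m.choose i : ℝ) * B i * D (m - i),
    Finset.sum_nonneg fun i _ => mul_nonneg (mul_nonneg (by positivity) (hB0 i)) (hD0 _),
    fun γ s b e y hs => ?_⟩
  have hfe : ContDiff ℝ (⊤ : ℕ∞) (fun y => f (y + e)) :=
    hf.1.comp (contDiff_id.add contDiff_const)
  have h := norm_iteratedFDeriv_smul_le (𝕜 := ℝ) (contDiff_conj_comp_affine hc γ s b) hfe y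
    (n := m) (by exact_mod_cast le_top)
  refine h.trans ?_
  rw [Finset.sum_mul, Finset.sum_mul]
  refine Finset.sum_le_sum fun i _ => ?_
  have h1 := (norm_iteratedFDeriv_conj_comp_affine_le hc γ hs b i y).trans (hB i γ _)
  have h2 : ‖iteratedFDeriv ℝ (m - i) (fun y => f (y + e)) y‖ ≤ D (m - i) * decay (y + e) := by
    rw [iteratedFDeriv_comp_add_right]; exact hD _ _
  have h3 := mul_le_mul h1 h2 (norm_nonneg _) (mul_nonneg (hB0 i) (pow_nonneg (decay_nonneg _) _))
  calc _ = (m.choose i : ℝ) * (‖iteratedFDeriv ℝ i (fun y => conj (c γ (s • y + b))) y‖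
          * ‖iteratedFDeriv ℝ (m - i) (fun y => f (y + e)) y‖) := by ring
    _ ≤ (m.choose i : ℝ) * (B i * decay (γ : Euc d) ^ N * (D (m - i) * decay (y + e))) := by gcongr
    _ = _ := by ring

/-- The formal adjoint of the operator `ψ ↦ ∑_γ c_γ(x + γ/2) ψ(x + γ)`. -/
def latticeOpAdj (c : lattice v → Euc d → ℂ) (f : Euc d → F) (x : Euc d) : F :=
  ∑' γ : lattice v, conj (c γ (x - (1 / 2 : ℝ) • (γ : Euc d))) • f (x - (γ : Euc d))

/-- Two powers of `decay γ` are requested from the coefficient: one moves the weight from `x - γ` to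
`x`, the other is kept to sum over `γ`. -/
theorem exists_bound_latticeOpAdj_term (hc : IsFourierExpansion v a c) {f : Euc d → F}
    (hf : HasDecay f) (m : ℕ) : ∃ C, 0 ≤ C ∧ ∀ (γ : lattice v) (x : Euc d),
      ‖iteratedFDeriv ℝ m (fun x => conj (c γ (x - (1 / 2 : ℝ) • (γ : Euc d))) • f (x - (γ : Euc d))) x‖
        ≤ C * decay (γ : Euc d) * decay x := by
  obtain ⟨C, hC0, hC⟩ := exists_bound_conj_smul hc hf 2 m
  refine ⟨C, hC0, fun γ x => ?_⟩
  have h := hC γ 1 (-((1 / 2 : ℝ) • (γ : Euc d))) (-γ) x (by simp)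
  simp only [one_smul, ← sub_eq_add_neg] at h
  refine h.trans ?_
  have h2 := decay_mul_decay_le (γ : Euc d) (x - (γ : Euc d))
  rw [add_sub_cancel] at h2
  calc C * decay (γ : Euc d) ^ 2 * decay (x - (γ : Euc d))
      = C * decay (γ : Euc d) * (decay (γ : Euc d) * decay (x - (γ : Euc d))) := by ring
    _ ≤ C * decay (γ : Euc d) * decay x := by
        gcongr
        exact mul_nonneg hC0 (decay_nonneg _)

theorem contDiff_latticeOpAdj_term (hc : IsFourierExpansion v a c) {f : Euc d → F}
    (hf : HasDecay f) (γ : lattice v) : ContDiff ℝ (⊤ : ℕ∞)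
      (fun x => conj (c γ (x - (1 / 2 : ℝ) • (γ : Euc d))) • f (x - (γ : Euc d))) := by
  have h := contDiff_conj_comp_affine hc γ 1 (-((1 / 2 : ℝ) • (γ : Euc d)))
  simp only [one_smul, ← sub_eq_add_neg] at h
  exact h.smul (hf.1.comp (contDiff_id.sub contDiff_const))

theorem hasSum_latticeOpAdj (hc : IsFourierExpansion v a c) {f : Euc d → F} (hf : HasDecay f)
    (x : Euc d) : HasSum (fun γ : lattice v =>
      conj (c γ (x - (1 / 2 : ℝ) • (γ : Euc d))) • f (x - (γ : Euc d))) (latticeOpAdj c f x) := by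
  obtain ⟨C, hC0, hC⟩ := exists_bound_latticeOpAdj_term hc hf 0
  refine Summable.hasSum (Summable.of_norm_bounded
    (((summable_decay v).mul_left C).mul_right (decay x)) fun γ => ?_)
  simpa using hC γ x

/-- The term bounds permit differentiation under the sum and retain the weight in `x`. Stability of
this class under the lattice sum is what later allows Fourier inversion. -/
theorem hasDecay_latticeOpAdj (hc : IsFourierExpansion v a c) {f : Euc d → F} (hf : HasDecay f) :
    HasDecay (latticeOpAdj c f) := by
  choose C hC0 hC using exists_bound_latticeOpAdj_term hc hf
  have hs : ∀ m, Summable fun γ : lattice v => C m * decay (γ : Euc d) :=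
    fun m => (summable_decay v).mul_left _
  have hb : ∀ (m : ℕ) (γ : lattice v) (x : Euc d), (m : ℕ∞) ≤ ⊤ →
      ‖iteratedFDeriv ℝ m (fun x => conj (c γ (x - (1 / 2 : ℝ) • (γ : Euc d))) • f (x - (γ : Euc d))) x‖
        ≤ C m * decay (γ : Euc d) := fun m γ x _ =>
    (hC m γ x).trans (mul_le_of_le_one_right (mul_nonneg (hC0 m) (decay_nonneg _)) (decay_le_one x))
  refine ⟨contDiff_tsum (N := ⊤) (fun γ => contDiff_latticeOpAdj_term hc hf γ)
    (fun m _ => hs m) hb, fun m => ?_⟩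
  refine ⟨∑' γ : lattice v, C m * decay (γ : Euc d), tsum_nonneg fun γ =>
    mul_nonneg (hC0 m) (decay_nonneg _), fun x => ?_⟩
  have h : iteratedFDeriv ℝ m (latticeOpAdj c f) = fun x => ∑' γ : lattice v,
      iteratedFDeriv ℝ m (fun x => conj (c γ (x - (1 / 2 : ℝ) • (γ : Euc d))) • f (x - (γ : Euc d))) x :=
    iteratedFDeriv_tsum (N := ⊤) (fun γ => contDiff_latticeOpAdj_term hc hf γ)
      (fun m _ => hs m) hb le_top
  rw [h, ← tsum_mul_right]
  exact tsum_of_norm_bounded ((hs m).mul_right (decay x)).hasSum fun γ => hC m γ x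

/-- The Weyl quantization of the pointwise adjoint of a scalar symbol periodic in momentum acts on
decaying functions as the adjoint lattice operator. -/
theorem weylSchwartz_periodic_momentum (hc : IsFourierExpansion v a c) {χ : Euc d → F}
    (hχ : HasDecay χ) (x : Euc d) :
    weylSchwartz (fun z => ContinuousLinearMap.adjoint (scalarSymbol F a z)) χ x
      = latticeOpAdj c χ x := by
  -- With `x` frozen, the `γ`-th part of the integrand is `g γ` times plane waves, and the inner
  -- integral becomes `ft (g γ)`.
  set g : lattice v → Euc d → F := fun γ y => conj (c γ ((1 / 2 : ℝ) • (x + y))) • χ y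
  have hg : ∀ m, ∃ C, 0 ≤ C ∧ ∀ γ y,
      ‖iteratedFDeriv ℝ m (g γ) y‖ ≤ C * decay (γ : Euc d) * decay y := by
    intro m
    obtain ⟨C, hC0, hC⟩ := exists_bound_conj_smul hc hχ 1 m
    refine ⟨C, hC0, fun γ y => ?_⟩
    have := hC γ (1 / 2) ((1 / 2 : ℝ) • x) 0 y (by rw [abs_of_pos] <;> norm_num)
    simpa [g, smul_add, add_comm] using this
  have hgd : ∀ γ, HasDecay (g γ) := by
    intro γ
    refine ⟨?_, fun m => ?_⟩
    · have := contDiff_conj_comp_affine hc γ (1 / 2) ((1 / 2 : ℝ) • x)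
      have h2 : g γ = fun y => conj (c γ ((1 / 2 : ℝ) • y + (1 / 2 : ℝ) • x)) • χ y := by
        funext y; simp only [g, smul_add, add_comm]
      rw [h2]
      exact this.smul hχ.1
    · obtain ⟨C, hC0, hC⟩ := hg m
      exact ⟨C * decay (γ : Euc d), mul_nonneg hC0 (decay_nonneg _), hC γ⟩
  choose B hB0 hB using hg
  obtain ⟨K, hK0, hK⟩ := exists_norm_ft_le d
  set D := ∑ m ∈ Finset.range (d + 2), B m
  -- Bounds summable in `γ` and integrable in `ξ` at once; they justify exchanging the sum with the
  -- outer integral.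
  have hft : ∀ γ ξ, ‖ft (g γ) ξ‖ ≤ K * (D * decay (γ : Euc d)) * decay ξ := by
    intro γ ξ
    refine hK (hgd γ).1 (fun p hp y => (hB p γ y).trans ?_) ξ
    have : B p ≤ D := Finset.single_le_sum (f := B) (fun m _ => hB0 m)
      (Finset.mem_range.2 (by omega))
    have h1 := decay_nonneg (γ : Euc d)
    have h2 := decay_nonneg y
    gcongr
  have hinner : ∀ ξ, HasSum (fun γ : lattice v => wave ξ (x - (γ : Euc d)) • ft (g γ) ξ)
      (∫ y, wave ξ (x - y) • ContinuousLinearMap.adjoint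
        (scalarSymbol F a ((1 / 2 : ℝ) • (x + y), ξ)) (χ y)) := by
    intro ξ
    have hpt : ∀ y, HasSum (fun γ : lattice v => wave ξ (x - (γ : Euc d)) • wave (-ξ) y • g γ y)
        (wave ξ (x - y) • ContinuousLinearMap.adjoint
          (scalarSymbol F a ((1 / 2 : ℝ) • (x + y), ξ)) (χ y)) := by
      intro y
      rw [adjoint_scalarSymbol]
      have h1 := ((hc.conj_hasSum ((1 / 2 : ℝ) • (x + y)) ξ).smul_const (χ y)).const_smul
        (wave ξ (x - y))
      refine h1.congr_fun fun γ => ?_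
      simp only [g, smul_smul]
      congr 1
      rw [sub_eq_add_neg, sub_eq_add_neg, wave_add_right, wave_add_right, wave_neg_right,
        wave_neg_right, wave_comm (-(γ : Euc d)), ← wave_neg_right ξ (γ : Euc d)]
      ring
    have h2 := hasSum_integral_of_summable_integral_norm (μ := volume)
      (F := fun (γ : lattice v) y => wave ξ (x - (γ : Euc d)) • wave (-ξ) y • g γ y) (fun γ => ?_) ?_
    · simp only [fun y => (hpt y).tsum_eq] at h2
      refine h2.congr_fun fun γ => ?_
      rw [ft, integral_smul]
    · refine Integrable.smul _ ?_
      refine (hgd γ).integrable.norm.mono' ?_ ?_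
      · exact ((continuous_wave _).smul (hgd γ).1.continuous).aestronglyMeasurable
      · exact Filter.Eventually.of_forall fun y => by rw [norm_smul, norm_wave, one_mul]
    · simp only [norm_smul, norm_wave, one_mul]
      refine Summable.of_nonneg_of_le (fun γ => integral_nonneg fun y => norm_nonneg _)
        (fun γ => ?_) (((summable_decay v).mul_left (B 0)).mul_right (∫ y : Euc d, decay y))
      rw [← integral_const_mul]
      refine integral_mono (hgd γ).integrable.norm (integrable_decay.const_mul _) fun y => ?_
      simpa using hB 0 γ y
  have hD0 : 0 ≤ D := Finset.sum_nonneg fun m _ => hB0 m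
  have houter := hasSum_integral_of_summable_integral_norm (μ := volume)
      (F := fun (γ : lattice v) ξ => wave ξ (x - (γ : Euc d)) • ft (g γ) ξ) (fun γ => ?_) ?_
  · simp only [fun ξ => (hinner ξ).tsum_eq] at houter
    rw [weylSchwartz, latticeOpAdj, ← houter.tsum_eq, ← tsum_const_smul'']
    refine tsum_congr fun γ => ?_
    -- Fourier inversion evaluates `g γ` at `x - γ`, where the midpoint with `x` is `x - γ/2`.
    rw [(hgd γ).inversion (x - (γ : Euc d))]
    simp only [g]
    congr 3
    rw [add_sub, ← two_smul ℝ x, smul_sub, smul_smul]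
    norm_num
  · refine (hgd γ).integrable_ft.norm.mono' ?_ ?_
    · exact (Continuous.smul (by fun_prop) (hgd γ).continuous_ft).aestronglyMeasurable
    · exact Filter.Eventually.of_forall fun y => by rw [norm_smul, norm_wave, one_mul]
  · simp only [norm_smul, norm_wave, one_mul]
    refine Summable.of_nonneg_of_le (fun γ => integral_nonneg fun y => norm_nonneg _)
      (fun γ => ?_) ((((summable_decay v).mul_left D).mul_left K).mul_right (∫ y : Euc d, decay y))
    rw [← integral_const_mul]
    exact integral_mono (hgd γ).integrable_ft.norm (integrable_decay.const_mul _) (hft γ)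

/-- The Weyl quantization of the pointwise adjoint of `(k, η) ↦ a(-η, k)`, for a scalar symbol `a`
periodic in its second variable, is the conjugate of the adjoint lattice operator under the
Fourier transform. -/
theorem weylSchwartz_periodic_position (hc : IsFourierExpansion v a c) {χ : Euc d → F}
    (hχ : HasDecay χ) (k : Euc d) :
    weylSchwartz (fun z => ContinuousLinearMap.adjoint
        (scalarSymbol F (fun z => a (-z.2, z.1)) z)) χ k
      = ((2 * Real.pi : ℂ) ^ d)⁻¹ • ft (latticeOpAdj c fun x => ft χ (-x)) k := by
  obtain ⟨B, hB0, hB⟩ := hc.norm_le 1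
  simp only [pow_one] at hB
  -- The factor `e^{-iγ·(k+y)/2}` at the Weyl midpoint splits evenly: half shifts the frequency in
  -- the wave at `k`, half the argument of `ft χ`.
  set h : lattice v → Euc d → F := fun γ η =>
    wave (η - (1 / 2 : ℝ) • (γ : Euc d)) k • conj (c γ (-η)) • ft χ (η + (1 / 2 : ℝ) • (γ : Euc d))
  have hinner : ∀ η, HasSum (fun γ : lattice v => h γ η)
      (∫ y, wave η (k - y) • ContinuousLinearMap.adjoint
        (scalarSymbol F (fun z => a (-z.2, z.1)) ((1 / 2 : ℝ) • (k + y), η)) (χ y)) := by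
    intro η
    set p : lattice v → Euc d → F := fun γ y =>
      (wave (η - (1 / 2 : ℝ) • (γ : Euc d)) k * conj (c γ (-η))) •
        wave (-(η + (1 / 2 : ℝ) • (γ : Euc d))) y • χ y
    have hpt : ∀ y, HasSum (fun γ : lattice v => p γ y)
        (wave η (k - y) • ContinuousLinearMap.adjoint
          (scalarSymbol F (fun z => a (-z.2, z.1)) ((1 / 2 : ℝ) • (k + y), η)) (χ y)) := by
      intro y
      rw [adjoint_scalarSymbol]
      have h1 := ((hc.conj_hasSum (-η) ((1 / 2 : ℝ) • (k + y))).smul_const (χ y)).const_smul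
        (wave η (k - y))
      refine h1.congr_fun fun γ => ?_
      simp only [p, smul_smul]
      congr 1
      have e1 : wave (-(γ : Euc d)) ((1 / 2 : ℝ) • (k + y))
          = wave (-((1 / 2 : ℝ) • (γ : Euc d))) k * wave (-((1 / 2 : ℝ) • (γ : Euc d))) y := by
        rw [← wave_add_right, wave, wave, real_inner_smul_left, ← smul_neg, real_inner_smul_right]
      rw [e1, sub_eq_add_neg, sub_eq_add_neg, wave_add_right, wave_add_left, wave_neg_right,
        neg_add, wave_add_left]
      ring
    have h2 := hasSum_integral_of_summable_integral_norm (μ := volume) (F := p) (fun γ => ?_) ?_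
    · simp only [fun y => (hpt y).tsum_eq] at h2
      refine h2.congr_fun fun γ => ?_
      rw [integral_smul, mul_smul]
      rfl
    · refine Integrable.smul _ ?_
      refine hχ.integrable.norm.mono' ?_ ?_
      · exact ((continuous_wave _).smul hχ.1.continuous).aestronglyMeasurable
      · exact Filter.Eventually.of_forall fun y => by rw [norm_smul, norm_wave, one_mul]
    · simp only [p, norm_smul, norm_mul, norm_wave, one_mul, RCLike.norm_conj]
      refine Summable.of_nonneg_of_le (fun γ => integral_nonneg fun y => by positivity)
        (fun γ => ?_) (((summable_decay v).mul_left B).mul_right (∫ y : Euc d, ‖χ y‖))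
      rw [integral_const_mul]
      exact mul_le_mul_of_nonneg_right (hB γ _) (integral_nonneg fun y => norm_nonneg _)
  have hcc : ∀ γ, Continuous (c γ) := fun γ => (hc.contDiff γ).continuous
  have hftc := hχ.continuous_ft
  have hnorm : ∀ γ η, ‖h γ η‖ ≤ B * decay (γ : Euc d) * ‖ft χ (η + (1 / 2 : ℝ) • (γ : Euc d))‖ := by
    intro γ η
    simp only [h, norm_smul, norm_wave, one_mul, RCLike.norm_conj]
    exact mul_le_mul_of_nonneg_right (hB γ _) (norm_nonneg _)
  have hhc : ∀ γ, Continuous (h γ) := by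
    intro γ
    have := hcc γ
    have h1 : Continuous fun η => conj (c γ (-η)) :=
      Complex.continuous_conj.comp ((hcc γ).comp continuous_neg)
    exact Continuous.smul (by fun_prop) (h1.smul (hftc.comp (by fun_prop)))
  have hshift : ∀ γ : lattice v,
      Integrable fun η => B * decay (γ : Euc d) * ‖ft χ (η + (1 / 2 : ℝ) • (γ : Euc d))‖ :=
    fun γ => (hχ.integrable_ft.comp_add_right _).norm.const_mul _
  have hint : ∀ γ, Integrable (h γ) := fun γ =>
    (hshift γ).mono' (hhc γ).aestronglyMeasurable (Filter.Eventually.of_forall (hnorm γ))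
  have hsum : Summable fun γ => ∫ η, ‖h γ η‖ := by
    refine Summable.of_nonneg_of_le (fun γ => integral_nonneg fun y => norm_nonneg _)
      (fun γ => ?_) (((summable_decay v).mul_left B).mul_right (∫ y : Euc d, ‖ft χ y‖))
    refine (integral_mono (hint γ).norm (hshift γ) (hnorm γ)).trans_eq ?_
    rw [integral_const_mul, integral_add_right_eq_self (fun η => ‖ft χ η‖)]
  have houter := hasSum_integral_of_summable_integral_norm (μ := volume) hint hsum
  simp only [fun η => (hinner η).tsum_eq] at houter
  -- The substitution `η = γ/2 - x`, different for each `γ`, aligns all terms on the common wave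
  -- `e^{-ix·k}`, so that they reassemble into one lattice sum under `ft`.
  have hrefl : ∀ (γ : lattice v) (x : Euc d), h γ ((1 / 2 : ℝ) • (γ : Euc d) - x)
      = wave (-k) x • conj (c γ (x - (1 / 2 : ℝ) • (γ : Euc d))) • ft χ (-(x - (γ : Euc d))) := by
    intro γ x
    have e1 : wave ((1 / 2 : ℝ) • (γ : Euc d) - x - (1 / 2 : ℝ) • (γ : Euc d)) k
        = wave (-k) x := by rw [sub_sub_cancel_left, wave_comm, wave_neg_right]
    have e2 : (1 / 2 : ℝ) • (γ : Euc d) - x + (1 / 2 : ℝ) • (γ : Euc d) = -(x - (γ : Euc d)) := by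
      rw [sub_add_eq_add_sub, ← add_smul, neg_sub]; norm_num
    simp only [h]
    rw [e1, e2, neg_sub]
  have hright := hasSum_integral_of_summable_integral_norm (μ := volume)
    (F := fun (γ : lattice v) x => h γ ((1 / 2 : ℝ) • (γ : Euc d) - x))
    (fun γ => (hint γ).comp_sub_left _) (by
      refine hsum.congr fun γ => ?_
      rw [integral_sub_left_eq_self (fun x => ‖h γ x‖)])
  simp only [fun γ : lattice v => integral_sub_left_eq_self (h γ) volume ((1 / 2 : ℝ) • (γ : Euc d))]
    at hright
  rw [weylSchwartz, ← houter.tsum_eq, hright.tsum_eq, ft]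
  congr 1
  refine integral_congr_ae (Filter.Eventually.of_forall fun x => ?_)
  simp only [hrefl]
  rw [tsum_const_smul'']
  rfl

end WeylSeries

/-! ### The Hilbert space `H_τ` -/

section HTauComplete

variable (v : Basis (Fin d) ℝ (Euc d))

theorem coeFn_tau (g : Euc d) (φ : Fibre v) :
    tau v g φ =ᵐ[volume.restrict (cell v)] fun y => wave g y * φ y :=
  coeFn_waveMul v g φ

theorem tau_add (g h : Euc d) (φ : Fibre v) : tau v (g + h) φ = tau v g (tau v h φ) := by
  apply Lp.ext
  filter_upwards [coeFn_tau v (g + h) φ, coeFn_tau v g (tau v h φ), coeFn_tau v h φ]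
    with y h1 h2 h3
  rw [h1, h2, h3, wave_add_left, mul_assoc]

@[simp] theorem tau_zero (φ : Fibre v) : tau v 0 φ = φ := by
  apply Lp.ext
  filter_upwards [coeFn_tau v 0 φ] with y h1
  rw [h1, wave_zero_left, one_mul]

theorem inner_tau_left (g : Euc d) (φ ψ : Fibre v) :
    ⟪tau v (-g) φ, ψ⟫_ℂ = ⟪φ, tau v g ψ⟫_ℂ := by
  rw [← (tau v g).inner_map_map, ← tau_add, add_neg_cancel, tau_zero]

theorem continuous_tau (φ : Fibre v) : Continuous fun k => tau v k φ := by
  obtain ⟨R, hR⟩ := (isCompact_cell v).isBounded.exists_norm_le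
  refine LipschitzWith.continuous (K := (|R| * ‖φ‖).toNNReal) (LipschitzWith.of_dist_le_mul
    fun k l => ?_)
  rw [Real.coe_toNNReal _ (by positivity), dist_eq_norm, dist_eq_norm]
  have h : ‖tau v k φ - tau v l φ‖ ≤ (|R| * ‖k - l‖) * ‖φ‖ := by
    refine Lp.norm_le_mul_norm_of_ae_le_mul ?_
    filter_upwards [coeFn_tau v k φ, coeFn_tau v l φ, Lp.coeFn_sub (tau v k φ) (tau v l φ),
      ae_restrict_mem (isCompact_cell v).measurableSet] with y h1 h2 h3 h4
    rw [h3, Pi.sub_apply, h1, h2, ← sub_mul, norm_mul]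
    gcongr
    refine (norm_wave_sub_wave_le k l y).trans ?_
    gcongr
    exact (hR y h4).trans (le_abs_self R)
  calc _ ≤ _ := h
    _ = _ := by ring

/-- The coordinates of the lattice point nearest to `k`. -/
def roundCoord (w : Basis (Fin d) ℝ (Euc d)) (k : Euc d) (j : Fin d) : ℤ := round (w.repr k j)

theorem measurable_roundCoord (w : Basis (Fin d) ℝ (Euc d)) : Measurable (roundCoord w) := by
  refine measurable_pi_iff.2 fun j => ?_
  have h : Continuous fun k => w.repr k j :=
    (continuous_apply j).comp w.equivFunL.continuous
  simp only [roundCoord, round_eq]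
  exact Int.measurable_floor.comp (h.measurable.add_const _)

/-- The lattice vector with given integer coordinates. -/
def latticeVec (w : Basis (Fin d) ℝ (Euc d)) (n : Fin d → ℤ) : Euc d := ∑ j, n j • w j

/-- Rounding commutes with integer shifts; this is what makes `tauExtend` equivariant everywhere. -/
theorem latticeVec_roundCoord_sub (w : Basis (Fin d) ℝ (Euc d)) (g : lattice w) (k : Euc d) :
    latticeVec w (roundCoord w (k - g)) = latticeVec w (roundCoord w k) - g := by
  have h : roundCoord w (k - g) = roundCoord w k - latticeCoord w g := by
    funext j
    simp only [roundCoord, map_sub, Finsupp.sub_apply, repr_lattice_eq_int, round_sub_intCast,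
      Pi.sub_apply]
    rfl
  have hg : latticeVec w (latticeCoord w g) = g := by
    have := (w.restrictScalars ℤ).sum_repr g
    have h2 := congrArg (Subtype.val) this
    rw [Submodule.coe_sum] at h2
    rw [← h2]
    refine Finset.sum_congr rfl fun j _ => ?_
    rw [Submodule.coe_smul, Basis.restrictScalars_apply]
    rfl
  rw [h, eq_sub_iff_add_eq, ← hg]
  conv_lhs => rw [hg, ← hg]
  simp [latticeVec, sub_smul]

theorem latticeVec_roundCoord_ae (w : Basis (Fin d) ℝ (Euc d)) :
    ∀ᵐ k : Euc d, k ∈ cell w → latticeVec w (roundCoord w k) = 0 := by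
  -- `round` sends `1/2` to `1`, so the upper faces of the cell have to be discarded.
  have h : ∀ᵐ x : Euc d, ∀ j, w.repr x j ≠ 1 / 2 :=
    ae_all_iff.2 fun j => by
      rw [ae_iff]; simpa using volume_repr_eq_zero w j (1 / 2)
  filter_upwards [h] with k hk hc
  have h0 : roundCoord w k = 0 := by
    funext j
    have h1 := hc j
    rw [roundCoord, round_eq, Pi.zero_apply, Int.floor_eq_zero_iff]
    refine ⟨by linarith [h1.1], ?_⟩
    have := lt_of_le_of_ne h1.2 (hk j)
    linarith
  simp [h0, latticeVec]

/-- The equivariant extension of a function on the cell. -/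
def tauExtend (f : Euc d → Fibre v) (k : Euc d) : Fibre v :=
  tau v (-latticeVec (dualBasis v) (roundCoord (dualBasis v) k))
    (f (k - latticeVec (dualBasis v) (roundCoord (dualBasis v) k)))

theorem tauExtend_sub (f : Euc d → Fibre v) (g : lattice (dualBasis v)) (k : Euc d) :
    tauExtend v f (k - g) = tau v g (tauExtend v f k) := by
  rw [tauExtend, tauExtend, latticeVec_roundCoord_sub, ← tau_add, sub_sub_sub_cancel_right, neg_sub,
    sub_eq_add_neg]

instance : Fact ((2 : ENNReal) ≠ ⊤) := ⟨ENNReal.ofNat_ne_top⟩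

/-- The extension is patched from countably many translates, selected by the measurable rounding
map. -/
theorem _root_.MeasureTheory.StronglyMeasurable.countable_select {X ι E : Type*}
    [MeasurableSpace X] [MeasurableSpace ι] [Countable ι] [MeasurableSingletonClass ι]
    [TopologicalSpace E] [TopologicalSpace.PseudoMetrizableSpace E] [SecondCountableTopology E]
    {n : X → ι} (hn : Measurable n) {f : ι → X → E} (hf : ∀ i, StronglyMeasurable (f i)) :
    StronglyMeasurable fun x => f (n x) x := by
  borelize E
  have h : Measurable fun p : ι × X => f p.1 p.2 :=
    measurable_from_prod_countable_right fun i => (hf i).measurable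
  exact (h.comp (hn.prodMk measurable_id)).stronglyMeasurable

theorem stronglyMeasurable_tauExtend {f : Euc d → Fibre v} (hf : StronglyMeasurable f) :
    StronglyMeasurable (tauExtend v f) := by
  refine StronglyMeasurable.countable_select (measurable_roundCoord (dualBasis v))
    (f := fun n k => tau v (-latticeVec (dualBasis v) n) (f (k - latticeVec (dualBasis v) n)))
    fun n => ?_
  exact (LinearIsometryEquiv.continuous _).comp_stronglyMeasurable
    (hf.comp_measurable (measurable_id.sub_const _))

/-- Integrability over one cell of a periodic function implies local integrability. -/
theorem integrableOn_compact_of_periodic (w : Basis (Fin d) ℝ (Euc d)) {N : Euc d → ℝ}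
    (hper : ∀ (g : lattice w) k, N (k - g) = N k) (hN : IntegrableOn N (cell w)) {K : Set (Euc d)}
    (hK : IsCompact K) : IntegrableOn N K := by
  -- A translate `g + cell w` meeting `K` has `g ∈ K - cell w`, a bounded set, so finitely many
  -- translates cover `K`.
  set S : Set (Euc d) := (K - cell w) ∩ lattice w
  have hS : S.Finite := ZSpan.setFinite_inter w (hK.isBounded.sub (isCompact_cell w).isBounded)
  have hcov : K ⊆ ⋃ g ∈ S, (g +ᵥ cell w) := by
    intro x hx
    obtain ⟨g, hg⟩ := exists_sub_mem_cell w x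
    refine Set.mem_iUnion₂.2 ⟨g, ⟨⟨x, hx, _, hg, by simp⟩, g.2⟩, ⟨x - g, hg, by simp⟩⟩
  refine IntegrableOn.mono_set ((integrableOn_finite_biUnion hS).2 fun g hg => ?_) hcov
  rw [← Set.image_vadd, (measurePreserving_vadd g volume).integrableOn_image
    (measurableEmbedding_const_vadd g)]
  refine hN.congr_fun (fun k _ => ?_) (isCompact_cell w).measurableSet
  have := hper ⟨g, hg.2⟩ (g + k)
  simpa [vadd_eq_add] using this

theorem smul_normalizedCell (w : Basis (Fin d) ℝ (Euc d)) :
    volume (cell w) • normalizedCell w = volume.restrict (cell w) := by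
  unfold normalizedCell
  rw [smul_smul, ENNReal.mul_inv_cancel (volume_cell_ne_zero w) (volume_cell_ne_top w), one_smul]

theorem coeFn_restrictCell (φ : HTau v) : restrictCell v φ =ᵐ[normalizedCell (dualBasis v)]
    (φ : Euc d →ₘ[(volume : Measure (Euc d))] Fibre v) :=
  (memLp_normalizedCell v φ).coeFn_toLp

/-- Extend from the cell by equivariance. The norm of the extension is `Γ*`-periodic because `τ` is
unitary, so square integrability on one cell gives it on every compact set. Completeness of `H_τ`
follows. -/
theorem restrictCell_surjective : Function.Surjective (restrictCell v) := by
  intro f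
  have hsm := stronglyMeasurable_tauExtend v (Lp.stronglyMeasurable f)
  have hcell : ∀ᵐ k : Euc d, k ∈ cell (dualBasis v) → tauExtend v f k = f k := by
    filter_upwards [latticeVec_roundCoord_ae (dualBasis v)] with k hk hc
    rw [tauExtend, hk hc, neg_zero, tau_zero, sub_zero]
  have hnc : ∀ᵐ k ∂(normalizedCell (dualBasis v)), tauExtend v f k = f k :=
    Measure.ae_smul_measure ((ae_restrict_iff' (isCompact_cell _).measurableSet).2 hcell) _
  have hmem : MemLp (tauExtend v f) 2 (volume.restrict (cell (dualBasis v))) := by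
    have h1 : MemLp (tauExtend v f) 2 (normalizedCell (dualBasis v)) :=
      (memLp_congr_ae hnc).2 (Lp.memLp f)
    have h2 := h1.smul_measure (c := volume (cell (dualBasis v))) (volume_cell_ne_top _)
    rwa [smul_normalizedCell] at h2
  have hmk := AEEqFun.coeFn_mk (tauExtend v f)
    (hsm.aestronglyMeasurable (μ := (volume : Measure (Euc d))))
  refine ⟨⟨AEEqFun.mk (tauExtend v f) hsm.aestronglyMeasurable, fun K hK => ?_, fun g hg => ?_⟩, ?_⟩
  · refine (memLp_congr_ae (ae_restrict_of_ae hmk)).2 ?_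
    rw [memLp_two_iff_integrable_sq_norm hsm.aestronglyMeasurable] at hmem ⊢
    refine integrableOn_compact_of_periodic (dualBasis v) (fun g k => ?_) hmem hK
    rw [tauExtend_sub, LinearIsometryEquiv.norm_map]
  · filter_upwards [hmk, (measurePreserving_sub_right volume g).quasiMeasurePreserving.ae hmk]
      with k h1 h2
    rw [h1, h2, tauExtend_sub v f ⟨g, hg⟩]
  · apply Lp.ext
    refine (coeFn_restrictCell v _).trans ?_
    filter_upwards [(normalizedCell_ac _).ae_le hmk, hnc] with k h1 h2
    rw [h1, h2]

theorem norm_restrictCell (φ : HTau v) : ‖restrictCell v φ‖ = ‖φ‖ := rfl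

instance : CompleteSpace (HTau v) := by
  have e : HTau v ≃ₗᵢ[ℂ] Lp (Fibre v) 2 (normalizedCell (dualBasis v)) :=
    { LinearEquiv.ofBijective (restrictCell v)
        ⟨restrictCell_injective v, restrictCell_surjective v⟩ with
      norm_map' := norm_restrictCell v }
  exact (completeSpace_congr (e := e.toEquiv) e.isometry.isUniformEmbedding).2 inferInstance

/-- A continuous equivariant function as an element of `H_τ`. -/
def HTau.ofContinuous (f : Euc d → Fibre v) (hf : Continuous f)
    (heq : ∀ g ∈ lattice (dualBasis v), ∀ k, f (k - g) = tau v g (f k)) : HTau v :=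
  ⟨AEEqFun.mk f hf.aestronglyMeasurable, by
    have hmk := AEEqFun.coeFn_mk f (hf.aestronglyMeasurable (μ := (volume : Measure (Euc d))))
    refine ⟨fun K hK => ?_, fun g hg => ?_⟩
    · refine (memLp_congr_ae (ae_restrict_of_ae hmk)).2 ?_
      obtain ⟨C, hC⟩ := (hK.image hf).isBounded.exists_norm_le
      have : IsFiniteMeasure (volume.restrict K) := ⟨by simpa using hK.measure_lt_top⟩
      exact MemLp.of_bound hf.aestronglyMeasurable C ((ae_restrict_iff' hK.measurableSet).2
        (Filter.Eventually.of_forall fun k hk => hC _ (Set.mem_image_of_mem f hk)))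
    · filter_upwards [hmk, (measurePreserving_sub_right volume g).quasiMeasurePreserving.ae hmk]
        with k h1 h2
      rw [h1, h2, heq g hg]⟩

theorem HTau.coeFn_ofContinuous {f : Euc d → Fibre v} (hf : Continuous f)
    (heq : ∀ g ∈ lattice (dualBasis v), ∀ k, f (k - g) = tau v g (f k)) :
    (HTau.ofContinuous v f hf heq : Euc d →ₘ[(volume : Measure (Euc d))] Fibre v)
      =ᵐ[volume] f :=
  AEEqFun.coeFn_mk f _

end HTauComplete

/-! ### The Zak transform -/

section Zak

variable (v : Basis (Fin d) ℝ (Euc d))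

theorem memLp_indicator_cell (φ : Fibre v) : MemLp ((cell v).indicator φ) 2 (volume : Measure (Euc d)) :=
  (memLp_indicator_iff_restrict (isCompact_cell v).measurableSet).2 (Lp.memLp φ)

/-- Extension by zero from the cell. -/
def extendZero : Fibre v →ₗᵢ[ℂ] L2 d where
  toFun φ := (memLp_indicator_cell v φ).toLp _
  map_add' φ ψ := by
    rw [← MemLp.toLp_add]
    refine MemLp.toLp_congr _ _ ?_
    have h := (ae_restrict_iff' (isCompact_cell v).measurableSet).1 (Lp.coeFn_add φ ψ)
    filter_upwards [h] with x hx
    by_cases hc : x ∈ cell v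
    · simp only [Pi.add_apply, Set.indicator_of_mem hc]
      exact hx hc
    · simp [hc]
  map_smul' c φ := by
    rw [RingHom.id_apply, ← MemLp.toLp_const_smul]
    refine MemLp.toLp_congr _ _ ?_
    have h := (ae_restrict_iff' (isCompact_cell v).measurableSet).1 (Lp.coeFn_smul c φ)
    filter_upwards [h] with x hx
    by_cases hc : x ∈ cell v
    · simp [hc, hx hc]
    · simp [hc]
  norm_map' φ := by
    change ‖(memLp_indicator_cell v φ).toLp _‖ = ‖φ‖
    rw [Lp.norm_toLp, eLpNorm_indicator_eq_eLpNorm_restrict (isCompact_cell v).measurableSet,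
      Lp.norm_def]

/-- Translation on `L²(ℝ^d)`. -/
def translate (g : Euc d) : L2 d →ₗᵢ[ℂ] L2 d :=
  Lp.compMeasurePreservingₗᵢ ℂ (fun x : Euc d => x + g) (measurePreserving_add_right volume g)

theorem coeFn_translate (g : Euc d) (f : L2 d) : translate g f =ᵐ[volume] fun x => f (x + g) :=
  Lp.coeFn_compMeasurePreserving f (measurePreserving_add_right volume g)

/-- The isometric embedding of the fibre onto the functions supported in the cell centred at `γ`. -/
def cellEmbedding (γ : lattice v) : Fibre v →ₗᵢ[ℂ] L2 d :=
  (translate (-(γ : Euc d))).comp (extendZero v)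

theorem ae_shift {p : Euc d → Prop} (h : ∀ᵐ x, p x) (g : Euc d) : ∀ᵐ x, p (x + g) :=
  (measurePreserving_add_right volume g).quasiMeasurePreserving.ae h

theorem coeFn_cellEmbedding (γ : lattice v) (φ : Fibre v) :
    cellEmbedding v γ φ =ᵐ[volume] fun x => (cell v).indicator φ (x - (γ : Euc d)) := by
  have h := ae_shift (memLp_indicator_cell v φ).coeFn_toLp (-(γ : Euc d))
  filter_upwards [coeFn_translate (-(γ : Euc d)) (extendZero v φ), h] with x h1 h2
  rw [sub_eq_add_neg, ← h2]
  exact h1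

theorem memLp_shift (γ : Euc d) (f : L2 d) :
    MemLp (fun y => f (y + γ)) 2 (volume.restrict (cell v)) :=
  ((Lp.memLp f).comp_measurePreserving (measurePreserving_add_right volume γ)).restrict _

/-- The piece of a function on the cell centred at `γ`, translated to the cell of the lattice. -/
def cellPiece (γ : Euc d) (f : L2 d) : Fibre v := (memLp_shift v γ f).toLp _

theorem coeFn_cellPiece (γ : Euc d) (f : L2 d) :
    cellPiece v γ f =ᵐ[volume.restrict (cell v)] fun y => f (y + γ) :=
  (memLp_shift v γ f).coeFn_toLp

/-- `cellPiece` is the adjoint of `cellEmbedding`, hence the coordinate map of the decomposition of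
`L²(ℝ^d)`. -/
theorem inner_cellEmbedding (γ : lattice v) (φ : Fibre v) (f : L2 d) :
    ⟪cellEmbedding v γ φ, f⟫_ℂ = ⟪φ, cellPiece v γ f⟫_ℂ := by
  rw [L2.inner_def, L2.inner_def]
  have h1 : ∫ x, ⟪cellEmbedding v γ φ x, f x⟫_ℂ
      = ∫ x, (cell v).indicator (fun y => ⟪φ y, f (y + γ)⟫_ℂ) (x - (γ : Euc d)) := by
    refine integral_congr_ae ?_
    filter_upwards [coeFn_cellEmbedding v γ φ] with x hx
    rw [hx]
    by_cases hc : x - (γ : Euc d) ∈ cell v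
    · simp [hc]
    · simp [hc]
  rw [h1, integral_sub_right_eq_self, integral_indicator (isCompact_cell v).measurableSet]
  refine integral_congr_ae ?_
  filter_upwards [coeFn_cellPiece v γ f] with y hy
  rw [hy]

theorem ae_unique_cell : ∀ᵐ x : Euc d, ∀ γ γ' : lattice v,
    x - (γ : Euc d) ∈ cell v → x - (γ' : Euc d) ∈ cell v → γ = γ' := by
  refine ae_all_iff.2 fun γ => ae_all_iff.2 fun γ' => ?_
  by_cases h : γ = γ'
  · exact Filter.Eventually.of_forall fun _ _ _ => h
  · have hd := (isAddFundamentalDomain_cell v).aedisjoint h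
    have h2 : ∀ᵐ x : Euc d, ¬ (x ∈ (γ +ᵥ cell v) ∩ (γ' +ᵥ cell v)) := measure_eq_zero_iff_ae_notMem.1 hd
    filter_upwards [h2] with x hx h3 h4
    exact absurd ⟨⟨_, h3, by simp⟩, ⟨_, h4, by simp⟩⟩ hx

/-- Distinct cells overlap in null sets, which gives orthogonality. A function orthogonal to
everything supported in each cell vanishes on each cell, and the cells cover. -/
theorem isHilbertSum_cellEmbedding :
    IsHilbertSum ℂ (fun _ : lattice v => Fibre v) (cellEmbedding v) := by
  refine IsHilbertSum.mk (fun γ γ' h φ ψ => ?_) ?_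
  · rw [L2.inner_def]
    refine integral_eq_zero_of_ae ?_
    filter_upwards [coeFn_cellEmbedding v γ φ, coeFn_cellEmbedding v γ' ψ, ae_unique_cell v]
      with x h1 h2 h3
    rw [h1, h2]
    by_cases hc : x - (γ : Euc d) ∈ cell v
    · by_cases hc' : x - (γ' : Euc d) ∈ cell v
      · exact absurd (h3 _ _ hc hc') h
      · simp [hc']
    · simp [hc]
  · rw [top_le_iff, Submodule.topologicalClosure_eq_top_iff, Submodule.eq_bot_iff]
    intro f hf
    have h0 : ∀ γ : lattice v, cellPiece v γ f = 0 := by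
      intro γ
      refine ext_inner_left ℂ fun φ => ?_
      rw [inner_zero_right, ← inner_cellEmbedding]
      exact (Submodule.mem_orthogonal _ _).1 hf _
        (Submodule.mem_iSup_of_mem γ (LinearMap.mem_range_self _ φ))
    have h1 : ∀ᵐ x : Euc d, ∀ γ : lattice v, x - (γ : Euc d) ∈ cell v → f x = 0 := by
      refine ae_all_iff.2 fun γ => ?_
      have h2 : ∀ᵐ y : Euc d, y ∈ cell v → f (y + γ) = 0 := by
        refine (ae_restrict_iff' (isCompact_cell v).measurableSet).1 ?_
        have h3 := coeFn_cellPiece v γ f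
        rw [h0 γ] at h3
        filter_upwards [h3, Lp.coeFn_zero ℂ 2 (volume.restrict (cell v))] with y h4 h5
        rw [← h4, h5]; rfl
      filter_upwards [ae_shift h2 (-(γ : Euc d))] with x hx hc
      rw [← sub_eq_add_neg, sub_add_cancel] at hx
      exact hx hc
    apply Lp.ext
    filter_upwards [h1, Lp.coeFn_zero ℂ 2 (volume : Measure (Euc d))] with x hx h5
    obtain ⟨γ, hγ⟩ := exists_sub_mem_cell v x
    rw [h5, hx γ hγ]; rfl

/-- The image of the functions on the cell centred at `γ` under the Zak transform. -/
def blochFun (γ : Euc d) (φ : Fibre v) (k : Euc d) : Fibre v := wave (-γ) k • tau v (-k) φ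

theorem continuous_blochFun (γ : Euc d) (φ : Fibre v) : Continuous (blochFun v γ φ) :=
  (continuous_wave _).smul ((continuous_tau v φ).comp continuous_neg)

theorem blochFun_sub (γ : lattice v) (φ : Fibre v) (g : Euc d) (hg : g ∈ lattice (dualBasis v))
    (k : Euc d) : blochFun v γ φ (k - g) = tau v g (blochFun v γ φ k) := by
  have h1 : wave (-(γ : Euc d)) (k - g) = wave (-(γ : Euc d)) k := by
    rw [sub_eq_add_neg, wave_add_lattice v (neg_mem γ.2) (neg_mem hg)]
  rw [blochFun, blochFun, h1, map_smul, ← tau_add, neg_sub, sub_eq_add_neg]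

theorem norm_blochFun (γ : Euc d) (φ : Fibre v) (k : Euc d) : ‖blochFun v γ φ k‖ = ‖φ‖ := by
  rw [blochFun, norm_smul, norm_wave, one_mul, LinearIsometryEquiv.norm_map]

theorem inner_blochFun (γ γ' : Euc d) (φ ψ : Fibre v) (k : Euc d) :
    ⟪blochFun v γ φ k, blochFun v γ' ψ k⟫_ℂ = wave (γ - γ') k * ⟪φ, ψ⟫_ℂ := by
  rw [blochFun, blochFun, inner_smul_left, inner_smul_right, LinearIsometryEquiv.inner_map_map,
    conj_wave, neg_neg, sub_eq_add_neg, wave_add_left, mul_assoc]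

/-- `blochFun` as an element of `H_τ`. -/
def blochElt (γ : lattice v) (φ : Fibre v) : HTau v :=
  HTau.ofContinuous v (blochFun v γ φ) (continuous_blochFun v γ φ) (blochFun_sub v γ φ)

theorem coeFn_blochElt (γ : lattice v) (φ : Fibre v) :
    (blochElt v γ φ : Euc d →ₘ[(volume : Measure (Euc d))] Fibre v) =ᵐ[volume] blochFun v γ φ :=
  HTau.coeFn_ofContinuous v _ _

theorem inner_blochElt (γ γ' : lattice v) (φ ψ : Fibre v) :
    ⟪blochElt v γ φ, blochElt v γ' ψ⟫_ℂ = if γ = γ' then ⟪φ, ψ⟫_ℂ else 0 := by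
  rw [inner_HTau]
  have h : ∫ k, ⟪(blochElt v γ φ : Euc d →ₘ[(volume : Measure (Euc d))] Fibre v) k,
      (blochElt v γ' ψ : Euc d →ₘ[(volume : Measure (Euc d))] Fibre v) k⟫_ℂ
        ∂(normalizedCell (dualBasis v))
      = ∫ k, wave ((γ - γ' : lattice v) : Euc d) k * ⟪φ, ψ⟫_ℂ ∂(normalizedCell (dualBasis v)) := by
    refine integral_congr_ae ?_
    filter_upwards [(normalizedCell_ac _).ae_le (coeFn_blochElt v γ φ),
      (normalizedCell_ac _).ae_le (coeFn_blochElt v γ' ψ)] with k h1 h2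
    rw [h1, h2, inner_blochFun]
    rfl
  rw [h, integral_mul_const, integral_wave_normalizedCell]
  simp [sub_eq_zero]

/-- The isometric embedding of the fibre into `H_τ` attached to a lattice vector. -/
def blochEmbedding (γ : lattice v) : Fibre v →ₗᵢ[ℂ] HTau v where
  toFun := blochElt v γ
  map_add' φ ψ := by
    apply Subtype.ext
    apply AEEqFun.ext
    filter_upwards [coeFn_blochElt v γ (φ + ψ), coeFn_blochElt v γ φ, coeFn_blochElt v γ ψ,
      AEEqFun.coeFn_add (blochElt v γ φ : Euc d →ₘ[(volume : Measure (Euc d))] Fibre v)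
        (blochElt v γ ψ)] with k h1 h2 h3 h4
    rw [h1]
    refine Eq.trans ?_ h4.symm
    rw [Pi.add_apply, h2, h3]
    simp [blochFun, map_add, smul_add]
  map_smul' c φ := by
    apply Subtype.ext
    apply AEEqFun.ext
    filter_upwards [coeFn_blochElt v γ (c • φ), coeFn_blochElt v γ φ,
      AEEqFun.coeFn_smul c (blochElt v γ φ : Euc d →ₘ[(volume : Measure (Euc d))] Fibre v)]
      with k h1 h2 h4
    rw [h1]
    refine Eq.trans ?_ h4.symm
    rw [Pi.smul_apply, h2]
    simp only [blochFun, map_smul]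
    rw [smul_comm]
  norm_map' φ := by
    change ‖blochElt v γ φ‖ = ‖φ‖
    have h := inner_blochElt v γ γ φ φ
    rw [if_pos rfl, inner_self_eq_norm_sq_to_K, inner_self_eq_norm_sq_to_K] at h
    have h2 : ‖blochElt v γ φ‖ ^ 2 = ‖φ‖ ^ 2 := by exact_mod_cast h
    exact (pow_left_inj₀ (norm_nonneg _) (norm_nonneg _) two_ne_zero).1 h2

/-- If `f` is orthogonal to all Bloch functions, then for each `φ` the scalar function `k ↦ ⟪τ(-k)
φ, f(k)⟫` has vanishing Fourier coefficients on `M*`, hence vanishes almost everywhere. -/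
theorem isHilbertSum_blochEmbedding :
    IsHilbertSum ℂ (fun _ : lattice v => Fibre v) (blochEmbedding v) := by
  refine IsHilbertSum.mk (fun γ γ' h φ ψ => ?_) ?_
  · exact (inner_blochElt v γ γ' φ ψ).trans (if_neg h)
  · rw [top_le_iff, Submodule.topologicalClosure_eq_top_iff, Submodule.eq_bot_iff]
    intro f hf
    have h0 : ∀ (γ : lattice v) (φ : Fibre v), ⟪blochElt v γ φ, f⟫_ℂ = 0 := fun γ φ =>
      (Submodule.mem_orthogonal _ _).1 hf _
        (Submodule.mem_iSup_of_mem γ (LinearMap.mem_range_self _ φ))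
    set F : Euc d → Fibre v := fun k => (f : Euc d →ₘ[(volume : Measure (Euc d))] Fibre v) k
    have hF : MemLp F 2 (normalizedCell (dualBasis v)) := memLp_normalizedCell v f
    have h1 : ∀ φ : Fibre v, ∀ᵐ k ∂(normalizedCell (dualBasis v)), ⟪tau v (-k) φ, F k⟫_ℂ = 0 := by
      intro φ
      have hm : MemLp (fun k => ⟪tau v (-k) φ, F k⟫_ℂ) 2 (normalizedCell (dualBasis v)) := by
        refine hF.of_le_mul (c := ‖φ‖) ?_ (Filter.Eventually.of_forall fun k => ?_)
        · exact ((continuous_tau v φ).comp continuous_neg).aestronglyMeasurable.inner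
            hF.aestronglyMeasurable
        · refine (norm_inner_le_norm _ _).trans_eq ?_
          rw [LinearIsometryEquiv.norm_map]
      refine ae_eq_zero_of_fourierCoeff_eq_zero v hm fun γ => ?_
      -- The inner product conjugates the wave of the Bloch function, hence the index `-γ`.
      rw [← h0 (-γ) φ, inner_HTau]
      refine integral_congr_ae ?_
      filter_upwards [(normalizedCell_ac _).ae_le (coeFn_blochElt v (-γ) φ)] with k hk
      rw [hk, blochFun, inner_smul_left, conj_wave, neg_neg]
    -- The exceptional null set depends on `φ`; a countable dense set of `φ` gives one null set for
    -- all.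
    obtain ⟨D, hDc, hD⟩ := TopologicalSpace.exists_countable_dense (Fibre v)
    have h2 : ∀ᵐ k ∂(normalizedCell (dualBasis v)), ∀ φ ∈ D, ⟪tau v (-k) φ, F k⟫_ℂ = 0 :=
      (ae_ball_iff hDc).2 fun φ _ => h1 φ
    have h3 : restrictCell v f = 0 := by
      apply Lp.ext
      filter_upwards [h2, coeFn_restrictCell v f,
        Lp.coeFn_zero (Fibre v) 2 (normalizedCell (dualBasis v))] with k h4 h5 h6
      rw [h5, h6]
      have h7 : tau v k (F k) = 0 := by
        refine hD.eq_zero_of_inner_right ℂ fun φ hφ => ?_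
        rw [← inner_tau_left]
        exact h4 φ hφ
      exact (tau v k).map_eq_zero_iff.1 h7
    exact restrictCell_injective v (h3.trans (map_zero _).symm)

/-- The Zak transform. -/
def zak : L2 d ≃ₗᵢ[ℂ] HTau v :=
  (isHilbertSum_cellEmbedding v).linearIsometryEquiv.trans
    (isHilbertSum_blochEmbedding v).linearIsometryEquiv.symm

theorem zak_cellEmbedding (γ : lattice v) (φ : Fibre v) :
    zak v (cellEmbedding v γ φ) = blochElt v γ φ := by
  classical
  rw [← (isHilbertSum_cellEmbedding v).linearIsometryEquiv_symm_apply_single, zak,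
    LinearIsometryEquiv.trans_apply, LinearIsometryEquiv.apply_symm_apply,
    (isHilbertSum_blochEmbedding v).linearIsometryEquiv_symm_apply_single]
  rfl

theorem cellEmbedding_coord (f : L2 d) (γ : lattice v) :
    (isHilbertSum_cellEmbedding v).linearIsometryEquiv f γ = cellPiece v γ f := by
  classical
  refine ext_inner_left ℂ fun φ => ?_
  rw [← inner_cellEmbedding, ← (isHilbertSum_cellEmbedding v).linearIsometryEquiv_symm_apply_single]
  rw [← LinearIsometryEquiv.inner_map_map
    (isHilbertSum_cellEmbedding v).linearIsometryEquiv, LinearIsometryEquiv.apply_symm_apply]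
  exact (lp.inner_single_left (G := fun _ : lattice v => Fibre v) γ φ _).symm

theorem hasSum_cellEmbedding (f : L2 d) :
    HasSum (fun γ : lattice v => cellEmbedding v γ (cellPiece v γ f)) f := by
  have h := (isHilbertSum_cellEmbedding v).hasSum_linearIsometryEquiv_symm
    ((isHilbertSum_cellEmbedding v).linearIsometryEquiv f)
  rw [LinearIsometryEquiv.symm_apply_apply] at h
  exact h.congr_fun fun γ => by rw [cellEmbedding_coord]

theorem hasSum_zak (f : L2 d) :
    HasSum (fun γ : lattice v => blochElt v γ (cellPiece v γ f)) (zak v f) := by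
  have h := (zak v).toContinuousLinearEquiv.toContinuousLinearMap.hasSum (hasSum_cellEmbedding v f)
  exact h.congr_fun fun γ => (zak_cellEmbedding v γ _).symm

end Zak

/-! ### The explicit formula for the Zak transform -/

theorem coeFn_finsetSum_Lp {X E ι : Type*} [MeasurableSpace X] {μ : Measure X}
    [NormedAddCommGroup E] (f : ι → Lp E 2 μ) (s : Finset ι) :
    ((∑ i ∈ s, f i : Lp E 2 μ) : X → E) =ᵐ[μ] fun x => ∑ i ∈ s, f i x := by
  classical
  induction s using Finset.induction_on with
  | empty =>
    filter_upwards [Lp.coeFn_zero E 2 μ] with x hx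
    simpa using hx
  | insert i s hi ih =>
    filter_upwards [ih, Lp.coeFn_add (f i) (∑ j ∈ s, f j)] with x h1 h2
    rw [Finset.sum_insert hi, Finset.sum_insert hi, h2, Pi.add_apply, h1]

/-- The sum of a series in `L²` agrees almost everywhere with its pointwise sum. -/
theorem ae_eq_of_hasSum_Lp {X E ι : Type*} [MeasurableSpace X] {μ : Measure X} [Countable ι]
    [NormedAddCommGroup E] {f : ι → Lp E 2 μ} {F : Lp E 2 μ} (h : HasSum f F) {G : X → E}
    (hG : ∀ᵐ x ∂μ, HasSum (fun i => f i x) (G x)) : F =ᵐ[μ] G := by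
  -- Convergence in `L²` gives almost everywhere convergence along a sequence of finite partial
  -- sums, which must share the limit of the full pointwise series.
  obtain ⟨ns, h1, h2⟩ := (tendstoInMeasure_of_tendsto_Lp h).exists_seq_tendsto_ae'
  filter_upwards [h2, hG, ae_all_iff.2 fun s => coeFn_finsetSum_Lp f s] with x h3 h4 h5
  simp only [h5] at h3
  exact tendsto_nhds_unique h3 (h4.comp h1)

section ZakFormula

variable (v : Basis (Fin d) ℝ (Euc d))

theorem coeFn_cellPiece_schwartz (γ : Euc d) (ψ : 𝓢(Euc d, ℂ)) :
    cellPiece v γ (ψ.toLp 2) =ᵐ[volume.restrict (cell v)] fun y => ψ (y + γ) := by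
  filter_upwards [coeFn_cellPiece v γ (ψ.toLp 2),
    ae_restrict_of_ae (ae_shift (ψ.coeFn_toLp 2 volume) γ)] with y h1 h2
  rw [h1, h2]

theorem exists_schwartz_cell_bound {F : Type*} [NormedAddCommGroup F] [InnerProductSpace ℂ F]
    (w : Basis (Fin d) ℝ (Euc d)) {f : Euc d → F} {A : ℝ} (hA : 0 ≤ A)
    (hf : ∀ x, ‖f x‖ ≤ A * decay x) :
    ∃ C, 0 ≤ C ∧ ∀ y ∈ cell w, ∀ g, ‖f (y + g)‖ ≤ C * decay g := by
  obtain ⟨K, hK0, hK⟩ := exists_decay_add_le w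
  refine ⟨A * K, mul_nonneg hA hK0, fun y hy g => (hf _).trans ?_⟩
  rw [mul_assoc]
  exact mul_le_mul_of_nonneg_left (hK y hy g) hA

theorem exists_norm_cellPiece_le (ψ : 𝓢(Euc d, ℂ)) :
    ∃ C, 0 ≤ C ∧ ∀ γ : Euc d, ‖cellPiece v γ (ψ.toLp 2)‖ ≤ C * decay γ := by
  obtain ⟨A, hA0, hA⟩ := (hasDecay_schwartz ψ).norm_le
  obtain ⟨C, hC0, hC⟩ := exists_schwartz_cell_bound v hA0 hA
  refine ⟨(measureUnivNNReal (volume.restrict (cell v)) : ℝ) ^ (2 : ENNReal).toReal⁻¹ * C,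
    by positivity, fun γ => ?_⟩
  rw [mul_assoc]
  refine Lp.norm_le_of_ae_bound (mul_nonneg hC0 (decay_nonneg γ)) ?_
  filter_upwards [coeFn_cellPiece_schwartz v γ ψ,
    ae_restrict_mem (isCompact_cell v).measurableSet] with y h1 h2
  rw [h1]
  exact hC y h2 γ

theorem summable_cellPiece (ψ : 𝓢(Euc d, ℂ)) :
    Summable fun γ : lattice v => ‖cellPiece v γ (ψ.toLp 2)‖ := by
  obtain ⟨C, _, hC⟩ := exists_norm_cellPiece_le v ψ
  exact Summable.of_nonneg_of_le (fun _ => norm_nonneg _) (fun γ => hC γ)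
    ((summable_decay v).mul_left C)

theorem hasSum_blochFun (ψ : 𝓢(Euc d, ℂ)) (k : Euc d) :
    HasSum (fun γ : lattice v => blochFun v γ (cellPiece v γ (ψ.toLp 2)) k)
      (∑' γ : lattice v, blochFun v γ (cellPiece v γ (ψ.toLp 2)) k) := by
  refine (Summable.of_norm ?_).hasSum
  simpa only [norm_blochFun] using summable_cellPiece v ψ

theorem hasSum_restrictCell {ι : Type*} {f : ι → HTau v} {a : HTau v} (h : HasSum f a) :
    HasSum (fun i => restrictCell v (f i)) (restrictCell v a) := by
  have hc : Continuous (restrictCell v) :=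
    AddMonoidHomClass.continuous_of_bound (restrictCell v) 1 fun φ => by
      rw [norm_restrictCell, one_mul]
  exact h.map (restrictCell v) hc

/-- For Schwartz `ψ` the norms of the cell pieces are summable, and Bloch functions have constant
norm in `k`. The series therefore converges uniformly to a continuous equivariant function,
identified with the Hilbert space sum on the cell. -/
theorem zak_schwartz (ψ : 𝓢(Euc d, ℂ)) :
    (zak v (ψ.toLp 2) : Euc d →ₘ[(volume : Measure (Euc d))] Fibre v)
      =ᵐ[volume] fun k => ∑' γ : lattice v, blochFun v γ (cellPiece v γ (ψ.toLp 2)) k := by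
  set Z : Euc d → Fibre v := fun k => ∑' γ : lattice v, blochFun v γ (cellPiece v γ (ψ.toLp 2)) k
  have hZc : Continuous Z := continuous_tsum (fun γ => continuous_blochFun v γ _)
    (summable_cellPiece v ψ) fun γ k => (norm_blochFun v _ _ k).le
  have hZe : ∀ g ∈ lattice (dualBasis v), ∀ k, Z (k - g) = tau v g (Z k) := by
    intro g hg k
    have h := (tau v g).toContinuousLinearEquiv.toContinuousLinearMap.hasSum (hasSum_blochFun v ψ k)
    refine (HasSum.tsum_eq ?_)
    exact h.congr_fun fun γ => blochFun_sub v γ _ g hg k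
  have h : zak v (ψ.toLp 2) = HTau.ofContinuous v Z hZc hZe := by
    apply restrictCell_injective v
    have h1 := hasSum_restrictCell v (hasSum_zak v (ψ.toLp 2 : L2 d))
    apply Lp.ext
    refine (ae_eq_of_hasSum_Lp h1 (G := Z) ?_).trans ?_
    · have h2 : ∀ᵐ k ∂(normalizedCell (dualBasis v)), ∀ γ : lattice v,
          restrictCell v (blochElt v γ (cellPiece v γ (ψ.toLp 2))) k
            = blochFun v γ (cellPiece v γ (ψ.toLp 2)) k := by
        refine ae_all_iff.2 fun γ => ?_
        exact (coeFn_restrictCell v _).trans ((normalizedCell_ac _).ae_le (coeFn_blochElt v γ _))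
      filter_upwards [h2] with k hk
      simp only [hk]
      exact hasSum_blochFun v ψ k
    · exact ((coeFn_restrictCell v _).trans
        ((normalizedCell_ac _).ae_le (HTau.coeFn_ofContinuous v hZc hZe))).symm
  rw [h]
  exact HTau.coeFn_ofContinuous v hZc hZe

theorem isZakTransform_zak : IsZakTransform v (zak v) := by
  intro ψ
  obtain ⟨A, hA0, hA⟩ := (hasDecay_schwartz ψ).norm_le
  obtain ⟨C, hC0, hC⟩ := exists_schwartz_cell_bound v hA0 hA
  filter_upwards [zak_schwartz v ψ] with k hk
  rw [hk]
  refine ae_eq_of_hasSum_Lp (hasSum_blochFun v ψ k) ?_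
  have h1 : ∀ᵐ y ∂(volume.restrict (cell v)), ∀ γ : lattice v,
      blochFun v γ (cellPiece v γ (ψ.toLp 2)) k y
        = wave (-k) (y + (γ : Euc d)) * ψ (y + (γ : Euc d)) := by
    refine ae_all_iff.2 fun γ => ?_
    filter_upwards [coeFn_cellPiece_schwartz v γ ψ, coeFn_tau v (-k) (cellPiece v γ (ψ.toLp 2)),
      Lp.coeFn_smul (wave (-(γ : Euc d)) k) (tau v (-k) (cellPiece v γ (ψ.toLp 2)))] with y h1 h2 h3
    rw [blochFun]
    refine h3.trans ?_
    rw [Pi.smul_apply, h2, h1, wave_add_right, smul_eq_mul, ← wave_neg_right k (γ : Euc d),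
      ← wave_comm (-(γ : Euc d)) k]
    ring
  filter_upwards [h1, ae_restrict_mem (isCompact_cell v).measurableSet] with y h2 h3
  simp only [h2]
  refine (Summable.of_norm_bounded ((summable_decay v).mul_left C) fun γ => ?_).hasSum
  rw [norm_mul, norm_wave, one_mul]
  exact hC y h3 γ

/-- The formula fixes the operator on Schwartz functions, which are dense in `L²`. -/
theorem isZakTransform_unique {U U' : L2 d ≃ₗᵢ[ℂ] HTau v} (hU : IsZakTransform v U)
    (hU' : IsZakTransform v U') : U = U' := by
  have h1 : ∀ ψ : 𝓢(Euc d, ℂ), U (ψ.toLp 2) = U' (ψ.toLp 2) := by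
    intro ψ
    apply Subtype.ext
    apply AEEqFun.ext
    filter_upwards [hU ψ, hU' ψ] with k h1 h2
    apply Lp.ext
    filter_upwards [h1, h2] with y h3 h4
    rw [h3, h4]
  have hd : DenseRange (SchwartzMap.toLpCLM ℝ ℂ 2 (volume : Measure (Euc d))) :=
    SchwartzMap.denseRange_toLpCLM ENNReal.ofNat_ne_top
  have h2 := hd.equalizer U.continuous U'.continuous (funext h1)
  exact LinearIsometryEquiv.ext fun f => congrFun h2 f

end ZakFormula

/-! ### The quantization on `L²(ℝ^d)` -/

theorem memLp_mul_L2 {m : Euc d → ℂ} (hm : Continuous m) {C : ℝ} (hC : ∀ x, ‖m x‖ ≤ C) (f : L2 d) :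
    MemLp (fun x => m x * f x) 2 (volume : Measure (Euc d)) :=
  (Lp.memLp f).of_le_mul (c := C) (hm.aestronglyMeasurable.mul (Lp.aestronglyMeasurable f))
    (Filter.Eventually.of_forall fun x => by
      rw [norm_mul]
      exact mul_le_mul_of_nonneg_right (hC x) (norm_nonneg _))

/-- Multiplication by a bounded continuous function on `L²(ℝ^d)`. -/
def mulL2 {m : Euc d → ℂ} (hm : Continuous m) {C : ℝ} (hC : ∀ x, ‖m x‖ ≤ C) : L2 d →L[ℂ] L2 d :=
  LinearMap.mkContinuous
    { toFun := fun f => (memLp_mul_L2 hm hC f).toLp _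
      map_add' := fun f g => by
        rw [← MemLp.toLp_add]
        refine MemLp.toLp_congr _ _ ?_
        filter_upwards [Lp.coeFn_add f g] with x hx
        rw [hx, Pi.add_apply, Pi.add_apply, mul_add]
      map_smul' := fun c f => by
        rw [RingHom.id_apply, ← MemLp.toLp_const_smul]
        refine MemLp.toLp_congr _ _ ?_
        filter_upwards [Lp.coeFn_smul c f] with x hx
        rw [hx, Pi.smul_apply, Pi.smul_apply, smul_eq_mul, smul_eq_mul, mul_left_comm] } C
    fun f => by
      refine Lp.norm_le_mul_norm_of_ae_le_mul ?_
      filter_upwards [(memLp_mul_L2 hm hC f).coeFn_toLp] with x hx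
      refine (congrArg norm hx).trans_le ?_
      rw [norm_mul]
      exact mul_le_mul_of_nonneg_right (hC x) (norm_nonneg _)

theorem coeFn_mulL2 {m : Euc d → ℂ} (hm : Continuous m) {C : ℝ} (hC : ∀ x, ‖m x‖ ≤ C) (f : L2 d) :
    mulL2 hm hC f =ᵐ[volume] fun x => m x * f x :=
  (memLp_mul_L2 hm hC f).coeFn_toLp

theorem norm_mulL2_le {m : Euc d → ℂ} (hm : Continuous m) {C : ℝ} (hC : ∀ x, ‖m x‖ ≤ C) :
    ‖mulL2 hm hC‖ ≤ C :=
  LinearMap.mkContinuous_norm_le _ ((norm_nonneg _).trans (hC 0)) _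

section LatticeOp

variable {v : Basis (Fin d) ℝ (Euc d)} {a : Euc d × Euc d → ℂ} {c : lattice v → Euc d → ℂ}

theorem continuous_conj_comp_sub (hc : IsFourierExpansion v a c) (γ : lattice v) :
    Continuous fun x => conj (c γ (x - (1 / 2 : ℝ) • (γ : Euc d))) :=
  Complex.continuous_conj.comp ((hc.contDiff γ).continuous.comp (by fun_prop))

/-- A single term `f ↦ conj c_γ(x - γ/2) f(x - γ)`. -/
theorem exists_latticeTermL2 (hc : IsFourierExpansion v a c) (γ : lattice v) {C : ℝ}
    (hC : ∀ x, ‖c γ x‖ ≤ C) : ∃ S : L2 d →L[ℂ] L2 d, ‖S‖ ≤ C ∧ ∀ h : L2 d,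
      S h =ᵐ[volume] fun x =>
        conj (c γ (x - (1 / 2 : ℝ) • (γ : Euc d))) • h (x - (γ : Euc d)) := by
  have hb : ∀ x : Euc d, ‖conj (c γ (x - (1 / 2 : ℝ) • (γ : Euc d)))‖ ≤ C := fun x => by
    rw [RCLike.norm_conj]
    exact hC _
  refine ⟨(mulL2 (continuous_conj_comp_sub hc γ) hb).comp
    (translate (-(γ : Euc d))).toContinuousLinearMap, ?_, fun h => ?_⟩
  · refine (ContinuousLinearMap.opNorm_comp_le _ _).trans ?_
    refine (mul_le_mul (norm_mulL2_le _ hb)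
      (LinearIsometry.norm_toContinuousLinearMap_le _) (norm_nonneg _)
      ((norm_nonneg _).trans (hC 0))).trans_eq (mul_one _)
  · filter_upwards [coeFn_mulL2 (continuous_conj_comp_sub hc γ) hb (translate (-(γ : Euc d)) h),
      coeFn_translate (-(γ : Euc d)) h] with x h3 h4
    rw [smul_eq_mul, sub_eq_add_neg x (γ : Euc d), ← h4]
    exact h3

/-- The operator `f ↦ ∑ conj c_γ(x - γ/2) f(x - γ)` is bounded on `L²(ℝ^d)`. -/
theorem exists_latticeOpL2 (hc : IsFourierExpansion v a c) :
    ∃ S : L2 d →L[ℂ] L2 d, ∀ (h : L2 d) (H : Euc d → ℂ),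
      (∀ᵐ x, HasSum (fun γ : lattice v =>
        conj (c γ (x - (1 / 2 : ℝ) • (γ : Euc d))) • h (x - (γ : Euc d))) (H x)) →
      S h =ᵐ[volume] H := by
  obtain ⟨C, hC0, hC⟩ := hc.norm_le 1
  choose S hSn hS using fun γ : lattice v => exists_latticeTermL2 hc γ (hC γ)
  have hsum : Summable S := by
    refine Summable.of_norm_bounded ((summable_decay v).mul_left C) fun γ => ?_
    exact (hSn γ).trans_eq (by rw [pow_one])
  -- The series converges in operator norm. The pointwise criterion evaluates it on any `L²`
  -- function whose lattice sum converges almost everywhere, not only on Schwartz functions.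
  refine ⟨∑' γ, S γ, fun h H hH => ?_⟩
  have h1 : HasSum (fun γ => S γ h) ((∑' γ, S γ) h) :=
    (ContinuousLinearMap.apply ℂ (L2 d) h).hasSum hsum.hasSum
  refine ae_eq_of_hasSum_Lp h1 ?_
  filter_upwards [hH, ae_all_iff.2 fun γ => hS γ h] with x h3 h4
  simpa only [h4] using h3

/-- Weyl quantization acts by duality, and on test functions the quantization of the adjoint symbol
is `S`; the operator itself is therefore `S*`. -/
theorem isWeylImage_L2_adjoint (hc : IsFourierExpansion v a c) {S : L2 d →L[ℂ] L2 d}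
    (hS : ∀ (h : L2 d) (H : Euc d → ℂ), (∀ᵐ x, HasSum (fun γ : lattice v =>
        conj (c γ (x - (1 / 2 : ℝ) • (γ : Euc d))) • h (x - (γ : Euc d))) (H x)) →
      S h =ᵐ[volume] H) (ψ : L2 d) :
    IsWeylImage (scalarSymbol ℂ a) ψ (ContinuousLinearMap.adjoint S ψ) := by
  intro χ
  have h1 : S (χ.toLp 2) =ᵐ[volume] latticeOpAdj c χ := by
    refine hS _ _ ?_
    have h2 : ∀ᵐ x, ∀ γ : lattice v, (χ.toLp 2 : L2 d) (x - (γ : Euc d)) = χ (x - (γ : Euc d)) :=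
      ae_all_iff.2 fun γ => by
        simpa only [sub_eq_add_neg] using ae_shift (χ.coeFn_toLp 2 volume) (-(γ : Euc d))
    filter_upwards [h2] with x hx
    simp only [hx]
    exact hasSum_latticeOpAdj hc (hasDecay_schwartz χ) x
  have h3 := ContinuousLinearMap.adjoint_inner_right S (χ.toLp 2) ψ
  rw [L2.inner_def, L2.inner_def] at h3
  refine Eq.trans (integral_congr_ae ?_) (h3.trans (integral_congr_ae ?_))
  · filter_upwards [χ.coeFn_toLp 2 volume] with x hx
    rw [hx]
  · filter_upwards [h1] with x hx
    rw [hx, ← weylSchwartz_periodic_momentum hc (hasDecay_schwartz χ)]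

end LatticeOp

theorem L2_eq_of_forall_schwartz {f g : L2 d}
    (h : ∀ χ : 𝓢(Euc d, ℂ), ∫ x, ⟪χ x, f x⟫_ℂ = ∫ x, ⟪χ x, g x⟫_ℂ) : f = g := by
  have hd : DenseRange (SchwartzMap.toLpCLM ℝ ℂ 2 (volume : Measure (Euc d))) :=
    SchwartzMap.denseRange_toLpCLM ENNReal.ofNat_ne_top
  have h1 : ∀ (χ : 𝓢(Euc d, ℂ)) (f : L2 d), ⟪(χ.toLp 2 : L2 d), f⟫_ℂ = ∫ x, ⟪χ x, f x⟫_ℂ := by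
    intro χ f
    rw [L2.inner_def]
    refine integral_congr_ae ?_
    filter_upwards [χ.coeFn_toLp 2 volume] with x hx
    rw [hx]
  rw [← sub_eq_zero]
  refine hd.eq_zero_of_inner_right ℂ ?_
  intro χ
  change ⟪(χ.toLp 2 : L2 d), f - g⟫_ℂ = 0
  rw [inner_sub_right, h1, h1, h χ, sub_self]

theorem IsWeylOpL2.unique {ε : ℝ} {a : Euc d × Euc d → ℂ} {T T' : L2 d →L[ℂ] L2 d}
    (hT : IsWeylOpL2 ε a T) (hT' : IsWeylOpL2 ε a T') : T = T' :=
  ContinuousLinearMap.ext fun ψ =>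
    L2_eq_of_forall_schwartz fun χ => (hT ψ χ).trans (hT' ψ χ).symm

/-! ### Pairing of decaying functions with `H_τ` -/

section Pairing

variable (v : Basis (Fin d) ℝ (Euc d))

theorem HTau.ae_norm_add (φ : HTau v) : ∀ᵐ k : Euc d, ∀ g : lattice (dualBasis v),
    ‖(φ : Euc d →ₘ[(volume : Measure (Euc d))] Fibre v) (g +ᵥ k)‖
      = ‖(φ : Euc d →ₘ[(volume : Measure (Euc d))] Fibre v) k‖ := by
  refine ae_all_iff.2 fun g => ?_
  filter_upwards [φ.2.2 (-(g : Euc d)) (neg_mem g.2)] with k hk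
  have : (g +ᵥ k : Euc d) = k - -(g : Euc d) := by
    rw [sub_neg_eq_add, add_comm]; rfl
  rw [this, hk, LinearIsometryEquiv.norm_map]

/-- The fibre norm of `φ` is `Γ*`-periodic, so the integral over `ℝ^d` splits into cell integrals
weighted by summable values of the weight. On one cell the `L¹` norm is dominated by the `L²` norm.
-/
theorem exists_lintegral_decay_HTau_le : ∃ C : NNReal, ∀ φ : HTau v,
    ∫⁻ k, ENNReal.ofReal (decay k) *
      ‖(φ : Euc d →ₘ[(volume : Measure (Euc d))] Fibre v) k‖ₑ ≤ C * ENNReal.ofReal ‖φ‖ := by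
  obtain ⟨A, hA0, hA⟩ := exists_decay_add_le (dualBasis v)
  have hs := (summable_decay (dualBasis v)).mul_left A
  set D : ℝ := ∑' g : lattice (dualBasis v), A * decay (g : Euc d)
  have hD : ∑' g : lattice (dualBasis v), ENNReal.ofReal (A * decay (g : Euc d))
      = ENNReal.ofReal D :=
    (ENNReal.ofReal_tsum_of_nonneg (fun g => mul_nonneg hA0 (decay_nonneg _)) hs).symm
  refine ⟨D.toNNReal * (volume (cell (dualBasis v))).toNNReal, fun φ => ?_⟩
  set N : Euc d → ENNReal := fun k => ‖(φ : Euc d →ₘ[(volume : Measure (Euc d))] Fibre v) k‖ₑ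
  have hN : ∫⁻ k in cell (dualBasis v), N k
      ≤ volume (cell (dualBasis v)) * ENNReal.ofReal ‖φ‖ := by
    rw [← smul_normalizedCell, lintegral_smul_measure, smul_eq_mul]
    gcongr
    have h1 := eLpNorm_le_eLpNorm_of_exponent_le (p := 1) (q := 2) one_le_two
      (memLp_normalizedCell v φ).aestronglyMeasurable
    rw [eLpNorm_one_eq_lintegral_enorm] at h1
    refine h1.trans_eq ?_
    rw [← norm_restrictCell, Lp.norm_def, ENNReal.ofReal_toReal (Lp.eLpNorm_ne_top _)]
    exact eLpNorm_congr_ae (coeFn_restrictCell v φ).symm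
  rw [(isAddFundamentalDomain_cell (dualBasis v)).lintegral_eq_tsum'']
  have h2 : ∀ g : lattice (dualBasis v),
      ∫⁻ k in cell (dualBasis v), ENNReal.ofReal (decay (g +ᵥ k : Euc d)) * N (g +ᵥ k)
        ≤ ENNReal.ofReal (A * decay (g : Euc d)) * ∫⁻ k in cell (dualBasis v), N k := by
    intro g
    rw [← lintegral_const_mul' _ _ ENNReal.ofReal_ne_top]
    refine lintegral_mono_ae ?_
    filter_upwards [ae_restrict_of_ae (HTau.ae_norm_add v φ),
      ae_restrict_mem (isCompact_cell _).measurableSet] with k h3 h4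
    have h5 : N (g +ᵥ k) = N k := by
      simp only [N, enorm_eq_nnnorm]
      congr 1
      exact Subtype.ext (h3 g)
    rw [h5]
    gcongr
    have := hA k h4 g
    rwa [add_comm] at this
  refine (ENNReal.tsum_le_tsum h2).trans ?_
  rw [ENNReal.tsum_mul_right, hD]
  refine (mul_le_mul_right hN _).trans_eq ?_
  rw [← mul_assoc, ENNReal.coe_mul, ENNReal.coe_toNNReal (volume_cell_ne_top _)]
  rfl

end Pairing

section Pairing

variable (v : Basis (Fin d) ℝ (Euc d))

theorem exists_integral_decay_HTau_le : ∃ C, 0 ≤ C ∧ ∀ φ : HTau v,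
    Integrable (fun k => decay k *
      ‖(φ : Euc d →ₘ[(volume : Measure (Euc d))] Fibre v) k‖) ∧
    ∫ k, decay k * ‖(φ : Euc d →ₘ[(volume : Measure (Euc d))] Fibre v) k‖ ≤ C * ‖φ‖ := by
  obtain ⟨C, hC⟩ := exists_lintegral_decay_HTau_le v
  refine ⟨C, C.2, fun φ => ?_⟩
  have hm : AEStronglyMeasurable (fun k : Euc d => decay k *
      ‖(φ : Euc d →ₘ[(volume : Measure (Euc d))] Fibre v) k‖) :=
    continuous_decay.aestronglyMeasurable.mul
      (φ : Euc d →ₘ[(volume : Measure (Euc d))] Fibre v).aestronglyMeasurable.norm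
  have h0 : ∀ k : Euc d, 0 ≤ decay k * ‖(φ : Euc d →ₘ[(volume : Measure (Euc d))] Fibre v) k‖ :=
    fun k => mul_nonneg (decay_nonneg k) (norm_nonneg _)
  have h1 : ∫⁻ k, ENNReal.ofReal (decay k *
      ‖(φ : Euc d →ₘ[(volume : Measure (Euc d))] Fibre v) k‖) ≤ C * ENNReal.ofReal ‖φ‖ := by
    refine (lintegral_congr fun k => ?_).trans_le (hC φ)
    rw [ENNReal.ofReal_mul (decay_nonneg k), ofReal_norm]
  have h2 : (C : ENNReal) * ENNReal.ofReal ‖φ‖ ≠ ⊤ :=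
    ENNReal.mul_ne_top ENNReal.coe_ne_top ENNReal.ofReal_ne_top
  constructor
  · refine ⟨hm, ?_⟩
    rw [hasFiniteIntegral_iff_ofReal (Filter.Eventually.of_forall h0)]
    exact h1.trans_lt h2.lt_top
  · rw [integral_eq_lintegral_of_nonneg_ae (Filter.Eventually.of_forall h0) hm]
    refine (ENNReal.toReal_mono h2 h1).trans_eq ?_
    rw [ENNReal.toReal_mul, ENNReal.coe_toReal, ENNReal.toReal_ofReal (norm_nonneg _)]

theorem HTau.integrable_norm_mul_norm {K : Euc d → Fibre v} (hK : AEStronglyMeasurable K) {A : ℝ}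
    (hA : ∀ k, ‖K k‖ ≤ A * decay k) (φ : HTau v) : Integrable (fun k =>
      ‖K k‖ * ‖(φ : Euc d →ₘ[(volume : Measure (Euc d))] Fibre v) k‖) := by
  obtain ⟨C, _, hC⟩ := exists_integral_decay_HTau_le v
  refine ((hC φ).1.const_mul A).mono'
    (hK.norm.mul (φ : Euc d →ₘ[(volume : Measure (Euc d))] Fibre v).aestronglyMeasurable.norm)
    (Filter.Eventually.of_forall fun k => ?_)
  rw [norm_mul, norm_norm, norm_norm, ← mul_assoc]
  exact mul_le_mul_of_nonneg_right (hA k) (norm_nonneg _)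

theorem HTau.integrable_inner {K : Euc d → Fibre v} (hK : AEStronglyMeasurable K) {A : ℝ}
    (hA : ∀ k, ‖K k‖ ≤ A * decay k) (φ : HTau v) : Integrable (fun k =>
      ⟪K k, (φ : Euc d →ₘ[(volume : Measure (Euc d))] Fibre v) k⟫_ℂ) :=
  (HTau.integrable_norm_mul_norm v hK hA φ).mono'
    (hK.inner (φ : Euc d →ₘ[(volume : Measure (Euc d))] Fibre v).aestronglyMeasurable)
    (Filter.Eventually.of_forall fun _ => norm_inner_le_norm _ _)

/-- The functional `φ ↦ ∫ ⟪K(k), φ(k)⟫ dk` on `H_τ`, pulled back by the Zak transform. -/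
theorem exists_zakAdjoint {K : Euc d → Fibre v} (hK : AEStronglyMeasurable K) {A : ℝ}
    (hA : ∀ k, ‖K k‖ ≤ A * decay k) : ∃ G : L2 d, ∀ ψ : L2 d,
      ⟪G, ψ⟫_ℂ = ∫ k, ⟪K k, (zak v ψ : Euc d →ₘ[(volume : Measure (Euc d))] Fibre v) k⟫_ℂ := by
  obtain ⟨C, hC0, hC⟩ := exists_integral_decay_HTau_le v
  have hA0 : 0 ≤ A := nonneg_of_mul_nonneg_left ((norm_nonneg _).trans (hA 0)) (decay_pos 0)
  set L : L2 d →ₗ[ℂ] ℂ :=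
    { toFun := fun ψ =>
        ∫ k, ⟪K k, (zak v ψ : Euc d →ₘ[(volume : Measure (Euc d))] Fibre v) k⟫_ℂ
      map_add' := fun ψ ψ' => by
        rw [← integral_add (HTau.integrable_inner v hK hA _) (HTau.integrable_inner v hK hA _)]
        refine integral_congr_ae ?_
        filter_upwards [AEEqFun.coeFn_add
          (zak v ψ : Euc d →ₘ[(volume : Measure (Euc d))] Fibre v) (zak v ψ')] with k hk
        rw [map_add, ← inner_add_right]
        exact congrArg _ hk
      map_smul' := fun c ψ => by
        rw [RingHom.id_apply, smul_eq_mul, ← integral_const_mul]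
        refine integral_congr_ae ?_
        filter_upwards [AEEqFun.coeFn_smul c
          (zak v ψ : Euc d →ₘ[(volume : Measure (Euc d))] Fibre v)] with k hk
        rw [map_smul, ← inner_smul_right]
        exact congrArg _ hk }
  have hL : ∀ ψ, ‖L ψ‖ ≤ (A * C) * ‖ψ‖ := by
    intro ψ
    refine (norm_integral_le_of_norm_le ((hC (zak v ψ)).1.const_mul A)
      (Filter.Eventually.of_forall fun k => ?_)).trans ?_
    · refine (norm_inner_le_norm _ _).trans ?_
      rw [← mul_assoc]
      exact mul_le_mul_of_nonneg_right (hA k) (norm_nonneg _)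
    · rw [integral_const_mul, mul_assoc, ← (zak v).norm_map ψ]
      exact mul_le_mul_of_nonneg_left (hC _).2 hA0
  refine ⟨(InnerProductSpace.toDual ℂ (L2 d)).symm (L.mkContinuous _ hL), fun ψ => ?_⟩
  rw [InnerProductSpace.toDual_symm_apply]
  rfl

theorem memLp_mul_Fibre {m : Euc d → ℂ} (hm : Continuous m) {C : ℝ} (hC : ∀ x, ‖m x‖ ≤ C)
    (φ : Fibre v) : MemLp (fun x => m x * φ x) 2 (volume.restrict (cell v)) :=
  (Lp.memLp φ).of_le_mul (c := C) (hm.aestronglyMeasurable.mul (Lp.aestronglyMeasurable φ))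
    (Filter.Eventually.of_forall fun x => by
      rw [norm_mul]
      exact mul_le_mul_of_nonneg_right (hC x) (norm_nonneg _))

/-- Fubini: the `k`-dependence is the single wave `e^{-ik·(y+γ)}`, so integrating first in `k`
leaves a Fourier transform at `-(y + γ)`. -/
theorem integral_inner_blochFun {f : Euc d → ℂ} (hf : Integrable f) (ζ η : Fibre v)
    (γ : Euc d) : ∫ k, ⟪f k • ζ, blochFun v γ η k⟫_ℂ
      = ∫ y in cell v, ⟪ft f (-(y + γ)) * ζ y, η y⟫_ℂ := by
  have hu : Integrable (fun y => ⟪ζ y, η y⟫_ℂ) (volume.restrict (cell v)) :=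
    L2.integrable_inner ζ η
  have h1 : ∀ k, ⟪f k • ζ, blochFun v γ η k⟫_ℂ
      = ∫ y in cell v, (starRingEnd ℂ (f k) * ⟪ζ y, η y⟫_ℂ) * wave (-k) (y + γ) := by
    intro k
    rw [blochFun, inner_smul_left, inner_smul_right, L2.inner_def, ← integral_const_mul,
      ← integral_const_mul]
    refine integral_congr_ae ?_
    filter_upwards [coeFn_tau v (-k) η] with y hy
    rw [hy, ← smul_eq_mul (wave (-k) y), inner_smul_right, wave_add_right,
      wave_comm (-k) γ, wave_neg_right]
    ring
  have h2 : ∀ y, ⟪ft f (-(y + γ)) * ζ y, η y⟫_ℂ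
      = ∫ k, (starRingEnd ℂ (f k) * ⟪ζ y, η y⟫_ℂ) * wave (-k) (y + γ) := by
    intro y
    rw [← smul_eq_mul, inner_smul_left, ft, ← integral_conj, ← integral_mul_const]
    refine integral_congr_ae (Filter.Eventually.of_forall fun k => ?_)
    simp only [neg_neg, smul_eq_mul, map_mul, conj_wave]
    rw [wave_comm (-(y + γ)) k, wave_neg_right]
    ring
  simp only [h1, h2]
  refine integral_integral_swap ?_
  have h3 : Integrable (fun p : Euc d × Euc d => starRingEnd ℂ (f p.1) * ⟪ζ p.2, η p.2⟫_ℂ)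
      ((volume : Measure (Euc d)).prod (volume.restrict (cell v))) :=
    Integrable.mul_prod (hf.norm.congr' (Complex.continuous_conj.comp_aestronglyMeasurable hf.1)
      (Filter.Eventually.of_forall fun k => by simp)) hu
  refine h3.mul_bdd (c := 1) ?_ (Filter.Eventually.of_forall fun p => (norm_wave _ _).le)
  exact Continuous.aestronglyMeasurable (by fun_prop)

variable {v}

/-- The Riesz representative of the pairing with `f ζ` is the product of the inverse Fourier
transform of `f` and the periodic extension of `ζ`. -/
theorem coeFn_zakAdjoint {f : Euc d → ℂ} (hf : Integrable f) {ζ : Fibre v} {G : L2 d}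
    (hG : ∀ ψ : L2 d, ⟪G, ψ⟫_ℂ
      = ∫ k, ⟪f k • ζ, (zak v ψ : Euc d →ₘ[(volume : Measure (Euc d))] Fibre v) k⟫_ℂ) :
    ∀ᵐ x, ∀ γ : lattice v, x - (γ : Euc d) ∈ cell v →
      G x = ft f (-x) * ζ (x - (γ : Euc d)) := by
  refine ae_all_iff.2 fun γ => ?_
  have hm : Continuous fun y : Euc d => ft f (-(y + γ)) := (continuous_ft hf).comp (by fun_prop)
  have hb : ∀ y : Euc d, ‖ft f (-(y + γ))‖ ≤ ∫ k, ‖f k‖ := fun y => by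
    refine (norm_integral_le_integral_norm _).trans_eq ?_
    simp [norm_wave]
  -- Test against functions supported in the cell at `γ`, whose Zak transforms are single Bloch
  -- functions.
  have h1 : cellPiece v γ G = (memLp_mul_Fibre v hm hb ζ).toLp _ := by
    refine ext_inner_right ℂ fun η => ?_
    rw [← inner_conj_symm, ← inner_cellEmbedding, inner_conj_symm, hG, zak_cellEmbedding,
      L2.inner_def]
    refine Eq.trans (integral_congr_ae ?_) ((integral_inner_blochFun v hf ζ η γ).trans
      (integral_congr_ae ?_))
    · filter_upwards [coeFn_blochElt v γ η] with k hk
      rw [hk]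
    · filter_upwards [(memLp_mul_Fibre v hm hb ζ).coeFn_toLp] with y hy
      rw [hy]
  have h2 : ∀ᵐ y : Euc d, y ∈ cell v → G (y + γ) = ft f (-(y + γ)) * ζ y := by
    refine (ae_restrict_iff' (isCompact_cell v).measurableSet).1 ?_
    have h3 := coeFn_cellPiece v γ G
    rw [h1] at h3
    filter_upwards [h3, (memLp_mul_Fibre v hm hb ζ).coeFn_toLp] with y h4 h5
    rw [← h4, h5]
  filter_upwards [ae_shift h2 (-(γ : Euc d))] with x hx hc
  rw [← sub_eq_add_neg, sub_add_cancel] at hx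
  exact hx hc

end Pairing

/-! ### The quantization on `H_τ` -/

section Position

variable {F : Type*} [NormedAddCommGroup F] [InnerProductSpace ℂ F] [CompleteSpace F]
variable {v : Basis (Fin d) ℝ (Euc d)} {a : Euc d × Euc d → ℂ} {c : lattice v → Euc d → ℂ}

/-- The Fourier conjugate of `latticeOpAdj`. -/
def latticeOpAdjFourier (c : lattice v → Euc d → ℂ) (f : Euc d → F) (k : Euc d) : F :=
  ((2 * Real.pi : ℂ) ^ d)⁻¹ • ft (latticeOpAdj c fun x => ft f (-x)) k

theorem hasDecay_latticeOpAdj_ft (hc : IsFourierExpansion v a c) (f : 𝓢(Euc d, F)) :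
    HasDecay (latticeOpAdj c fun x => ft f (-x)) :=
  hasDecay_latticeOpAdj hc (hasDecay_ft_neg f)

theorem continuous_latticeOpAdjFourier (hc : IsFourierExpansion v a c) (f : 𝓢(Euc d, F)) :
    Continuous (latticeOpAdjFourier c f) :=
  (hasDecay_latticeOpAdj_ft hc f).continuous_ft.const_smul _

theorem exists_norm_latticeOpAdjFourier_le (hc : IsFourierExpansion v a c) (f : 𝓢(Euc d, F)) :
    ∃ C, ∀ k, ‖latticeOpAdjFourier c f k‖ ≤ C * decay k := by
  obtain ⟨C, _, hC⟩ := (hasDecay_latticeOpAdj_ft hc f).norm_ft_le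
  refine ⟨‖((2 * Real.pi : ℂ) ^ d)⁻¹‖ * C, fun k => ?_⟩
  rw [latticeOpAdjFourier, norm_smul, mul_assoc]
  exact mul_le_mul_of_nonneg_left (hC k) (norm_nonneg _)

/-- Fourier inversion undoes the outer transform, exhibiting the new test function as the lattice
sum acting on the Fourier side. -/
theorem ft_latticeOpAdjFourier_neg (hc : IsFourierExpansion v a c) (f : 𝓢(Euc d, F)) (x : Euc d) :
    ft (latticeOpAdjFourier c f) (-x) = latticeOpAdj c (fun x => ft f (-x)) x := by
  rw [← (hasDecay_latticeOpAdj_ft hc f).inversion x, ← integral_smul, ft]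
  refine integral_congr_ae (Filter.Eventually.of_forall fun k => ?_)
  simp only [latticeOpAdjFourier, neg_neg]
  rw [wave_comm x k, smul_comm]

theorem clm_ft {f : Euc d → F} (hf : Integrable f) (L : F →L[ℂ] ℂ) (x : Euc d) :
    L (ft f x) = ft (fun y => L (f y)) x := by
  have h : Integrable fun y => wave (-x) y • f y :=
    hf.norm.mono' ((continuous_wave _).aestronglyMeasurable.smul hf.1)
      (Filter.Eventually.of_forall fun y => by rw [norm_smul, norm_wave, one_mul])
  rw [ft, ← L.integral_comp_comm h]
  simp only [map_smul, ft]

/-- Continuous functionals pass through the integrals and the series; this reduces fibre-valued test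
functions to scalar coefficients. -/
theorem clm_latticeOpAdjFourier (hc : IsFourierExpansion v a c) (f : 𝓢(Euc d, F)) (L : F →L[ℂ] ℂ)
    (k : Euc d) : L (latticeOpAdjFourier c f k) = latticeOpAdjFourier c (fun y => L (f y)) k := by
  rw [latticeOpAdjFourier, map_smul, clm_ft (hasDecay_latticeOpAdj_ft hc f).integrable]
  have h : (fun y => L (latticeOpAdj c (fun x => ft f (-x)) y))
      = latticeOpAdj c fun x => ft (fun y => L (f y)) (-x) := by
    funext y
    have h1 := L.hasSum (hasSum_latticeOpAdj hc (hasDecay_ft_neg f) y)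
    rw [← h1.tsum_eq]
    simp only [map_smul, clm_ft (hasDecay_schwartz f).integrable L]
    rfl
  rw [h]
  rfl

end Position

section Elementary

variable {v : Basis (Fin d) ℝ (Euc d)} {a : Euc d × Euc d → ℂ} {c : lattice v → Euc d → ℂ}

/-- The duality relation between the quantization on `H_τ` and its adjoint, for the test
functions `f ζ`. -/
theorem integral_inner_zak_adjoint_smul (hc : IsFourierExpansion v a c) {S : L2 d →L[ℂ] L2 d}
    (hS : ∀ (h : L2 d) (H : Euc d → ℂ), (∀ᵐ x, HasSum (fun γ : lattice v =>
        conj (c γ (x - (1 / 2 : ℝ) • (γ : Euc d))) • h (x - (γ : Euc d))) (H x)) →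
      S h =ᵐ[volume] H) (f : 𝓢(Euc d, ℂ)) (ζ : Fibre v) (ψ : L2 d) :
    ∫ k, ⟪f k • ζ, (zak v (ContinuousLinearMap.adjoint S ψ) :
        Euc d →ₘ[(volume : Measure (Euc d))] Fibre v) k⟫_ℂ
      = ∫ k, ⟪latticeOpAdjFourier c f k • ζ,
          (zak v ψ : Euc d →ₘ[(volume : Measure (Euc d))] Fibre v) k⟫_ℂ := by
  obtain ⟨A, _, hA⟩ := (hasDecay_schwartz f).norm_le
  obtain ⟨A', hA'⟩ := exists_norm_latticeOpAdjFourier_le hc f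
  have hcont := continuous_latticeOpAdjFourier hc f
  have hbd : ∀ {g : Euc d → ℂ} {A : ℝ}, (∀ k, ‖g k‖ ≤ A * decay k) →
      ∀ k, ‖g k • ζ‖ ≤ (‖ζ‖ * A) * decay k := fun h k => by
    rw [norm_smul, mul_comm, mul_assoc]
    exact mul_le_mul_of_nonneg_left (h k) (norm_nonneg _)
  obtain ⟨G, hG⟩ := exists_zakAdjoint v (K := fun k => f k • ζ)
    (f.continuous.smul continuous_const).aestronglyMeasurable (hbd hA)
  obtain ⟨G', hG'⟩ := exists_zakAdjoint v (K := fun k => latticeOpAdjFourier c f k • ζ)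
    (hcont.smul continuous_const).aestronglyMeasurable (hbd hA')
  rw [← hG, ← hG', ContinuousLinearMap.adjoint_inner_right]
  have h1 := coeFn_zakAdjoint (hasDecay_schwartz f).integrable hG
  have h2 := coeFn_zakAdjoint (integrable_of_norm_le_decay hcont.aestronglyMeasurable hA') hG'
  -- The crux: `G` is a transform times the `Γ`-periodic extension of `ζ`, which `S` treats as a
  -- constant because its translations lie in `Γ`.
  have h3 : S G = G' := by
    apply Lp.ext
    refine hS G G' ?_
    have h4 : ∀ᵐ x, ∀ γ' : lattice v, ∀ γ : lattice v, x - (γ' : Euc d) - (γ : Euc d) ∈ cell v →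
        G (x - (γ' : Euc d)) = ft f (-(x - (γ' : Euc d))) * ζ (x - (γ' : Euc d) - (γ : Euc d)) :=
      ae_all_iff.2 fun γ' => by
        simpa only [sub_eq_add_neg] using ae_shift h1 (-(γ' : Euc d))
    filter_upwards [h2, h4] with x h5 h6
    obtain ⟨γ, hγ⟩ := exists_sub_mem_cell v x
    rw [h5 γ hγ, ft_latticeOpAdjFourier_neg hc]
    refine ((hasSum_latticeOpAdj hc (hasDecay_ft_neg f) x).mul_right (ζ (x - (γ : Euc d)))).congr_fun
      fun γ' => ?_
    -- If `γ` carries `x` to the cell, then `γ - γ'` carries `x - γ'` to the same point: this is the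
    -- periodicity of the extension.
    have h7 : x - (γ' : Euc d) - ((γ - γ' : lattice v) : Euc d) = x - (γ : Euc d) := by
      rw [Submodule.coe_sub]; abel
    rw [h6 γ' (γ - γ') (by rw [h7]; exact hγ), h7]
    simp only [smul_eq_mul, mul_assoc]
  rw [h3]

end Elementary

/-! ### Expansion in a Hilbert basis of the fibre -/

/-- Distinct basis vectors are at distance `√2`, so balls of radius `1/2` about them are disjoint,
and separability allows only countably many. -/
theorem _root_.HilbertBasis.countable {ι E : Type*} [NormedAddCommGroup E] [InnerProductSpace ℂ E]
    [TopologicalSpace.SeparableSpace E] (b : HilbertBasis ι ℂ E) : Countable ι := by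
  refine Pairwise.countable_of_isOpen_disjoint (s := fun i => Metric.ball (b i) (1 / 2))
    (fun i j hij => ?_) (fun _ => Metric.isOpen_ball)
    fun i => Metric.nonempty_ball.2 (by norm_num)
  refine Metric.ball_disjoint_ball ?_
  have h1 : ‖b i - b j‖ ^ 2 = 2 := by
    rw [@norm_sub_sq ℂ, b.orthonormal.1 i, b.orthonormal.1 j, b.orthonormal.2 hij]
    norm_num
  rw [dist_eq_norm]
  nlinarith [norm_nonneg (b i - b j)]

/-- Cauchy–Schwarz and Bessel; the bound is independent of the finite set and serves as the
dominating function below. -/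
theorem _root_.HilbertBasis.norm_sum_inner_mul_inner_le {ι E : Type*} [NormedAddCommGroup E]
    [InnerProductSpace ℂ E] (b : HilbertBasis ι ℂ E) (s : Finset ι) (x y : E) :
    ‖∑ i ∈ s, ⟪x, b i⟫_ℂ * ⟪b i, y⟫_ℂ‖ ≤ ‖x‖ * ‖y‖ := by
  refine (norm_sum_le _ _).trans (le_of_sq_le_sq ?_ (by positivity))
  have h1 : ∑ i ∈ s, ‖⟪x, b i⟫_ℂ‖ ^ 2 ≤ ‖x‖ ^ 2 := by
    simpa only [norm_inner_symm] using b.orthonormal.sum_inner_products_le x (s := s)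
  calc (∑ i ∈ s, ‖⟪x, b i⟫_ℂ * ⟪b i, y⟫_ℂ‖) ^ 2
      = (∑ i ∈ s, ‖⟪x, b i⟫_ℂ‖ * ‖⟪b i, y⟫_ℂ‖) ^ 2 := by simp only [norm_mul]
    _ ≤ (∑ i ∈ s, ‖⟪x, b i⟫_ℂ‖ ^ 2) * ∑ i ∈ s, ‖⟪b i, y⟫_ℂ‖ ^ 2 :=
        Finset.sum_mul_sq_le_sq_mul_sq _ _ _
    _ ≤ ‖x‖ ^ 2 * ‖y‖ ^ 2 :=
        mul_le_mul h1 (b.orthonormal.sum_inner_products_le y)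
          (Finset.sum_nonneg fun _ _ => by positivity) (by positivity)
    _ = _ := by ring

section Expansion

variable {v : Basis (Fin d) ℝ (Euc d)}

/-- Pointwise Parseval integrated by dominated convergence along finite sets; countability of the
basis makes that limit admissible. -/
theorem hasSum_integral_inner_hilbertBasis {ι : Type*} (b : HilbertBasis ι ℂ (Fibre v))
    {K : Euc d → Fibre v} (hK : AEStronglyMeasurable K) {A : ℝ} (hA : ∀ k, ‖K k‖ ≤ A * decay k)
    (φ : HTau v) :
    HasSum (fun i => ∫ k, ⟪⟪b i, K k⟫_ℂ • b i,
        (φ : Euc d →ₘ[(volume : Measure (Euc d))] Fibre v) k⟫_ℂ)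
      (∫ k, ⟪K k, (φ : Euc d →ₘ[(volume : Measure (Euc d))] Fibre v) k⟫_ℂ) := by
  have : Countable ι := b.countable
  have h0 : ∀ i k, ⟪⟪b i, K k⟫_ℂ • b i,
      (φ : Euc d →ₘ[(volume : Measure (Euc d))] Fibre v) k⟫_ℂ
        = ⟪K k, b i⟫_ℂ * ⟪b i, (φ : Euc d →ₘ[(volume : Measure (Euc d))] Fibre v) k⟫_ℂ :=
    fun i k => by rw [inner_smul_left, inner_conj_symm]
  simp only [h0]
  have hφ := (φ : Euc d →ₘ[(volume : Measure (Euc d))] Fibre v).aestronglyMeasurable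
  have hm : ∀ i, AEStronglyMeasurable (fun k => ⟪K k, b i⟫_ℂ *
      ⟪b i, (φ : Euc d →ₘ[(volume : Measure (Euc d))] Fibre v) k⟫_ℂ) volume := fun i =>
    (hK.inner aestronglyMeasurable_const).mul (aestronglyMeasurable_const.inner hφ)
  have hint := HTau.integrable_norm_mul_norm v hK hA φ
  have hi : ∀ i, Integrable (fun k => ⟪K k, b i⟫_ℂ *
      ⟪b i, (φ : Euc d →ₘ[(volume : Measure (Euc d))] Fibre v) k⟫_ℂ) := fun i => by
    refine hint.mono' (hm i) (Filter.Eventually.of_forall fun k => ?_)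
    simpa using b.norm_sum_inner_mul_inner_le {i} (K k)
      ((φ : Euc d →ₘ[(volume : Measure (Euc d))] Fibre v) k)
  have h1 : Filter.Tendsto (fun s : Finset ι => ∫ k, ∑ i ∈ s, ⟪K k, b i⟫_ℂ *
      ⟪b i, (φ : Euc d →ₘ[(volume : Measure (Euc d))] Fibre v) k⟫_ℂ) Filter.atTop
      (nhds (∫ k, ⟪K k, (φ : Euc d →ₘ[(volume : Measure (Euc d))] Fibre v) k⟫_ℂ)) := by
    refine tendsto_integral_filter_of_dominated_convergence _
      (Filter.Eventually.of_forall fun s => Finset.aestronglyMeasurable_fun_sum _ fun i _ => hm i)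
      (Filter.Eventually.of_forall fun s => Filter.Eventually.of_forall fun k =>
        b.norm_sum_inner_mul_inner_le s _ _) hint
      (Filter.Eventually.of_forall fun k => b.hasSum_inner_mul_inner _ _)
  have h2 : ∀ s : Finset ι, ∫ k, ∑ i ∈ s, ⟪K k, b i⟫_ℂ *
      ⟪b i, (φ : Euc d →ₘ[(volume : Measure (Euc d))] Fibre v) k⟫_ℂ
        = ∑ i ∈ s, ∫ k, ⟪K k, b i⟫_ℂ *
          ⟪b i, (φ : Euc d →ₘ[(volume : Measure (Euc d))] Fibre v) k⟫_ℂ :=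
    fun s => integral_finsetSum s fun i _ => hi i
  simp only [h2] at h1
  exact h1

variable {a : Euc d × Euc d → ℂ} {c : lattice v → Euc d → ℂ}

/-- Both sides of the duality relation expand over a Hilbert basis of the fibre, and corresponding
terms agree by the elementary case with `f = ⟪b i, χ⟫` and `ζ = b i`. -/
theorem isWeylImage_HTau_adjoint (hc : IsFourierExpansion v a c) {S : L2 d →L[ℂ] L2 d}
    (hS : ∀ (h : L2 d) (H : Euc d → ℂ), (∀ᵐ x, HasSum (fun γ : lattice v =>
        conj (c γ (x - (1 / 2 : ℝ) • (γ : Euc d))) • h (x - (γ : Euc d))) (H x)) →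
      S h =ᵐ[volume] H) (ψ : L2 d) :
    IsWeylImage (scalarSymbol (Fibre v) fun z => a (-z.2, z.1))
      (zak v ψ : Euc d →ₘ[(volume : Measure (Euc d))] Fibre v)
      (zak v (ContinuousLinearMap.adjoint S ψ) :
        Euc d →ₘ[(volume : Measure (Euc d))] Fibre v) := by
  intro χ
  obtain ⟨w, b, _⟩ := exists_hilbertBasis ℂ (Fibre v)
  obtain ⟨A, _, hA⟩ := (hasDecay_schwartz χ).norm_le
  obtain ⟨A', hA'⟩ := exists_norm_latticeOpAdjFourier_le hc χ
  have h1 := hasSum_integral_inner_hilbertBasis b χ.continuous.aestronglyMeasurable hA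
    (zak v (ContinuousLinearMap.adjoint S ψ))
  have h2 := hasSum_integral_inner_hilbertBasis b
    (continuous_latticeOpAdjFourier hc χ).aestronglyMeasurable hA' (zak v ψ)
  have h3 : ∀ k, weylSchwartz (fun z => ContinuousLinearMap.adjoint
      (scalarSymbol (Fibre v) (fun z => a (-z.2, z.1)) z)) χ k = latticeOpAdjFourier c χ k :=
    weylSchwartz_periodic_position hc (hasDecay_schwartz χ)
  simp only [h3]
  refine h1.unique (h2.congr_fun fun i => ?_)
  have h4 := integral_inner_zak_adjoint_smul hc hS
    (χ.postcompCLM (innerSL ℂ (b i))) (b i) ψ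
  refine Eq.trans h4 ?_
  congr 1
  funext k
  rw [← innerSL_apply_apply ℂ (b i) (latticeOpAdjFourier c χ k), clm_latticeOpAdjFourier hc]
  rfl

end Expansion

/-! ### Uniqueness of the quantization on `H_τ`. -/

section Unique

variable {v : Basis (Fin d) ℝ (Euc d)}

theorem HTau.locallyIntegrable_inner (φ : HTau v) (ζ : Fibre v) : LocallyIntegrable (fun k =>
    ⟪ζ, (φ : Euc d →ₘ[(volume : Measure (Euc d))] Fibre v) k⟫_ℂ) := by
  refine locallyIntegrable_iff.2 fun K hK => ?_
  have : IsFiniteMeasure (volume.restrict K) := ⟨by simpa using hK.measure_lt_top⟩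
  exact ((φ.2.1 K hK).integrable one_le_two).const_inner ζ

/-- Test functions `u ζ` with `u` smooth of compact support determine each scalar component almost
everywhere; countably many `ζ` suffice. -/
theorem HTau.eq_of_forall_schwartz {f g : HTau v}
    (h : ∀ χ : 𝓢(Euc d, Fibre v),
      ∫ k, ⟪χ k, (f : Euc d →ₘ[(volume : Measure (Euc d))] Fibre v) k⟫_ℂ
        = ∫ k, ⟪χ k, (g : Euc d →ₘ[(volume : Measure (Euc d))] Fibre v) k⟫_ℂ) : f = g := by
  have h1 : ∀ ζ : Fibre v, ∀ᵐ k : Euc d,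
      ⟪ζ, (f : Euc d →ₘ[(volume : Measure (Euc d))] Fibre v) k⟫_ℂ
        = ⟪ζ, (g : Euc d →ₘ[(volume : Measure (Euc d))] Fibre v) k⟫_ℂ := by
    intro ζ
    refine ae_eq_of_integral_contDiff_smul_eq (f.locallyIntegrable_inner ζ)
      (g.locallyIntegrable_inner ζ) fun u hu hc => ?_
    have hc' : HasCompactSupport fun k => (u k : ℂ) := hc.comp_left (g := ((↑) : ℝ → ℂ)) (by simp)
    have h2 := h ((hc'.toSchwartzMap (Complex.ofRealCLM.contDiff.comp hu)).postcompCLM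
      (ContinuousLinearMap.toSpanSingleton ℂ ζ))
    have h3 : ∀ (k : Euc d) (η : Fibre v), u k • ⟪ζ, η⟫_ℂ = ⟪((u k : ℝ) : ℂ) • ζ, η⟫_ℂ := by
      intro k η
      rw [inner_smul_left, Complex.conj_ofReal, Complex.real_smul]
    simp only [h3]
    exact h2
  obtain ⟨D, hDc, hD⟩ := TopologicalSpace.exists_countable_dense (Fibre v)
  apply Subtype.ext
  apply AEEqFun.ext
  filter_upwards [(ae_ball_iff hDc).2 fun ζ _ => h1 ζ] with k hk
  exact hD.eq_of_inner_right ℂ hk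

theorem IsWeylOpHTau.unique {ε : ℝ} {b : Euc d × Euc d → (Fibre v →L[ℂ] Fibre v)}
    {B B' : HTau v →L[ℂ] HTau v} (hB : IsWeylOpHTau v ε b B) (hB' : IsWeylOpHTau v ε b B') :
    B = B' :=
  ContinuousLinearMap.ext fun φ =>
    HTau.eq_of_forall_schwartz fun χ => (hB φ χ).trans (hB' φ χ).symm

end Unique

/-! ### Existence of both quantizations and their conjugation. -/

section Conjugation

variable {v : Basis (Fin d) ℝ (Euc d)}

/-- The two quantizations of a periodic symbol exist and are conjugate by the Zak transform. -/
theorem exists_isWeylOp {ε : ℝ} {a b : Euc d × Euc d → ℂ} (ha : IsSymbol a)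
    (hper : ∀ g ∈ lattice (dualBasis v), ∀ r k, a (r, k + g) = a (r, k))
    (hb : ∀ k r, b (k, r) = a (r, k)) :
    ∃ (T : L2 d →L[ℂ] L2 d) (B : HTau v →L[ℂ] HTau v), IsWeylOpL2 ε a T ∧
      IsWeylOpHTau v ε (scalarSymbol (Fibre v) b) B ∧ ∀ ψ, B (zak v ψ) = zak v (T ψ) := by
  -- For fixed `ε` the scaling is absorbed into the symbol; `ε = 0` is allowed and no estimate
  -- uniform in `ε` is required.
  set α : Euc d × Euc d → ℂ := fun z => a (ε • z.1, z.2)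
  have hα : IsSymbol α := ha.comp_continuousLinearMap
    ((ε • ContinuousLinearMap.fst ℝ (Euc d) (Euc d)).prod (ContinuousLinearMap.snd ℝ _ _))
  have hαp : IsPeriodic v α := fun g hg x k => hper g hg (ε • x) k
  have hc := isFourierExpansion_fourierCoef hα hαp
  obtain ⟨S, hS⟩ := exists_latticeOpL2 hc
  set T : L2 d →L[ℂ] L2 d := ContinuousLinearMap.adjoint S
  -- `B` is defined as the conjugate of `T`, so the intertwining is immediate; the substance is that
  -- this `B` is a Weyl quantization.
  refine ⟨T, (zak v).toContinuousLinearEquiv.toContinuousLinearMap.comp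
    (T.comp (zak v).symm.toContinuousLinearEquiv.toContinuousLinearMap),
    isWeylImage_L2_adjoint hc hS, fun φ => ?_, fun ψ => ?_⟩
  · have h := isWeylImage_HTau_adjoint hc hS ((zak v).symm φ)
    rw [LinearIsometryEquiv.apply_symm_apply] at h
    have hσ : (fun z : Euc d × Euc d => scalarSymbol (Fibre v) b (z.1, -(ε • z.2)))
        = scalarSymbol (Fibre v) fun z => α (-z.2, z.1) := by
      funext z
      simp only [scalarSymbol, hb, α, smul_neg]
    rw [hσ]
    exact h
  · change zak v (T ((zak v).symm (zak v ψ))) = _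
    rw [LinearIsometryEquiv.symm_apply_apply]

end Conjugation

end

end BlochZak

theorem mainTheorem6 (d : ℕ) (v : Module.Basis (Fin d) ℝ (EuclideanSpace ℝ (Fin d))) :
    (∃! U : L2 d ≃ₗᵢ[ℂ] HTau v, IsZakTransform v U) ∧
    ∀ U : L2 d ≃ₗᵢ[ℂ] HTau v, IsZakTransform v U →
    ∀ (ε₀ : ℝ) (a b : ℝ → Euc d × Euc d → ℂ), 0 < ε₀ →
      IsSemiclassicalSymbol ε₀ a →
      (∀ ε ∈ Set.Ico 0 ε₀, ∀ g ∈ lattice (dualBasis v), ∀ r k, a ε (r, k + g) = a ε (r, k)) →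
      (∀ ε k r, b ε (k, r) = a ε (r, k)) →
      IsSemiclassicalSymbol ε₀ b ∧
      IsTauEquivariantSymbol v ε₀ (fun ε => scalarSymbol (Fibre v) (b ε)) ∧
      ∀ ε ∈ Set.Ico 0 ε₀,
        (∃! T : L2 d →L[ℂ] L2 d, IsWeylOpL2 ε (a ε) T) ∧
        (∃! B : HTau v →L[ℂ] HTau v, IsWeylOpHTau v ε (scalarSymbol (Fibre v) (b ε)) B) ∧
        ∀ (T : L2 d →L[ℂ] L2 d) (B : HTau v →L[ℂ] HTau v),
          IsWeylOpL2 ε (a ε) T → IsWeylOpHTau v ε (scalarSymbol (Fibre v) (b ε)) B →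
            ∀ ψ : L2 d, T ψ = U.symm (B (U ψ)) := by
  refine ⟨⟨zak v, isZakTransform_zak v, fun U hU =>
    isZakTransform_unique v hU (isZakTransform_zak v)⟩, ?_⟩
  intro U hU ε₀ a b _ ha hper hb
  -- Uniqueness replaces an arbitrary Zak transform, and below arbitrary quantizations, by the ones
  -- constructed.
  obtain rfl : U = zak v := isZakTransform_unique v hU (isZakTransform_zak v)
  have hbs : IsSemiclassicalSymbol ε₀ b := by
    have h : b = fun ε z => a ε z.swap := by
      funext ε ⟨k, r⟩
      exact hb ε k r
    rw [h]
    exact ha.comp_swap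
  refine ⟨hbs, isTauEquivariantSymbol_scalarSymbol v hbs fun ε hε g hg k r => ?_, fun ε hε => ?_⟩
  · rw [hb, hb, hper ε hε g hg]
  · obtain ⟨T, B, hT, hB, hTB⟩ := exists_isWeylOp (ε := ε) (ha.1 ε hε) (hper ε hε) (hb ε)
    refine ⟨⟨T, hT, fun T' hT' => hT'.unique hT⟩, ⟨B, hB, fun B' hB' => hB'.unique hB⟩,
      fun T' B' hT' hB' ψ => ?_⟩
    rw [hT'.unique hT, hB'.unique hB, hTB, LinearIsometryEquiv.symm_apply_apply]
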